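/- Let $G=(V,E)$ be a finite simple graph with maximum degree $\Delta$, whose vertex set is partitioned into blocks $V=V_1\sqcup\dots\sqcup V_l$, each of size exactly $b\ge 1$, and let $w(v)\ge 0$ be a real weight for each vertex $v$; write $w(S)=\sum_{v\in S}w(v)$ for $S\subseteq V$. An independent transversal is an independent set $I\subseteq V$ of $G$ that contains exactly one vertex of each block. (1) If $4\Delta\le b\le 8\Delta$, then there is an independent transversal $I$ of $G$ with $$w(I)\le w(V)\,\frac{2}{b+4\sqrt{(b-4\Delta)\Delta}} .$$ (2) If $b\ge 8\Delta$, then there is an independent transversal $I$ of $G$ with $$w(I)\le \frac{w(V)}{b}.$$ (3) Furthermore, independent transversals whose weight is at most $(1+n^{-\Theta(1)})$ times these upper bounds, where $n=|V|$, can be found in polynomial time with high probability. Precisely: for every constant $c\in\mathbb N$ there are a single randomized algorithm (a program for a random-access machine that draws fair random bits and has logarithmic cost) and a polynomial $p$ such that the following holds for every such $G$ with $n\ge 1$ vertices, every such partition and all non-negative rational weights. Given the graph, the partition and the weights (in binary) as input of bit length $L$, with probability at least $1-n^{-c}$ the algorithm halts within time $p(L)$ and outputs an independent transversal $I$ such that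 $$w(I)\le (1+n^{-c})\,w(V)\,\frac{2}{b+4\sqrt{(b-4\Delta)\Delta}}\quad\text{if } 4\Delta\le b\le 8\Delta,\qquad w(I)\le(1+n^{-c})\,\frac{w(V)}{b}\quad\text{if } b\ge 8\Delta.$$ -/

import Mathlib

/-! ## Transversals of a vertex-partitioned graph -/

/-- `blk : V → ι` sends a vertex to (the index of) its block.  A transversal contains exactly one
vertex from each block. -/
def IsTransversal {V ι : Type*} (blk : V → ι) (I : Finset V) : Prop :=
  ∀ i : ι, ∃! v : V, v ∈ I ∧ blk v = i

/-- An independent transversal: a transversal that is an independent set of `G`. -/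
def IsIndepTransversal {V ι : Type*} (G : SimpleGraph V) (blk : V → ι) (I : Finset V) : Prop :=
  IsTransversal blk I ∧ G.IsIndepSet (I : Set V)

/-! ## A randomized random-access machine with logarithmic cost

Programs are finite syntax trees.  The store consists of natural-number variables and of arrays of
natural numbers (with indirect addressing).  Every elementary operation is charged the bit lengths
of the numbers it handles, and drawing `k` fair random bits is charged `k`. -/

namespace RandRAM

inductive BinOp where
  | add | sub | mul | div | mod | lt | eq

/-- `sub` is truncated subtraction, `div` and `mod` are division with remainder, and a comparison
returns `1` (true) or `0` (false). -/
def BinOp.eval : BinOp → ℕ → ℕ → ℕ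
  | .add, a, b => a + b
  | .sub, a, b => a - b
  | .mul, a, b => a * b
  | .div, a, b => a / b
  | .mod, a, b => a % b
  | .lt, a, b => if a < b then 1 else 0
  | .eq, a, b => if a = b then 1 else 0

/-- Arithmetic expressions: literals, variables, array reads, binary operations. -/
inductive Expr where
  | lit (k : ℕ)
  | var (x : ℕ)
  | read (a : ℕ) (e : Expr)
  | bin (o : BinOp) (e f : Expr)

/-- Commands.  `flip x e` stores in `x` a number formed by `e` fresh fair random bits. -/
inductive Cmd where
  | skip
  | assign (x : ℕ) (e : Expr)
  | write (a : ℕ) (e f : Expr)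
  | flip (x : ℕ) (e : Expr)
  | seq (c d : Cmd)
  | cond (e : Expr) (c d : Cmd)
  | loop (e : Expr) (c : Cmd)

/-- The contents of the variables and of the arrays. -/
structure Store where
  var : ℕ → ℕ
  arr : ℕ → ℕ → ℕ

/-- The variable `x` gets the value `k`. -/
def Store.setVar (s : Store) (x k : ℕ) : Store :=
  { s with var := Function.update s.var x k }

/-- Entry `j` of the array `a` gets the value `k`. -/
def Store.setArr (s : Store) (a j k : ℕ) : Store :=
  { s with arr := Function.update s.arr a (Function.update (s.arr a) j k) }

/-- The value of an expression. -/
def Expr.eval (s : Store) : Expr → ℕ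
  | .lit k => k
  | .var x => s.var x
  | .read a e => s.arr a (e.eval s)
  | .bin o e f => o.eval (e.eval s) (f.eval s)

/-- The cost of evaluating an expression: one plus the bit length of the value, for the expression
and for each of its subexpressions. -/
def Expr.cost (s : Store) : Expr → ℕ
  | .lit k => 1 + Nat.size k
  | .var x => 1 + Nat.size (s.var x)
  | .read a e => e.cost s + (1 + Nat.size (s.arr a (e.eval s)))
  | .bin o e f => e.cost s + f.cost s + (1 + Nat.size (o.eval (e.eval s) (f.eval s)))

/-- A configuration: the commands still to be executed (in order), the store, and the time used so
far.  The machine has halted when nothing is left to be executed. -/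
structure Config where
  todo : List Cmd
  store : Store
  time : ℕ

/-- One step of the machine, as a probability distribution on the next configuration. A step of a
machine that has not halted takes time at least one. -/
noncomputable def step : Config → PMF Config
  | ⟨[], s, t⟩ => PMF.pure ⟨[], s, t⟩
  | ⟨.skip :: K, s, t⟩ => PMF.pure ⟨K, s, t + 1⟩
  | ⟨.assign x e :: K, s, t⟩ => PMF.pure ⟨K, s.setVar x (e.eval s), t + (1 + e.cost s)⟩
  | ⟨.write a e f :: K, s, t⟩ =>
      PMF.pure ⟨K, s.setArr a (e.eval s) (f.eval s), t + (1 + e.cost s + f.cost s)⟩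
  | ⟨.flip x e :: K, s, t⟩ =>
      (PMF.uniformOfFintype (Fin (2 ^ e.eval s))).map
        fun r => ⟨K, s.setVar x r.val, t + (1 + e.cost s + e.eval s)⟩
  | ⟨.seq c d :: K, s, t⟩ => PMF.pure ⟨c :: d :: K, s, t + 1⟩
  | ⟨.cond e c d :: K, s, t⟩ =>
      PMF.pure ⟨(if e.eval s ≠ 0 then c else d) :: K, s, t + (1 + e.cost s)⟩
  | ⟨.loop e c :: K, s, t⟩ =>
      PMF.pure ⟨if e.eval s ≠ 0 then c :: .loop e c :: K else K, s, t + (1 + e.cost s)⟩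

/-- The distribution of the configuration after `m` steps. -/
noncomputable def steps : ℕ → Config → PMF Config
  | 0, C => PMF.pure C
  | m + 1, C => (step C).bind (steps m)

/-- The probability that the program `P`, started on the store `s`, halts within time `T` with a
final store satisfying `good`.  (Since every step takes time at least one, a run that halts within
time `T` makes at most `T` steps.) -/
noncomputable def probHaltsWithin (P : Cmd) (s : Store) (T : ℕ) (good : Store → Prop) :
    ENNReal :=
  (steps T ⟨[P], s, 0⟩).toOuterMeasure {C | C.todo = [] ∧ C.time ≤ T ∧ good C.store}

end RandRAM

/-! ## Weighted partitioned graphs as inputs, vertex sets as outputs -/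

/-- The input store: variable `0` holds the number `n` of vertices and variable `1` the number `l`
of blocks; array `0` is the adjacency matrix (row by row), array `1` lists the blocks of the
vertices, arrays `2` and `3` list the numerators and the denominators of the weights.
All else is `0`. -/
def inputStore {n l : ℕ} (G : SimpleGraph (Fin n)) [DecidableRel G.Adj] (blk : Fin n → Fin l)
    (w : Fin n → ℚ≥0) : RandRAM.Store where
  var x := if x = 0 then n else if x = 1 then l else 0
  arr a k :=
    if a = 0 then
      if ∃ u v : Fin n, k = u.val * n + v.val ∧ G.Adj u v then 1 else 0
    else if h : k < n then
      if a = 1 then (blk ⟨k, h⟩).val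
      else if a = 2 then (w ⟨k, h⟩).num
      else if a = 3 then (w ⟨k, h⟩).den
      else 0
    else 0

/-- The bit length of the input. -/
def inputLength {n l : ℕ} (blk : Fin n → Fin l) (w : Fin n → ℚ≥0) : ℕ :=
  Nat.size n + Nat.size l + n * n
    + ∑ v, (Nat.size (blk v).val + Nat.size (w v).num + Nat.size (w v).den)

/-- The output: the set of vertices `v` whose entry in array `4` is nonzero. -/
def outputSet (n : ℕ) (s : RandRAM.Store) : Finset (Fin n) :=
  Finset.univ.filter fun v => s.arr 4 v.val ≠ 0

/-! Keep only the m lightest vertices of each block, where m = 4Δ (m = 1 if Δ = 0); they form A. As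
long as some block is empty, draw a random vertex v of A from an empty block. If v has no neighbour
in the partial transversal, it joins; otherwise v is dropped and one of its neighbours u is removed.
Such a conflict (v, u) uses up exactly two draws, that of v and that of u. Hence the draws from a
block are the end points of the logged conflicts in this block, followed by its present vertex
(`exists_log`). Prescribed vertices head the draws of all blocks with probability at most p per
vertex (`listAvg_explains_le`), where p = 1/m for uniform draws.

Only the projections of the log to the blocks matter, so conflicts that share no block commute. Up
to this commutation, the part of the log that matters for block i is a word of the recursive shape w
w' (v, u): here (v, u) is the last conflict in block i, w explains the block of u, and w' explains
what came earlier in block i (`exists_word`). With weight m⁻² for each conflict, the generating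
function satisfies F ≤ 1 + mΔ·m⁻²·F², and F ≤ 2 follows from 4Δ ≤ m. If h vertices of block i are
forbidden, the recursion becomes linear and gives 2m/(m + h) (`sum_words_le`).

There are two consequences. First, every draw yields its own word that explains the draws, and the
expected number of such words is at most 2 for each block; so a run of T steps is unfinished with
probability at most 2l/T. Second, for a set H of h kept vertices of block i, cut the log at the
first appearance of H in this block: the run ends with a vertex of H in block i with probability at
most (h/m)·2m/(m + h) = 2h/(m + h).

For the weights, compare with κ times the counting measure of each block, layer by layer. A layer of
heavy vertices that contains h > 0 kept ones contains all b - m discarded ones, so 2h/(m + h) ≤ κ(h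
+ b - m) is what is needed (`IsRate`). Since (h + m)(h + b - m)/h = h + b + m(b - m)/h, the
arithmetic-geometric mean inequality gives the first bound, and for b ≥ 2m the worst case h = m
gives 1/b. Existence follows as T grows.

For the algorithm, δ = n⁻ᶜ. One run of polynomial length succeeds within the factor 1 + δ with
probability at least δ/4 by Markov's inequality, and polynomially many independent runs suffice.
Reducing random bits modulo m makes the draws slightly non-uniform, which costs a factor (1 + ε)ᵀ.
The program is verified by a logic that also tracks word lengths and time, on runs that read their
random numbers from a list. -/

/-! ### Averages over lists of random numbers -/

/-- The average of `F` over all lists of length `T` with entries in `Ω`. -/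
noncomputable def listAvg (Ω : Type*) [Fintype Ω] : ℕ → (List Ω → ℝ) → ℝ
  | 0, F => F []
  | T + 1, F => (∑ r, listAvg Ω T fun l => F (r :: l)) / Fintype.card Ω

section listAvg

variable {Ω : Type*} [Fintype Ω]

theorem listAvg_mono {T : ℕ} {F F' : List Ω → ℝ} (h : ∀ l, l.length = T → F l ≤ F' l) :
    listAvg Ω T F ≤ listAvg Ω T F' := by
  induction T generalizing F F' with
  | zero => exact h [] rfl
  | succ T ih =>
    unfold listAvg
    gcongr with r
    exact ih fun l hl => h _ (by simp [hl])

theorem listAvg_congr {T : ℕ} {F F' : List Ω → ℝ} (h : ∀ l, l.length = T → F l = F' l) :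
    listAvg Ω T F = listAvg Ω T F' :=
  le_antisymm (listAvg_mono fun l hl => (h l hl).le) (listAvg_mono fun l hl => (h l hl).ge)

theorem listAvg_const [Nonempty Ω] (T : ℕ) (a : ℝ) : listAvg Ω T (fun _ => a) = a := by
  induction T with
  | zero => rfl
  | succ T ih => simp [listAvg, ih]

theorem listAvg_sum {α : Type*} (T : ℕ) (s : Finset α) (F : α → List Ω → ℝ) :
    listAvg Ω T (fun l => ∑ a ∈ s, F a l) = ∑ a ∈ s, listAvg Ω T (F a) := by
  induction T generalizing F with
  | zero => rfl
  | succ T ih =>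
    simp only [listAvg, ih]
    rw [Finset.sum_comm, Finset.sum_div]

theorem listAvg_add (T : ℕ) (F F' : List Ω → ℝ) :
    listAvg Ω T (fun l => F l + F' l) = listAvg Ω T F + listAvg Ω T F' := by
  induction T generalizing F F' with
  | zero => rfl
  | succ T ih => simp only [listAvg, ih, Finset.sum_add_distrib, add_div]

theorem listAvg_const_mul (T : ℕ) (a : ℝ) (F : List Ω → ℝ) :
    listAvg Ω T (fun l => a * F l) = a * listAvg Ω T F := by
  induction T generalizing F with
  | zero => rfl
  | succ T ih => simp only [listAvg, ih, ← Finset.mul_sum, mul_div_assoc]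

theorem listAvg_nonneg {T : ℕ} {F : List Ω → ℝ} (h : ∀ l, l.length = T → 0 ≤ F l) :
    0 ≤ listAvg Ω T F := by
  induction T generalizing F with
  | zero => exact h [] rfl
  | succ T ih =>
    unfold listAvg
    have : ∀ r, 0 ≤ listAvg Ω T fun l => F (r :: l) := fun r => ih fun l hl => h _ (by simp [hl])
    exact div_nonneg (Finset.sum_nonneg fun r _ => this r) (by positivity)

theorem listAvg_append (T T' : ℕ) (F : List Ω → ℝ) :
    listAvg Ω (T + T') F = listAvg Ω T fun l => listAvg Ω T' fun l' => F (l ++ l') := by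
  induction T generalizing F with
  | zero => simp [listAvg]
  | succ T ih =>
    rw [show T + 1 + T' = T + T' + 1 by omega]
    simp only [listAvg, ih, List.cons_append]

end listAvg

/-! ### Runs with a prescribed list of random numbers -/

namespace RandRAM

/-- The run of the machine in which the results of the `flip` commands, all of width `k`, are read
from a list. -/
def tapeRun (k : ℕ) : ℕ → Config → List (Fin (2 ^ k)) → Option Config
  | 0, C, _ => some C
  | _ + 1, ⟨[], s, t⟩, _ => some ⟨[], s, t⟩
  | m + 1, ⟨.skip :: K, s, t⟩, τ => tapeRun k m ⟨K, s, t + 1⟩ τ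
  | m + 1, ⟨.assign x e :: K, s, t⟩, τ =>
      tapeRun k m ⟨K, s.setVar x (e.eval s), t + (1 + e.cost s)⟩ τ
  | m + 1, ⟨.write a e f :: K, s, t⟩, τ =>
      tapeRun k m ⟨K, s.setArr a (e.eval s) (f.eval s), t + (1 + e.cost s + f.cost s)⟩ τ
  | _ + 1, ⟨.flip _ _ :: _, _, _⟩, [] => none
  | m + 1, ⟨.flip x e :: K, s, t⟩, r :: τ =>
      if e.eval s = k then
        tapeRun k m ⟨K, s.setVar x r.val, t + (1 + e.cost s + e.eval s)⟩ τ
      else none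
  | m + 1, ⟨.seq c d :: K, s, t⟩, τ => tapeRun k m ⟨c :: d :: K, s, t + 1⟩ τ
  | m + 1, ⟨.cond e c d :: K, s, t⟩, τ =>
      tapeRun k m ⟨(if e.eval s ≠ 0 then c else d) :: K, s, t + (1 + e.cost s)⟩ τ
  | m + 1, ⟨.loop e c :: K, s, t⟩, τ =>
      tapeRun k m ⟨if e.eval s ≠ 0 then c :: .loop e c :: K else K, s, t + (1 + e.cost s)⟩ τ

theorem tapeRun_nil (k m : ℕ) (s : Store) (t : ℕ) (τ : List (Fin (2 ^ k))) :
    tapeRun k m ⟨[], s, t⟩ τ = some ⟨[], s, t⟩ := by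
  cases m <;> rfl

theorem toOuterMeasure_pure_bind_steps (m : ℕ) (C C' : Config) (h : step C = PMF.pure C') :
    steps (m + 1) C = steps m C' := by
  simp [steps, h]

open Classical in
-- All steps but `flip` are deterministic, and at a `flip` averaging over the head of the list is
-- the uniform distribution. It is only an inequality because an exhausted list or a `flip` of
-- another width counts as failure; the number of steps and the length of the list are unrelated.
theorem listAvg_tapeRun_le (k : ℕ) (A : Config → Prop) (m N : ℕ) (C : Config)  :
    ENNReal.ofReal (listAvg (Fin (2 ^ k)) N fun τ =>
        if ∃ C', tapeRun k m C τ = some C' ∧ A C' then 1 else 0) ≤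
      (steps m C).toOuterMeasure {C | A C} := by
  induction m generalizing N C with
  | zero =>
    by_cases h : A C <;> simp [tapeRun, steps, listAvg_const, h]
  | succ m ih =>
    obtain ⟨K, s, t⟩ := C
    match K with
    | [] =>
      rw [toOuterMeasure_pure_bind_steps m _ _ rfl]
      refine le_trans (le_of_eq ?_) (ih N _)
      simp only [tapeRun_nil]
    | .skip :: K => rw [toOuterMeasure_pure_bind_steps m _ _ rfl]; exact ih N _
    | .assign x e :: K => rw [toOuterMeasure_pure_bind_steps m _ _ rfl]; exact ih N _
    | .write a e f :: K => rw [toOuterMeasure_pure_bind_steps m _ _ rfl]; exact ih N _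
    | .seq c d :: K => rw [toOuterMeasure_pure_bind_steps m _ _ rfl]; exact ih N _
    | .cond e c d :: K => rw [toOuterMeasure_pure_bind_steps m _ _ rfl]; exact ih N _
    | .loop e c :: K => rw [toOuterMeasure_pure_bind_steps m _ _ rfl]; exact ih N _
    | .flip x e :: K =>
      cases N with
      | zero => simp [listAvg, tapeRun]
      | succ N =>
        by_cases he : e.eval s = k
        · subst he
          have hs : steps (m + 1) ⟨.flip x e :: K, s, t⟩ =
              (PMF.uniformOfFintype (Fin (2 ^ e.eval s))).bind fun r =>
                steps m ⟨K, s.setVar x r.val, t + (1 + e.cost s + e.eval s)⟩ := by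
            simp [steps, step, PMF.bind_map, Function.comp_def]
          rw [hs, PMF.toOuterMeasure_bind_apply, tsum_fintype]
          simp only [listAvg, tapeRun, if_true, PMF.uniformOfFintype_apply]
          rw [Finset.sum_div, ENNReal.ofReal_sum_of_nonneg]
          · refine Finset.sum_le_sum fun r _ => ?_
            refine le_trans (le_of_eq ?_) (mul_le_mul_right (ih N _) _)
            rw [div_eq_inv_mul, ENNReal.ofReal_mul (by positivity),
              ENNReal.ofReal_inv_of_pos (by simp), ENNReal.ofReal_natCast]
          · intro r _
            refine div_nonneg (listAvg_nonneg fun l _ => ?_) (by positivity)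
            split_ifs <;> norm_num
        · refine le_trans (le_of_eq ?_) zero_le
          simp [listAvg, tapeRun, he, listAvg_const]

end RandRAM

/-! ### Words of conflicts and their generating function -/

namespace LazyResampling

open Finset

section Words

/-- Pairs of adjacent vertices of `A` in distinct blocks. -/
def IsConflict {V ι : Type*} (blk : V → ι) (G : SimpleGraph V) (A : Finset V) (x : V × V) : Prop :=
  G.Adj x.1 x.2 ∧ blk x.1 ≠ blk x.2 ∧ x.1 ∈ A ∧ x.2 ∈ A

theorem IsConflict.swap {V ι : Type*} {blk : V → ι} {G : SimpleGraph V} {A : Finset V}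
    {x : V × V} (h : IsConflict blk G A x) : IsConflict blk G A (x.2, x.1) :=
  ⟨h.1.symm, h.2.1.symm, h.2.2.2, h.2.2.1⟩

variable {V ι : Type*} [DecidableEq ι] (blk : V → ι)

/-- The entries of a list that lie in block `k`. -/
def proj (k : ι) (l : List V) : List V := l.filter fun v => blk v = k

/-- The end points of a list of edges. -/
def ends (c : List (V × V)) : List V := c.flatMap fun x => [x.1, x.2]

@[simp] theorem ends_nil : ends ([] : List (V × V)) = [] := rfl

@[simp] theorem ends_append (c d : List (V × V)) : ends (c ++ d) = ends c ++ ends d :=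
  List.flatMap_append

@[simp] theorem ends_cons (x : V × V) (c : List (V × V)) :
    ends (x :: c) = x.1 :: x.2 :: ends c := rfl

theorem length_ends (c : List (V × V)) : (ends c).length = 2 * c.length := by
  induction c with
  | nil => rfl
  | cons x c ih => simp [ih]; ring

@[simp] theorem proj_nil (k : ι) : proj blk k [] = [] := rfl

@[simp] theorem proj_append (k : ι) (l l' : List V) :
    proj blk k (l ++ l') = proj blk k l ++ proj blk k l' := List.filter_append ..

theorem proj_cons (k : ι) (v : V) (l : List V) :
    proj blk k (v :: l) = if blk v = k then v :: proj blk k l else proj blk k l := by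
  simp [proj, List.filter_cons]

theorem length_eq_sum_proj [Fintype ι] (l : List V) :
    l.length = ∑ k, (proj blk k l).length := by
  induction l with
  | nil => simp
  | cons v l ih =>
    have h (k : ι) : (proj blk k (v :: l)).length =
        (if blk v = k then 1 else 0) + (proj blk k l).length := by
      rw [proj_cons]; split_ifs <;> simp [add_comm]
    simp [h, sum_add_distrib, ← ih, add_comm]

theorem exists_last_split {α : Type*} (P : α → Prop) (c : List α) :
    (∀ x ∈ c, ¬ P x) ∨ ∃ c₁ x c₂, c = c₁ ++ x :: c₂ ∧ P x ∧ ∀ y ∈ c₂, ¬ P y := by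
  induction c with
  | nil => simp
  | cons a c ih =>
    rcases ih with h | ⟨c₁, x, c₂, rfl, hx, h⟩
    · by_cases ha : P a
      · exact Or.inr ⟨[], a, c, rfl, ha, h⟩
      · exact Or.inl (by simpa [ha] using h)
    · exact Or.inr ⟨a :: c₁, x, c₂, rfl, hx, h⟩

theorem exists_first_split {α : Type*} (P : α → Prop) (c : List α) :
    (∀ x ∈ c, ¬ P x) ∨ ∃ c₁ x c₂, c = c₁ ++ x :: c₂ ∧ P x ∧ ∀ y ∈ c₁, ¬ P y := by
  induction c with
  | nil => simp
  | cons a c ih =>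
    by_cases ha : P a
    · exact Or.inr ⟨[], a, c, rfl, ha, by simp⟩
    rcases ih with h | ⟨c₁, x, c₂, rfl, hx, h⟩
    · exact Or.inl (by simpa [ha] using h)
    · exact Or.inr ⟨a :: c₁, x, c₂, rfl, hx, by simpa [ha] using h⟩

theorem proj_ends_eq_nil {k : ι} {c : List (V × V)}
    (h : ∀ x ∈ c, ¬ (blk x.1 = k ∨ blk x.2 = k)) : proj blk k (ends c) = [] := by
  induction c with
  | nil => rfl
  | cons x c ih =>
    have := h x (by simp)
    push Not at this
    simp only [ends_cons, proj_cons, this.1, this.2, if_false]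
    exact ih fun y hy => h y (by simp [hy])

variable [Fintype V] [DecidableEq V] (G : SimpleGraph V) [DecidableRel G.Adj] (A : Finset V)

/-- The words that explain the draws of block `i`, all of which are made from `L`. -/
def words : ℕ → Finset V → ι → Finset (List (V × V))
  | 0, _, _ => {[]}
  | n + 1, L, i => insert [] ((L.filter fun v => blk v = i).biUnion fun v =>
      (G.neighborFinset v).biUnion fun u =>
        (words n A (blk u) ×ˢ words n L i).image fun p => p.1 ++ p.2 ++ [(v, u)])

theorem nil_mem_words (n : ℕ) (L : Finset V) (i : ι) : [] ∈ words blk G A n L i := by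
  cases n <;> simp [words]

theorem append_mem_words {n : ℕ} {L : Finset V} {v u : V} {w w' : List (V × V)}
    (hv : v ∈ L) (hu : G.Adj v u) (hw : w ∈ words blk G A n A (blk u))
    (hw' : w' ∈ words blk G A n L (blk v)) :
    w ++ w' ++ [(v, u)] ∈ words blk G A (n + 1) L (blk v) := by
  simp only [words, mem_insert, mem_biUnion, mem_filter, mem_image, mem_product,
    SimpleGraph.mem_neighborFinset]
  exact Or.inr ⟨v, ⟨hv, rfl⟩, u, hu, (w, w'), ⟨hw, hw'⟩, rfl⟩

/-- Every list of conflicts is, blockwise, a word that explains the draws of block `i`, followed by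
conflicts that do not concern block `i`. -/
theorem exists_word (n : ℕ) (c : List (V × V)) (hn : c.length ≤ n)
    (hc : ∀ x ∈ c, IsConflict blk G A x) (L : Finset V) (i : ι)
    (hL : ∀ v ∈ proj blk i (ends c), v ∈ L) :
    ∃ w r : List (V × V), w ∈ words blk G A n L i ∧ (∀ x ∈ r, IsConflict blk G A x) ∧
      w.length + r.length = c.length ∧
      (∀ k, proj blk k (ends c) = proj blk k (ends w) ++ proj blk k (ends r)) ∧
      proj blk i (ends r) = [] := by
  induction n generalizing c L i with
  | zero =>
    have : c = [] := List.length_eq_zero_iff.1 (by omega)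
    subst this
    exact ⟨[], [], by simp [words]⟩
  | succ n ih =>
    -- What follows the last conflict that meets block i is irrelevant for block i.
    rcases exists_last_split (fun x : V × V => blk x.1 = i ∨ blk x.2 = i) c with
      h | ⟨c₁, x, c₂, rfl, hx, h₂⟩
    · exact ⟨[], c, nil_mem_words .., hc, by simp, by simp, proj_ends_eq_nil blk h⟩
    -- The conflict may be oriented so that its first end point lies in block i: the end points are
    -- in distinct blocks, so no projection sees their order.
    obtain ⟨v, u, hvu, hv, hxe⟩ : ∃ v u, IsConflict blk G A (v, u) ∧ blk v = i ∧
        ∀ k, proj blk k [x.1, x.2] = proj blk k [v, u] := by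
      have hxc := hc x (by simp)
      rcases hx with hx | hx
      · exact ⟨x.1, x.2, hxc, hx, fun k => rfl⟩
      · refine ⟨x.2, x.1, hxc.swap, hx, fun k => ?_⟩
        have := hxc.2.1
        simp only [proj_cons, proj_nil]
        split_ifs <;> simp_all
    have hlen : c₁.length + c₂.length ≤ n := by simp at hn; omega
    -- The block of u is explained first, with all of A allowed; only then is block i explained,
    -- within the remainder, where the restriction to L is inherited.
    obtain ⟨w₁, r₁, hw₁, hr₁, hl₁, he₁, hj₁⟩ := ih c₁ (by omega)
      (fun y hy => hc y (by simp [hy])) A (blk u) (by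
        intro y hy
        obtain ⟨z, hz, hyz⟩ := List.mem_flatMap.1 (List.mem_filter.1 hy).1
        have := hc z (by simp [hz])
        rcases List.mem_pair.1 hyz with rfl | rfl
        exacts [this.2.2.1, this.2.2.2])
    obtain ⟨w₂, r₂, hw₂, hr₂, hl₂, he₂, hi₂⟩ := ih r₁ (by omega) hr₁ L i (by
        intro y hy
        refine hL y ?_
        simp only [ends_append, proj_append, List.mem_append]
        exact Or.inl (he₁ i ▸ List.mem_append_right _ hy))
    have hj₂ : proj blk (blk u) (ends r₂) = [] :=
      (List.append_eq_nil_iff.1 ((he₂ (blk u)).symm.trans hj₁)).2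
    have hvL : v ∈ L := by
      refine hL v ?_
      simp only [ends_append, ends_cons, proj_append, List.mem_append]
      refine Or.inr ?_
      rw [show x.1 :: x.2 :: ends c₂ = [x.1, x.2] ++ ends c₂ from rfl, proj_append, hxe]
      simp [proj_cons, hv]
    subst hv
    refine ⟨w₁ ++ w₂ ++ [(v, u)], r₂ ++ c₂, append_mem_words blk G A hvL hvu.1 hw₁ hw₂, ?_, ?_,
      fun k => ?_, ?_⟩
    · intro y hy
      rcases List.mem_append.1 hy with hy | hy
      exacts [hr₂ y hy, hc y (by simp [hy])]
    · simp; omega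
    · have e : proj blk k (ends (c₁ ++ x :: c₂)) =
          proj blk k (ends w₁) ++ proj blk k (ends w₂) ++
            (proj blk k (ends r₂) ++ proj blk k [v, u]) ++ proj blk k (ends c₂) := by
        rw [ends_append, ends_cons, show x.1 :: x.2 :: ends c₂ = [x.1, x.2] ++ ends c₂ from rfl,
          proj_append, proj_append, hxe, he₁, he₂]
        simp
      -- The remainder has no end point in the blocks of v and u, so (v, u) commutes past it.
      have e' : proj blk k (ends r₂) ++ proj blk k [v, u] =
          proj blk k [v, u] ++ proj blk k (ends r₂) := by
        by_cases h1 : blk v = k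
        · subst h1; simp [hi₂]
        by_cases h2 : blk u = k
        · subst h2; simp [hj₂]
        · simp [proj_cons, h1, h2]
      rw [e, e']
      simp
    · simp [hi₂, proj_ends_eq_nil blk h₂]

theorem sum_biUnion_le {α β : Type*} [DecidableEq β] (s : Finset α) (t : α → Finset β)
    (f : β → ℝ) (hf : ∀ b, 0 ≤ f b) : ∑ b ∈ s.biUnion t, f b ≤ ∑ a ∈ s, ∑ b ∈ t a, f b := by
  classical
  induction s using Finset.induction_on with
  | empty => simp
  | insert a s ha ih =>
    rw [biUnion_insert, sum_insert ha]
    have := sum_union_inter (s₁ := t a) (s₂ := s.biUnion t) (f := f)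
    have h0 : 0 ≤ ∑ b ∈ t a ∩ s.biUnion t, f b := sum_nonneg fun b _ => hf b
    linarith

theorem sum_image_le {α β : Type*} [DecidableEq β] (s : Finset α) (g : α → β)
    (f : β → ℝ) (hf : ∀ b, 0 ≤ f b) : ∑ b ∈ s.image g, f b ≤ ∑ a ∈ s, f (g a) := by
  rw [← biUnion_singleton]
  exact (sum_biUnion_le s (fun a => {g a}) f hf).trans_eq (by simp)

/-- This is the recursive shape of words read as a recursion for generating functions. Different
decompositions may give the same word, which only decreases the left side since x ≥ 0. -/
theorem sum_words_succ_le {n : ℕ} {L : Finset V} {i : ι} {x : ℝ} (hx : 0 ≤ x) :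
    ∑ w ∈ words blk G A (n + 1) L i, x ^ w.length ≤
      1 + ∑ v ∈ L.filter (fun v => blk v = i), ∑ u ∈ G.neighborFinset v,
        x * (∑ w ∈ words blk G A n A (blk u), x ^ w.length) *
          ∑ w ∈ words blk G A n L i, x ^ w.length := by
  have hf : ∀ w : List (V × V), 0 ≤ x ^ w.length := fun w => pow_nonneg hx _
  have h1 : ∀ s : Finset (List (V × V)), ∑ w ∈ insert [] s, x ^ w.length ≤
      1 + ∑ w ∈ s, x ^ w.length := by
    intro s
    rw [insert_eq, ← union_comm]
    have := sum_union_inter (s₁ := s) (s₂ := {[]}) (f := fun w : List (V × V) => x ^ w.length)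
    have h0 : 0 ≤ ∑ b ∈ s ∩ {[]}, x ^ b.length := sum_nonneg fun b _ => hf b
    rw [sum_singleton, List.length_nil, pow_zero] at this
    linarith
  refine (h1 _).trans ?_
  gcongr
  refine (sum_biUnion_le _ _ _ hf).trans (sum_le_sum fun v _ => ?_)
  refine (sum_biUnion_le _ _ _ hf).trans (sum_le_sum fun u _ => ?_)
  refine (sum_image_le _ _ _ hf).trans (le_of_eq ?_)
  rw [sum_product, mul_assoc, sum_mul_sum, mul_sum]
  refine sum_congr rfl fun w _ => ?_
  rw [mul_sum]
  refine sum_congr rfl fun w' _ => ?_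
  simp [pow_add]
  ring

variable {blk G A} {m D : ℕ}

/-- The recursion is F ≤ 1 + m·D·m⁻²·F² ≤ 1 + F²/4, and 2 is the double root of F = 1 + F²/4. This
is where the factor 4 in 4D ≤ m comes from. -/
theorem sum_words_le_two (hm : 0 < m) (hA : ∀ i, (A.filter fun v => blk v = i).card = m)
    (hD : ∀ v, G.degree v ≤ D) (hmD : 4 * D ≤ m) (n : ℕ) (i : ι) :
    ∑ w ∈ words blk G A n A i, (((m : ℝ) ^ 2)⁻¹) ^ w.length ≤ 2 := by
  have hm' : (0 : ℝ) < m := by exact_mod_cast hm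
  have hx : (0 : ℝ) ≤ ((m : ℝ) ^ 2)⁻¹ := by positivity
  induction n generalizing i with
  | zero => simp [words]
  | succ n ih =>
    refine (sum_words_succ_le blk G A hx).trans ?_
    have h : ∀ v ∈ A.filter (fun v => blk v = i), ∑ u ∈ G.neighborFinset v,
        ((m : ℝ) ^ 2)⁻¹ * (∑ w ∈ words blk G A n A (blk u), (((m : ℝ) ^ 2)⁻¹) ^ w.length) *
          ∑ w ∈ words blk G A n A i, (((m : ℝ) ^ 2)⁻¹) ^ w.length ≤ (m : ℝ)⁻¹ := by
      intro v _
      have : ∀ u ∈ G.neighborFinset v,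
        ((m : ℝ) ^ 2)⁻¹ * (∑ w ∈ words blk G A n A (blk u), (((m : ℝ) ^ 2)⁻¹) ^ w.length) *
          ∑ w ∈ words blk G A n A i, (((m : ℝ) ^ 2)⁻¹) ^ w.length ≤ ((m : ℝ) ^ 2)⁻¹ * 2 * 2 := by
        intro u _
        have h0 : 0 ≤ ∑ w ∈ words blk G A n A i, (((m : ℝ) ^ 2)⁻¹) ^ w.length :=
          sum_nonneg fun w _ => pow_nonneg hx _
        gcongr
        exacts [ih _, ih _]
      refine (sum_le_card_nsmul _ _ _ this).trans ?_
      rw [G.card_neighborFinset_eq_degree, nsmul_eq_mul]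
      have h4 : (G.degree v : ℝ) * 4 ≤ m := by
        have := hD v
        exact_mod_cast (by omega : G.degree v * 4 ≤ m)
      calc (G.degree v : ℝ) * (((m : ℝ) ^ 2)⁻¹ * 2 * 2)
          = (G.degree v : ℝ) * 4 * ((m : ℝ) ^ 2)⁻¹ := by ring
        _ ≤ m * ((m : ℝ) ^ 2)⁻¹ := by gcongr
        _ = (m : ℝ)⁻¹ := by field_simp
    have := sum_le_card_nsmul _ _ _ h
    rw [hA, nsmul_eq_mul, mul_inv_cancel₀ hm'.ne'] at this
    linarith

/-- Only the words of block i itself are restricted to L; those of neighbouring blocks contribute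
the factor 2. So the recursion is linear, g ≤ 1 + g(m - h)/(2m), with fixed point g = 2m/(m + h). -/
theorem sum_words_le (hm : 0 < m) (hA : ∀ i, (A.filter fun v => blk v = i).card = m)
    (hD : ∀ v, G.degree v ≤ D) (hmD : 4 * D ≤ m) (n : ℕ) (i : ι) {L : Finset V} {h : ℕ}
    (hL : (L.filter fun v => blk v = i).card + h = m) :
    ∑ w ∈ words blk G A n L i, (((m : ℝ) ^ 2)⁻¹) ^ w.length ≤ 2 * m / (m + h) := by
  have hm' : (0 : ℝ) < m := by exact_mod_cast hm
  have hx : (0 : ℝ) ≤ ((m : ℝ) ^ 2)⁻¹ := by positivity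
  have hL' : ((L.filter fun v => blk v = i).card : ℝ) = m - h := by
    rw [eq_sub_iff_add_eq]; exact_mod_cast hL
  induction n with
  | zero =>
    have : h ≤ m := by omega
    have : (h : ℝ) ≤ m := by exact_mod_cast this
    rw [le_div_iff₀ (by positivity)]
    simp [words]; linarith
  | succ n ih =>
    refine (sum_words_succ_le blk G A hx).trans ?_
    set g : ℝ := 2 * m / (m + h) with hg
    have hg0 : 0 ≤ g := by positivity
    have hh : ∀ v ∈ L.filter (fun v => blk v = i), ∑ u ∈ G.neighborFinset v,
        ((m : ℝ) ^ 2)⁻¹ * (∑ w ∈ words blk G A n A (blk u), (((m : ℝ) ^ 2)⁻¹) ^ w.length) *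
          ∑ w ∈ words blk G A n L i, (((m : ℝ) ^ 2)⁻¹) ^ w.length ≤ (2 * m : ℝ)⁻¹ * g := by
      intro v _
      have : ∀ u ∈ G.neighborFinset v,
        ((m : ℝ) ^ 2)⁻¹ * (∑ w ∈ words blk G A n A (blk u), (((m : ℝ) ^ 2)⁻¹) ^ w.length) *
          ∑ w ∈ words blk G A n L i, (((m : ℝ) ^ 2)⁻¹) ^ w.length ≤ ((m : ℝ) ^ 2)⁻¹ * 2 * g := by
        intro u _
        have h0 : 0 ≤ ∑ w ∈ words blk G A n L i, (((m : ℝ) ^ 2)⁻¹) ^ w.length :=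
          sum_nonneg fun w _ => pow_nonneg hx _
        gcongr
        exact sum_words_le_two hm hA hD hmD n _
      refine (sum_le_card_nsmul _ _ _ this).trans ?_
      rw [G.card_neighborFinset_eq_degree, nsmul_eq_mul]
      have h4 : (G.degree v : ℝ) * 4 ≤ m := by
        have := hD v
        exact_mod_cast (by omega : G.degree v * 4 ≤ m)
      calc (G.degree v : ℝ) * (((m : ℝ) ^ 2)⁻¹ * 2 * g)
          = (G.degree v : ℝ) * 4 * (((m : ℝ) ^ 2)⁻¹ / 2 * g) := by ring
        _ ≤ m * (((m : ℝ) ^ 2)⁻¹ / 2 * g) := by gcongr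
        _ = (2 * m : ℝ)⁻¹ * g := by field_simp
    have := sum_le_card_nsmul _ _ _ hh
    rw [nsmul_eq_mul, hL'] at this
    refine (add_le_add le_rfl this).trans (le_of_eq ?_)
    rw [hg]
    field_simp
    ring

end Words

end LazyResampling

/-! ### The resampling algorithm and its log -/

namespace LazyResampling

open Finset

/-- A resampling algorithm for independent transversals.  Its states `s` describe partial
transversals `view s`.  If block `i = sel s` has no vertex, a step draws the vertex `tab i r` from
the random number `r`; either this vertex has no neighbours in the partial transversal and is added
to it, or one of the neighbours is removed. -/
structure Resampler {V ι : Type*} [DecidableEq ι] (blk : V → ι) (G : SimpleGraph V) (A : Finset V)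
    (Ω S : Type*) where
  view : S → ι → Option V
  next : S → Ω → S
  sel : S → Option ι
  tab : ι → Ω → V
  tab_mem : ∀ i r, tab i r ∈ A
  blk_tab : ∀ i r, blk (tab i r) = i
  sel_eq_none : ∀ s, sel s = none → ∀ i, view s i ≠ none
  next_eq : ∀ s r, sel s = none → next s r = s
  view_sel : ∀ s i, sel s = some i → view s i = none
  view_next : ∀ s i r, sel s = some i →
    ((∀ j u, view s j = some u → ¬ G.Adj (tab i r) u) ∧
      view (next s r) = Function.update (view s) i (some (tab i r))) ∨
    ∃ j u, view s j = some u ∧ G.Adj (tab i r) u ∧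
      view (next s r) = Function.update (view s) j none

namespace Resampler

variable {V ι : Type*} [DecidableEq ι] {blk : V → ι} {G : SimpleGraph V} {A : Finset V}
  {Ω S : Type*} (𝓡 : Resampler blk G A Ω S)

/-- The final state. -/
def run (s : S) (ω : List Ω) : S := ω.foldl 𝓡.next s

/-- The vertices drawn. -/
def draws : S → List Ω → List V
  | _, [] => []
  | s, r :: ω => ((𝓡.sel s).map fun i => 𝓡.tab i r).toList ++ draws (𝓡.next s r) ω

@[simp] theorem run_nil (s : S) : 𝓡.run s [] = s := rfl

@[simp] theorem run_cons (s : S) (r : Ω) (ω : List Ω) :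
    𝓡.run s (r :: ω) = 𝓡.run (𝓡.next s r) ω := rfl

theorem run_append (s : S) (ω ω' : List Ω) : 𝓡.run s (ω ++ ω') = 𝓡.run (𝓡.run s ω) ω' :=
  List.foldl_append

theorem draws_append (s : S) (ω ω' : List Ω) :
    𝓡.draws s (ω ++ ω') = 𝓡.draws s ω ++ 𝓡.draws (𝓡.run s ω) ω' := by
  induction ω generalizing s with
  | nil => rfl
  | cons r ω ih => simp [draws, ih]

theorem run_of_sel_eq_none {s : S} (h : 𝓡.sel s = none) (ω : List Ω) : 𝓡.run s ω = s := by
  induction ω with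
  | nil => rfl
  | cons r ω ih => rw [run_cons, 𝓡.next_eq s r h, ih]

theorem length_draws_le (s : S) (ω : List Ω) : (𝓡.draws s ω).length ≤ ω.length := by
  induction ω generalizing s with
  | nil => simp [draws]
  | cons r ω ih =>
    have := ih (𝓡.next s r)
    simp only [draws, List.length_append, List.length_cons]
    cases 𝓡.sel s <;> simp <;> omega

/-- A finished state is never left, so a run that ends unfinished has drawn a vertex in each of its
steps. -/
theorem length_draws (s : S) (ω : List Ω) (h : 𝓡.sel (𝓡.run s ω) ≠ none) :
    (𝓡.draws s ω).length = ω.length := by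
  induction ω generalizing s with
  | nil => simp [draws]
  | cons r ω ih =>
    rw [run_cons] at h
    have := ih _ h
    simp only [draws, List.length_append, List.length_cons]
    match hs : 𝓡.sel s with
    | some i => simp; omega
    | none =>
      rw [𝓡.next_eq s r hs, run_of_sel_eq_none 𝓡 hs] at h
      exact absurd hs h

/-- The invariants of a run: the partial transversal is independent and contained in `A`, and the
vertices drawn from a block are those of its conflicts followed by its present vertex. -/
theorem exists_log {s : S} (hs : ∀ i, 𝓡.view s i = none) (ω : List Ω) :
    (∀ i v, 𝓡.view (𝓡.run s ω) i = some v → blk v = i ∧ v ∈ A) ∧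
    (∀ i v j u, 𝓡.view (𝓡.run s ω) i = some v → 𝓡.view (𝓡.run s ω) j = some u → ¬ G.Adj v u) ∧
    ∃ c : List (V × V), (∀ x ∈ c, IsConflict blk G A x) ∧
      ∀ k, proj blk k (𝓡.draws s ω) =
        proj blk k (ends c) ++ (𝓡.view (𝓡.run s ω) k).toList := by
  induction ω using List.reverseRecOn with
  | nil => exact ⟨by simp [hs], by simp [hs], [], by simp, by simp [draws, hs]⟩
  | append_singleton ω r ih =>
    obtain ⟨h1, h2, c, hc, h3⟩ := ih
    rw [run_append, draws_append]
    set s' := 𝓡.run s ω with hs'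
    simp only [run_cons, run_nil, draws, List.append_nil]
    match hsel : 𝓡.sel s' with
    | none =>
      rw [𝓡.next_eq s' r hsel]
      exact ⟨h1, h2, c, hc, by simpa using h3⟩
    | some i =>
      have hi := 𝓡.view_sel s' i hsel
      set v := 𝓡.tab i r with hv
      have hvi : blk v = i := 𝓡.blk_tab i r
      have hvA : v ∈ A := 𝓡.tab_mem i r
      simp only [Option.map_some, Option.toList_some]
      -- If v joins, the log is unchanged and v is the present vertex of block i. Otherwise (v, u)
      -- is logged: u passes from the present vertex of block j to the log, and block i stays empty.
      rcases 𝓡.view_next s' i r hsel with ⟨hfree, hn⟩ | ⟨j, u, hj, hadj, hn⟩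
      · rw [hn]
        refine ⟨fun k x hx => ?_, fun k x k' y hx hy => ?_, c, hc, fun k => ?_⟩
        · by_cases hk : k = i
          · subst hk
            simp only [Function.update_self, Option.some.injEq] at hx
            subst hx
            exact ⟨hvi, hvA⟩
          · rw [Function.update_of_ne hk] at hx
            exact h1 k x hx
        · by_cases hk : k = i <;> by_cases hk' : k' = i
          · subst hk hk'
            simp only [Function.update_self, Option.some.injEq] at hx hy
            subst hx hy
            exact G.loopless.irrefl _
          · subst hk
            rw [Function.update_of_ne hk'] at hy
            simp only [Function.update_self, Option.some.injEq] at hx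
            subst hx
            exact hfree _ _ hy
          · subst hk'
            rw [Function.update_of_ne hk] at hx
            simp only [Function.update_self, Option.some.injEq] at hy
            subst hy
            exact fun h => hfree _ _ hx h.symm
          · rw [Function.update_of_ne hk] at hx
            rw [Function.update_of_ne hk'] at hy
            exact h2 _ _ _ _ hx hy
        · rw [proj_append, h3]
          by_cases hk : k = i
          · subst hk
            simp [hi, proj_cons, ← hv, hvi]
          · rw [Function.update_of_ne hk]
            simp [proj_cons, ← hv, hvi, Ne.symm hk]
      · rw [hn]
        obtain ⟨huj, huA⟩ := h1 j u hj
        have hij : i ≠ j := by rintro rfl; simp [hi] at hj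
        have hup : ∀ k x, Function.update (𝓡.view s') j none k = some x →
            𝓡.view s' k = some x := by
          intro k x hx
          by_cases hk : k = j
          · subst hk; simp at hx
          · rwa [Function.update_of_ne hk] at hx
        refine ⟨fun k x hx => h1 k x (hup k x hx),
          fun k x k' y hx hy => h2 k x k' y (hup k x hx) (hup k' y hy), c ++ [(v, u)], ?_,
          fun k => ?_⟩
        · intro x hx
          rcases List.mem_append.1 hx with hx | hx
          · exact hc x hx
          · rw [List.mem_singleton.1 hx]
            exact ⟨hadj, by rw [hvi, huj]; exact hij, hvA, huA⟩
        · rw [proj_append, h3]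
          by_cases hk : k = j
          · subst hk
            simp [hj, proj_cons, ← hv, hvi, huj, hij]
          · rw [Function.update_of_ne hk]
            by_cases hk' : k = i
            · subst hk'
              simp [hi, proj_cons, ← hv, hvi, huj, Ne.symm hk]
            · simp [proj_cons, ← hv, hvi, huj, Ne.symm hk, Ne.symm hk']

/-- The draws from each block begin with the vertices of `h` in that block. -/
def Explains (blk : V → ι) (h d : List V) : Prop := ∀ k, proj blk k h <+: proj blk k d

theorem Explains.length_le {h d : List V} [Fintype ι] (H : Explains blk h d) :
    h.length ≤ d.length := by
  rw [length_eq_sum_proj blk h, length_eq_sum_proj blk d]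
  exact sum_le_sum fun k _ => (H k).length_le

theorem exists_split_of_proj_eq_cons {k : ι} {v : V} {h l : List V}
    (H : proj blk k h = v :: l) : ∃ h₁ h₂, h = h₁ ++ v :: h₂ ∧ proj blk k h₁ = [] ∧ blk v = k := by
  induction h with
  | nil => simp at H
  | cons a h ih =>
    rw [proj_cons] at H
    split_ifs at H with ha
    · obtain ⟨rfl, -⟩ := List.cons_eq_cons.1 H
      exact ⟨[], h, rfl, rfl, ha⟩
    · obtain ⟨h₁, h₂, rfl, h3, h4⟩ := ih H
      exact ⟨a :: h₁, h₂, rfl, by simp [proj_cons, ha, h3], h4⟩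

open Classical in
-- The choice of the block may depend on the past, but the draw is fresh. If h has an entry in the
-- selected block, the draw must equal the first such entry, at a cost of p; induction applies to h
-- without this entry. The bound holds from every state, so adaptivity does no harm.
theorem listAvg_explains_le [DecidableEq V] [Fintype Ω] [Nonempty Ω] {p : ℝ}
    (hp : ∀ i v, ((univ.filter fun r => 𝓡.tab i r = v).card : ℝ) / Fintype.card Ω ≤ p)
    (T : ℕ) (s : S) (h : List V) :
    listAvg Ω T (fun ω => if Explains blk h (𝓡.draws s ω) then 1 else 0) ≤ p ^ h.length := by
  have hcard : (0 : ℝ) < Fintype.card Ω := by exact_mod_cast Fintype.card_pos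
  induction T generalizing s h with
  | zero =>
    cases h with
    | nil => simp [listAvg]; split_ifs <;> norm_num
    | cons v h =>
      have : ¬ Explains blk (v :: h) (𝓡.draws s []) := by
        intro H
        have := H (blk v)
        simp [draws, proj_cons] at this
      have hp0 : 0 ≤ p := le_trans (by positivity) (hp (blk v) v)
      simp only [listAvg, this, if_false]
      positivity
  | succ T ih =>
    simp only [listAvg]
    have havg : ∀ (f : Ω → ℝ) (a : ℝ), (∀ r, f r ≤ a) → (∑ r, f r) / Fintype.card Ω ≤ a := by
      intro f a hf
      rw [div_le_iff₀ hcard]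
      refine (sum_le_card_nsmul _ _ _ fun r _ => hf r).trans_eq ?_
      simp [mul_comm]
    match hsel : 𝓡.sel s with
    | none =>
      refine havg _ _ fun r => ?_
      simp only [draws, hsel]
      exact ih (𝓡.next s r) h
    | some i =>
      have hd : ∀ r ω, 𝓡.draws s (r :: ω) = 𝓡.tab i r :: 𝓡.draws (𝓡.next s r) ω := by
        intro r ω
        simp [draws, hsel]
      simp only [hd]
      match hi : proj blk i h with
      | [] =>
        -- No entry of h lies in the selected block, so this draw is unconstrained.
        refine havg _ _ fun r => le_trans (listAvg_mono fun ω _ => ?_) (ih (𝓡.next s r) h)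
        have : Explains blk h (𝓡.tab i r :: 𝓡.draws (𝓡.next s r) ω) →
            Explains blk h (𝓡.draws (𝓡.next s r) ω) := by
          intro H k
          by_cases hk : k = i
          · subst hk; simp [hi]
          · have := H k
            rwa [proj_cons, 𝓡.blk_tab, if_neg (Ne.symm hk)] at this
        split_ifs with h1 h2
        exacts [le_rfl, absurd (this h1) h2, zero_le_one, le_rfl]
      | v :: l =>
        obtain ⟨h₁, h₂, rfl, hh₁, hvi⟩ := exists_split_of_proj_eq_cons hi
        have hp0 : 0 ≤ p := le_trans (by positivity) (hp (blk v) v)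
        have key : ∀ r, listAvg Ω T (fun ω => if Explains blk (h₁ ++ v :: h₂)
            (𝓡.tab i r :: 𝓡.draws (𝓡.next s r) ω) then (1 : ℝ) else 0) ≤
            if 𝓡.tab i r = v then p ^ (h₁ ++ h₂).length else 0 := by
          intro r
          split_ifs with hr
          · refine le_trans (listAvg_mono fun ω _ => ?_) (ih (𝓡.next s r) (h₁ ++ h₂))
            have : Explains blk (h₁ ++ v :: h₂) (𝓡.tab i r :: 𝓡.draws (𝓡.next s r) ω) →
                Explains blk (h₁ ++ h₂) (𝓡.draws (𝓡.next s r) ω) := by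
              intro H k
              have := H k
              rw [proj_append, proj_cons, proj_cons, hr] at this
              rw [proj_append]
              by_cases hk : blk v = k
              · have hik : i = k := hvi.symm.trans hk
                subst hik
                rw [if_pos hk, if_pos hk, hh₁, List.nil_append, List.prefix_cons_inj] at this
                rwa [hh₁]
              · rwa [if_neg hk, if_neg hk] at this
            split_ifs with h1 h2
            exacts [le_rfl, absurd (this h1) h2, zero_le_one, le_rfl]
          · refine le_trans (listAvg_mono (F' := fun _ => 0) fun ω _ => ?_) (listAvg_const _ _).le
            rw [if_neg]
            intro H
            have := H i
            rw [hi, proj_cons, 𝓡.blk_tab, if_pos rfl, List.cons_prefix_cons] at this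
            exact hr this.1.symm
        have hlen : (h₁ ++ v :: h₂).length = (h₁ ++ h₂).length + 1 := by simp; omega
        rw [hlen, pow_succ]
        calc (∑ r, listAvg Ω T fun ω => if Explains blk (h₁ ++ v :: h₂)
              (𝓡.tab i r :: 𝓡.draws (𝓡.next s r) ω) then (1 : ℝ) else 0) / Fintype.card Ω
            ≤ (∑ r, if 𝓡.tab i r = v then p ^ (h₁ ++ h₂).length else 0) / Fintype.card Ω := by
              gcongr with r
              exact key r
          _ = p ^ (h₁ ++ h₂).length *
                ((univ.filter fun r => 𝓡.tab i r = v).card / Fintype.card Ω) := by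
              rw [← sum_filter, sum_const, nsmul_eq_mul]
              ring
          _ ≤ _ := by gcongr; exact hp i v

end Resampler

end LazyResampling

/-! ### Probabilities of the outcomes of a run -/

namespace LazyResampling

open Finset

namespace Resampler

variable {V ι : Type*} [DecidableEq ι] {blk : V → ι} {G : SimpleGraph V} {A : Finset V}
  {Ω S : Type*} (𝓡 : Resampler blk G A Ω S)

theorem proj_ends_subset {c : List (V × V)} (hc : ∀ x ∈ c, IsConflict blk G A x) (k : ι) :
    ∀ v ∈ proj blk k (ends c), v ∈ A := by
  intro y hy
  obtain ⟨z, hz, hyz⟩ := List.mem_flatMap.1 (List.mem_filter.1 hy).1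
  rcases List.mem_pair.1 hyz with rfl | rfl
  exacts [(hc z hz).2.2.1, (hc z hz).2.2.2]

/-- A conflict has at most one end point in block k, so along the prefixes of c the number of
entries in block k grows by steps of at most one and skips no value. -/
theorem exists_prefix_of_length {c : List (V × V)} (hc : ∀ x ∈ c, IsConflict blk G A x) (k : ι)
    {r : ℕ} (hr : r ≤ (proj blk k (ends c)).length) :
    ∃ c₁ c₂, c = c₁ ++ c₂ ∧ (proj blk k (ends c₁)).length = r := by
  induction c using List.reverseRecOn with
  | nil => exact ⟨[], [], rfl, by simp at hr; simp [hr]⟩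
  | append_singleton c x ih =>
    by_cases h : r ≤ (proj blk k (ends c)).length
    · obtain ⟨c₁, c₂, rfl, h'⟩ := ih (fun y hy => hc y (by simp [hy])) h
      exact ⟨c₁, c₂ ++ [x], by simp, h'⟩
    · refine ⟨c ++ [x], [], by simp, le_antisymm ?_ hr⟩
      have hx := (hc x (by simp)).2.1
      have : (proj blk k [x.1, x.2]).length ≤ 1 := by
        simp only [proj_cons, proj_nil]
        split_ifs with h1 h2
        · exact absurd (h1.trans h2.symm) hx
        all_goals simp
      simp only [ends_append, ends_cons, ends_nil, proj_append, List.length_append]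
      omega

variable [Fintype V] [DecidableEq V] [DecidableRel G.Adj]

/-- The part of c outside the word does not meet block i, so h can follow the word directly. -/
theorem exists_word_explains {n : ℕ} {c : List (V × V)} (hn : c.length ≤ n)
    (hc : ∀ x ∈ c, IsConflict blk G A x) {L : Finset V} {i : ι}
    (hL : ∀ v ∈ proj blk i (ends c), v ∈ L) {h : V} (hi : blk h = i) {d : List V}
    (hd : Explains blk (ends c ++ [h]) d) :
    ∃ w ∈ words blk G A n L i, Explains blk (ends w ++ [h]) d := by
  obtain ⟨w, r, hw, -, -, hk, hr⟩ := exists_word blk G A n c hn hc L i hL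
  refine ⟨w, hw, fun k => ?_⟩
  have := hd k
  rw [proj_append, hk] at this
  rw [proj_append]
  by_cases hki : k = i
  · subst hki
    rwa [hr, List.append_nil] at this
  · have hh : proj blk k [h] = [] := by simp [proj_cons, hi, Ne.symm hki]
    rw [hh, List.append_nil] at this ⊢
    exact (List.prefix_append _ _).trans this

variable [Fintype ι]

/-- The log is cut just before the first conflict with an end point in H and block i; this end point
serves as h. If there is no such conflict, h is the present vertex. In both cases the earlier
entries of block i avoid H. -/
theorem exists_word_of_view_mem {s : S} (hs : ∀ i, 𝓡.view s i = none) {ω : List Ω} {i : ι} {v : V}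
    {H : Finset V} (hv : 𝓡.view (𝓡.run s ω) i = some v) (hvH : v ∈ H) :
    ∃ w ∈ words blk G A ω.length (A \ H) i, ∃ h ∈ H.filter (fun v => blk v = i),
      Explains blk (ends w ++ [h]) (𝓡.draws s ω) := by
  obtain ⟨h1, -, c, hc, hk⟩ := 𝓡.exists_log hs ω
  obtain ⟨hvi, -⟩ := h1 i v hv
  have hlen : c.length ≤ ω.length := by
    have : Explains blk (ends c) (𝓡.draws s ω) := fun k => hk k ▸ List.prefix_append _ _
    have := this.length_le
    rw [length_ends] at this
    have := 𝓡.length_draws_le s ω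
    omega
  rcases exists_first_split (fun x : V × V => (blk x.1 = i ∧ x.1 ∈ H) ∨ (blk x.2 = i ∧ x.2 ∈ H)) c
    with hno | ⟨c₁, x, c₂, rfl, hx, hno⟩
  · have hL : ∀ v ∈ proj blk i (ends c), v ∈ A \ H := by
      intro y hy
      refine mem_sdiff.2 ⟨proj_ends_subset hc i y hy, fun hyH => ?_⟩
      obtain ⟨hy, hyi⟩ := List.mem_filter.1 hy
      obtain ⟨z, hz, hyz⟩ := List.mem_flatMap.1 hy
      have hyi : blk y = i := by simpa using hyi
      rcases List.mem_pair.1 hyz with rfl | rfl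
      exacts [hno z hz (Or.inl ⟨hyi, hyH⟩), hno z hz (Or.inr ⟨hyi, hyH⟩)]
    obtain ⟨w, hw, hwe⟩ := exists_word_explains hlen hc hL hvi (d := 𝓡.draws s ω) (by
      intro k
      rw [proj_append, hk]
      by_cases hki : k = i
      · subst hki; simp [hv, proj_cons, hvi]
      · simp [proj_cons, hvi, Ne.symm hki])
    exact ⟨w, hw, v, mem_filter.2 ⟨hvH, hvi⟩, hwe⟩
  · have hc₁ : ∀ x ∈ c₁, IsConflict blk G A x := fun y hy => hc y (by simp [hy])
    have hL : ∀ v ∈ proj blk i (ends c₁), v ∈ A \ H := by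
      intro y hy
      refine mem_sdiff.2 ⟨proj_ends_subset hc₁ i y hy, fun hyH => ?_⟩
      obtain ⟨hy, hyi⟩ := List.mem_filter.1 hy
      obtain ⟨z, hz, hyz⟩ := List.mem_flatMap.1 hy
      have hyi : blk y = i := by simpa using hyi
      rcases List.mem_pair.1 hyz with rfl | rfl
      exacts [hno z hz (Or.inl ⟨hyi, hyH⟩), hno z hz (Or.inr ⟨hyi, hyH⟩)]
    have hlen₁ : c₁.length ≤ ω.length := by simp at hlen; omega
    obtain ⟨h, hhi, hhH, hpre⟩ : ∃ h, blk h = i ∧ h ∈ H ∧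
        ∀ k, proj blk k [h] <+: proj blk k [x.1, x.2] := by
      have hne := (hc x (by simp)).2.1
      rcases hx with ⟨hx, hxH⟩ | ⟨hx, hxH⟩
      · exact ⟨x.1, hx, hxH, fun k => by
          simp only [proj_cons, proj_nil]; split_ifs <;> simp⟩
      · refine ⟨x.2, hx, hxH, fun k => ?_⟩
        simp only [proj_cons, proj_nil]
        split_ifs with h1 h2 <;> simp
        exact absurd (h2.trans h1.symm) hne
    obtain ⟨w, hw, hwe⟩ := exists_word_explains hlen₁ hc₁ hL hhi (d := 𝓡.draws s ω) (by
      intro k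
      rw [proj_append, hk, ends_append, ends_cons,
        show x.1 :: x.2 :: ends c₂ = [x.1, x.2] ++ ends c₂ from rfl, proj_append, proj_append]
      rw [List.append_assoc, List.prefix_append_right_inj, List.append_assoc]
      exact (hpre k).trans (List.prefix_append _ _))
    exact ⟨w, hw, h, mem_filter.2 ⟨hhH, hhi⟩, hwe⟩

open Classical in
-- Each r from 0 up to the number of log entries in block k comes from a prefix of the log, and the
-- word of this prefix has exactly r entries in block k, so these words are distinct. The case r = 0
-- makes up for the present vertex, which is a draw outside the log.
theorem length_le_of_sel_ne_none {s : S} (hs : ∀ i, 𝓡.view s i = none) {ω : List Ω}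
    (hω : 𝓡.sel (𝓡.run s ω) ≠ none) :
    ω.length ≤ ∑ k, ((words blk G A ω.length A k).filter
      fun w => Explains blk (ends w) (𝓡.draws s ω)).card := by
  obtain ⟨h1, -, c, hc, hk⟩ := 𝓡.exists_log hs ω
  have hlen : c.length ≤ ω.length := by
    have : Explains blk (ends c) (𝓡.draws s ω) := fun k => hk k ▸ List.prefix_append _ _
    have := this.length_le
    rw [length_ends] at this
    have := 𝓡.length_draws_le s ω
    omega
  refine (𝓡.length_draws s ω hω).symm.le.trans ?_
  rw [length_eq_sum_proj blk]
  refine sum_le_sum fun k _ => ?_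
  rw [hk]
  have hone : (𝓡.view (𝓡.run s ω) k).toList.length ≤ 1 := by
    cases 𝓡.view (𝓡.run s ω) k <;> simp
  rw [List.length_append]
  have : (range ((proj blk k (ends c)).length + 1)).card ≤ ((words blk G A ω.length A k).filter
      fun w => Explains blk (ends w) (𝓡.draws s ω)).card := by
    have H : ∀ r ∈ range ((proj blk k (ends c)).length + 1), ∃ w ∈ (words blk G A ω.length A k).filter
        (fun w => Explains blk (ends w) (𝓡.draws s ω)), (proj blk k (ends w)).length = r := by
      intro r hr
      obtain ⟨c₁, c₂, rfl, hr'⟩ := exists_prefix_of_length hc k (Nat.lt_succ_iff.1 (mem_range.1 hr))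
      have hc₁ : ∀ x ∈ c₁, IsConflict blk G A x := fun y hy => hc y (by simp [hy])
      obtain ⟨w, r', hw, -, -, hw', hr''⟩ := exists_word blk G A ω.length c₁
        (by simp at hlen; omega) hc₁ A k (proj_ends_subset hc₁ k)
      refine ⟨w, mem_filter.2 ⟨hw, fun j => ?_⟩, ?_⟩
      · rw [hk, ends_append, proj_append, hw', List.append_assoc, List.append_assoc]
        exact List.prefix_append _ _
      · rw [← hr', hw', hr'', List.append_nil]
    choose! f hf hf' using H
    refine card_le_card_of_injOn f hf ?_
    intro r hr r' hr' he
    rw [← hf' r (by simpa using hr), ← hf' r' (by simpa using hr'), he]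
  rw [card_range] at this
  omega

variable {m D : ℕ} [Fintype Ω] [Nonempty Ω]

/-- This separates the bias of the draws from the uniform probability: at most T draws occur, so the
total bias is at most (1 + ε)ᵀ. -/
theorem pow_le_of_length {ε : ℝ} (hε : 0 ≤ ε) {a T : ℕ} (e : ℕ) (ha : 2 * a + e ≤ T) :
    ((1 + ε) / m) ^ (2 * a + e) ≤ (1 + ε) ^ T * ((((m : ℝ) ^ 2)⁻¹) ^ a * ((m : ℝ) ^ e)⁻¹) := by
  rw [div_pow, pow_add (m : ℝ), pow_mul (m : ℝ), div_eq_mul_inv, mul_inv, inv_pow]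
  have : (1 + ε) ^ (2 * a + e) ≤ (1 + ε) ^ T := pow_le_pow_right₀ (by linarith) ha
  gcongr

open Classical in
/-- The probability that a run of `T` steps ends with a vertex of `H` in block `i`. -/
theorem listAvg_view_mem_le (hm : 0 < m) (hA : ∀ i, (A.filter fun v => blk v = i).card = m)
    (hD : ∀ v, G.degree v ≤ D) (hmD : 4 * D ≤ m) {ε : ℝ} (hε : 0 ≤ ε)
    (hp : ∀ i v, ((univ.filter fun r => 𝓡.tab i r = v).card : ℝ) / Fintype.card Ω ≤ (1 + ε) / m)
    {s : S} (hs : ∀ i, 𝓡.view s i = none) (T : ℕ) (i : ι) {H : Finset V}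
    (hH : H ⊆ A.filter fun v => blk v = i) :
    listAvg Ω T (fun ω => if ∃ v ∈ H, 𝓡.view (𝓡.run s ω) i = some v then 1 else 0) ≤
      (1 + ε) ^ T * (2 * H.card / (m + H.card)) := by
  -- Words with more entries than there are draws cannot explain anything; dropping them keeps the
  -- bias below (1 + ε)ᵀ.
  set W := (words blk G A T (A \ H) i).filter fun w => 2 * w.length + 1 ≤ T with hW
  have hm' : (0 : ℝ) < m := by exact_mod_cast hm
  have hx : (0 : ℝ) ≤ ((m : ℝ) ^ 2)⁻¹ := by positivity
  calc listAvg Ω T (fun ω => if ∃ v ∈ H, 𝓡.view (𝓡.run s ω) i = some v then 1 else 0)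
      ≤ listAvg Ω T (fun ω => ∑ w ∈ W, ∑ h ∈ H,
          if Explains blk (ends w ++ [h]) (𝓡.draws s ω) then 1 else 0) := by
        refine listAvg_mono fun ω hω => ?_
        split_ifs with h
        · obtain ⟨v, hvH, hv⟩ := h
          obtain ⟨w, hw, h, hh, hwe⟩ := 𝓡.exists_word_of_view_mem hs hv hvH
          have hl : 2 * w.length + 1 ≤ T := by
            have h1 := hwe.length_le
            have h2 := 𝓡.length_draws_le s ω
            simp [length_ends] at h1
            omega
          rw [hω] at hw
          have hwW : w ∈ W := mem_filter.2 ⟨hw, hl⟩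
          have h0 : ∀ w ∈ W, (0 : ℝ) ≤ ∑ h ∈ H,
              if Explains blk (ends w ++ [h]) (𝓡.draws s ω) then 1 else 0 :=
            fun w _ => sum_nonneg fun h _ => by split_ifs <;> norm_num
          refine le_trans ?_ (single_le_sum h0 hwW)
          refine le_trans ?_ (single_le_sum (fun h _ => by split_ifs <;> norm_num)
            (mem_filter.1 hh).1)
          rw [if_pos hwe]
        · exact sum_nonneg fun w _ => sum_nonneg fun h _ => by split_ifs <;> norm_num
    _ = ∑ w ∈ W, ∑ h ∈ H, listAvg Ω T (fun ω =>
          if Explains blk (ends w ++ [h]) (𝓡.draws s ω) then 1 else 0) := by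
        rw [listAvg_sum]
        exact sum_congr rfl fun w _ => listAvg_sum _ _ _
    _ ≤ ∑ w ∈ W, ∑ h ∈ H, (1 + ε) ^ T * ((((m : ℝ) ^ 2)⁻¹) ^ w.length * (m : ℝ)⁻¹) := by
        refine sum_le_sum fun w hw => sum_le_sum fun h _ => ?_
        refine (𝓡.listAvg_explains_le hp T s _).trans ?_
        have := pow_le_of_length (m := m) hε 1 (mem_filter.1 hw).2
        rw [pow_one] at this
        simpa [length_ends] using this
    _ = (1 + ε) ^ T * (H.card * (m : ℝ)⁻¹) * ∑ w ∈ W, (((m : ℝ) ^ 2)⁻¹) ^ w.length := by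
        simp only [sum_const, nsmul_eq_mul]
        rw [mul_sum]
        exact sum_congr rfl fun w _ => by ring
    _ ≤ (1 + ε) ^ T * (H.card * (m : ℝ)⁻¹) * (2 * m / (m + H.card)) := by
        gcongr
        refine (sum_le_sum_of_subset_of_nonneg (filter_subset _ _)
          fun w _ _ => pow_nonneg hx _).trans (sum_words_le hm hA hD hmD T i ?_)
        rw [← hA i, ← card_sdiff_add_card_eq_card hH]
        congr 2
        ext v
        simp only [mem_filter, mem_sdiff]
        tauto
    _ = _ := by field_simp

open Classical in
/-- The probability that a run of `T` steps does not produce a transversal. -/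
theorem mul_listAvg_sel_ne_none_le (hm : 0 < m)
    (hA : ∀ i, (A.filter fun v => blk v = i).card = m)
    (hD : ∀ v, G.degree v ≤ D) (hmD : 4 * D ≤ m) {ε : ℝ} (hε : 0 ≤ ε)
    (hp : ∀ i v, ((univ.filter fun r => 𝓡.tab i r = v).card : ℝ) / Fintype.card Ω ≤ (1 + ε) / m)
    {s : S} (hs : ∀ i, 𝓡.view s i = none) (T : ℕ) :
    T * listAvg Ω T (fun ω => if 𝓡.sel (𝓡.run s ω) ≠ none then 1 else 0) ≤
      (1 + ε) ^ T * (2 * Fintype.card ι) := by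
  set W := fun k => (words blk G A T A k).filter fun w => 2 * w.length ≤ T with hW
  have hm' : (0 : ℝ) < m := by exact_mod_cast hm
  have hx : (0 : ℝ) ≤ ((m : ℝ) ^ 2)⁻¹ := by positivity
  rw [← listAvg_const_mul]
  calc listAvg Ω T (fun ω => T * if 𝓡.sel (𝓡.run s ω) ≠ none then 1 else 0)
      ≤ listAvg Ω T (fun ω => ∑ k, ∑ w ∈ W k,
          if Explains blk (ends w) (𝓡.draws s ω) then 1 else 0) := by
        refine listAvg_mono fun ω hω => ?_
        split_ifs with h
        · have := 𝓡.length_le_of_sel_ne_none hs h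
          rw [hω] at this
          rw [mul_one]
          refine (Nat.cast_le.2 this).trans ?_
          rw [Nat.cast_sum]
          refine sum_le_sum fun k _ => ?_
          rw [← sum_filter, sum_const, nsmul_eq_mul, mul_one, Nat.cast_le]
          refine card_le_card fun w hw => ?_
          obtain ⟨hw, hwe⟩ := mem_filter.1 hw
          refine mem_filter.2 ⟨mem_filter.2 ⟨hw, ?_⟩, hwe⟩
          have h1 := hwe.length_le
          have h2 := 𝓡.length_draws_le s ω
          rw [length_ends] at h1
          omega
        · rw [mul_zero]
          exact sum_nonneg fun w _ => sum_nonneg fun h _ => by split_ifs <;> norm_num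
    _ = ∑ k, ∑ w ∈ W k, listAvg Ω T (fun ω =>
          if Explains blk (ends w) (𝓡.draws s ω) then 1 else 0) := by
        rw [listAvg_sum]
        exact sum_congr rfl fun w _ => listAvg_sum _ _ _
    _ ≤ ∑ k, ∑ w ∈ W k, (1 + ε) ^ T * (((m : ℝ) ^ 2)⁻¹) ^ w.length := by
        refine sum_le_sum fun k _ => sum_le_sum fun w hw => ?_
        refine (𝓡.listAvg_explains_le hp T s _).trans ?_
        have := pow_le_of_length (m := m) hε 0 (mem_filter.1 hw).2
        simpa [length_ends] using this
    _ = (1 + ε) ^ T * ∑ k, ∑ w ∈ W k, (((m : ℝ) ^ 2)⁻¹) ^ w.length := by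
        simp only [mul_sum]
    _ ≤ (1 + ε) ^ T * ∑ k : ι, 2 := by
        gcongr with k
        exact (sum_le_sum_of_subset_of_nonneg (filter_subset _ _)
          fun w _ _ => pow_nonneg hx _).trans (sum_words_le_two hm hA hD hmD T k)
    _ = _ := by rw [sum_const, card_univ, nsmul_eq_mul]; ring

end Resampler

end LazyResampling

/-! ### From probabilities to weights -/

namespace LazyResampling

open Finset

/-- This is the layer-cake decomposition of f. The induction removes the lowest layer: subtracting
the smallest positive value c leaves fewer positive values, and the layers of the truncated function
are layers of f. -/
theorem sum_mul_le_sum_mul_of_layers {α : Type*} (s : Finset α) (f μ ν : α → ℝ)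
    (hf : ∀ v ∈ s, 0 ≤ f v)
    (h : ∀ θ, 0 < θ → ∑ v ∈ s.filter (fun v => θ ≤ f v), μ v ≤
      ∑ v ∈ s.filter (fun v => θ ≤ f v), ν v) :
    ∑ v ∈ s, f v * μ v ≤ ∑ v ∈ s, f v * ν v := by
  induction hn : (s.filter fun v => 0 < f v).card using Nat.strong_induction_on generalizing f with
  | _ n ih =>
  subst hn
  rcases (s.filter fun v => 0 < f v).eq_empty_or_nonempty with he | hne
  · have h0 : ∀ v ∈ s, f v = 0 := fun v hv =>
      le_antisymm (not_lt.1 fun h => (filter_eq_empty_iff.1 he) hv h) (hf v hv)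
    exact (sum_congr rfl fun v hv => by rw [h0 v hv, zero_mul, zero_mul]).le
  obtain ⟨v₀, hv₀, hmin⟩ := exists_min_image _ f hne
  set c := f v₀ with hc
  obtain ⟨hv₀s, hc0⟩ := mem_filter.1 hv₀
  rw [← hc] at hc0
  have hcases : ∀ v ∈ s, f v = 0 ∨ c ≤ f v := fun v hv => by
    rcases (hf v hv).eq_or_lt with h | h
    exacts [Or.inl h.symm, Or.inr (hmin v (mem_filter.2 ⟨hv, h⟩))]
  have key : ∀ ρ : α → ℝ, ∑ v ∈ s, f v * ρ v =
      ∑ v ∈ s, max (f v - c) 0 * ρ v + c * ∑ v ∈ s.filter (fun v => c ≤ f v), ρ v := by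
    intro ρ
    rw [sum_filter, mul_sum, ← sum_add_distrib]
    refine sum_congr rfl fun v hv => ?_
    rcases hcases v hv with h | h
    · rw [if_neg (by rw [h]; exact not_le.2 hc0), h, max_eq_right (by linarith)]; ring
    · rw [if_pos h, max_eq_left (by linarith)]; ring
  rw [key μ, key ν]
  refine add_le_add (ih _ (card_lt_card ?_) _ (fun v _ => le_max_right _ _) (fun θ hθ => ?_) rfl)
    (mul_le_mul_of_nonneg_left (h c hc0) hc0.le)
  · refine (ssubset_iff_of_subset fun v hv => ?_).2 ⟨v₀, hv₀, ?_⟩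
    · obtain ⟨hv, hv'⟩ := mem_filter.1 hv
      refine mem_filter.2 ⟨hv, ?_⟩
      rcases lt_max_iff.1 hv' with h | h
      · linarith
      · exact absurd h (lt_irrefl _)
    · simp [← hc]
  · have : ∀ v, θ ≤ max (f v - c) 0 ↔ θ + c ≤ f v := fun v => by
      rw [le_max_iff, le_sub_iff_add_le]
      exact or_iff_left (not_le.2 hθ)
    simp only [this]
    exact h _ (by linarith)

/-- The size to which the blocks are cut down. -/
def listSize (D : ℕ) : ℕ := 4 * D + if D = 0 then 1 else 0

theorem listSize_pos (D : ℕ) : 0 < listSize D := by unfold listSize; split_ifs <;> omega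

theorem le_listSize (D : ℕ) : 4 * D ≤ listSize D := Nat.le_add_right _ _

/-- `κ` bounds the weight of a random transversal, as a fraction of the total weight. -/
structure IsRate (D b : ℕ) (κ : ℝ) : Prop where
  pos : 0 < κ
  size_le : listSize D ≤ b
  bound : ∀ h : ℕ, 1 ≤ h → h ≤ listSize D →
    2 * (h : ℝ) / (listSize D + h) ≤ κ * (h + b - listSize D)

theorem isRate_of_le {D b : ℕ} (hb : 0 < b) (h1 : 4 * D ≤ b) (h2 : b ≤ 8 * D) :
    IsRate D b (2 / ((b : ℝ) + 4 * √(((b : ℝ) - 4 * D) * D))) := by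
  have hD : D ≠ 0 := by omega
  have hm : listSize D = 4 * D := by simp [listSize, hD]
  have hb' : (0 : ℝ) < b := by exact_mod_cast hb
  have h1' : (4 : ℝ) * D ≤ b := by exact_mod_cast h1
  have hD' : (0 : ℝ) < D := by exact_mod_cast Nat.pos_of_ne_zero hD
  have hs : √(((b : ℝ) - 4 * D) * D) ^ 2 = ((b : ℝ) - 4 * D) * D :=
    Real.sq_sqrt (mul_nonneg (by linarith) hD'.le)
  have hs0 := Real.sqrt_nonneg (((b : ℝ) - 4 * D) * D)
  set σ := √(((b : ℝ) - 4 * D) * D)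
  refine ⟨by positivity, by omega, fun h _ _ => ?_⟩
  rw [hm]
  push_cast
  rw [div_mul_eq_mul_div, div_le_div_iff₀ (by positivity) (by positivity)]
  -- After clearing denominators the difference of the two sides is 2(h - 2σ)².
  nlinarith [sq_nonneg ((h : ℝ) - 2 * σ)]

theorem isRate_inv {D b : ℕ} (hb : 0 < b) (h1 : 8 * D ≤ b) : IsRate D b (1 / b) := by
  have hb' : (0 : ℝ) < b := by exact_mod_cast hb
  have hm0 : (0 : ℝ) < listSize D := by exact_mod_cast listSize_pos D
  refine ⟨by positivity, ?_, fun h hh hm => ?_⟩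
  · unfold listSize; split_ifs <;> omega
  -- For D = 0 one vertex is kept in each block and h = 1; then b may be less than twice the number
  -- of kept vertices, but the first factor below vanishes.
  have hcase : h = listSize D ∨ 2 * listSize D ≤ b := by
    by_cases hD : D = 0
    · simp [listSize, hD] at hm ⊢; omega
    · simp [listSize, hD]; omega
  have hm' : (h : ℝ) ≤ listSize D := by exact_mod_cast hm
  have h0 : (0 : ℝ) ≤ (listSize D - h) * (b - listSize D - h) := by
    rcases hcase with h | h
    · rw [h, sub_self, zero_mul]
    · have : (2 : ℝ) * listSize D ≤ b := by exact_mod_cast h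
      exact mul_nonneg (by linarith) (by linarith)
  rw [div_mul_eq_mul_div, div_le_div_iff₀ (by positivity) (by positivity)]
  nlinarith

namespace Resampler

variable {V ι : Type*} [DecidableEq ι] {blk : V → ι} {G : SimpleGraph V} {A : Finset V}
  {Ω S : Type*} (𝓡 : Resampler blk G A Ω S)

/-- The weight of the partial transversal in state `s`. -/
noncomputable def weight [Fintype ι] (w : V → ℝ) (s : S) : ℝ := ∑ i, (𝓡.view s i).elim 0 w

/-- The partial transversal in state `s`. -/
def chosen [Fintype V] [DecidableEq V] (s : S) : Finset V :=
  univ.filter fun v => 𝓡.view s (blk v) = some v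

variable [Fintype V] [DecidableEq V]

theorem isIndepTransversal_chosen {s : S} (hs : ∀ i, 𝓡.view s i = none) {ω : List Ω}
    (hω : 𝓡.sel (𝓡.run s ω) = none) : IsIndepTransversal G blk (𝓡.chosen (𝓡.run s ω)) := by
  obtain ⟨h1, h2, -⟩ := 𝓡.exists_log hs ω
  refine ⟨fun i => ?_, fun v hv u hu _ => ?_⟩
  · obtain ⟨v, hv⟩ := Option.ne_none_iff_exists'.1 (𝓡.sel_eq_none _ hω i)
    have hvi := (h1 i v hv).1
    refine ⟨v, ⟨by simp [chosen, hvi, hv], hvi⟩, fun u hu => ?_⟩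
    have := hu.1
    simp only [chosen, mem_filter, mem_univ, true_and, hu.2, hv, Option.some.injEq] at this
    exact this.symm
  · simp only [chosen, coe_filter, mem_univ, true_and, Set.mem_ofPred_eq] at hv hu
    exact h2 _ _ _ _ hv hu

variable [Fintype ι]

theorem sum_chosen {s : S} (hs : ∀ i, 𝓡.view s i = none) (ω : List Ω) (w : V → ℝ) :
    ∑ v ∈ 𝓡.chosen (𝓡.run s ω), w v = 𝓡.weight w (𝓡.run s ω) := by
  obtain ⟨h1, -, -⟩ := 𝓡.exists_log hs ω
  unfold chosen weight
  set t := 𝓡.run s ω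
  have : ∀ i, (𝓡.view t i).elim 0 w = ∑ v, if 𝓡.view t i = some v then w v else 0 := by
    intro i
    cases h : 𝓡.view t i <;> simp
  simp only [this]
  rw [sum_comm, sum_filter]
  refine sum_congr rfl fun v _ => ?_
  rw [sum_eq_single (blk v)]
  · intro i _ hi
    rw [if_neg]
    intro h
    exact hi (h1 i v h).1.symm
  · simp

variable [DecidableRel G.Adj] {b D : ℕ} [Fintype Ω] [Nonempty Ω]

/-- The expected weight of the partial transversal found by a run of `T` steps. -/
theorem listAvg_weight_le {κ : ℝ} (hκ : IsRate D b κ)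
    (hA : ∀ i, (A.filter fun v => blk v = i).card = listSize D)
    (hb : ∀ i, (univ.filter fun v => blk v = i).card = b)
    (hD : ∀ v, G.degree v ≤ D) {w : V → ℝ} (hw : ∀ v, 0 ≤ w v)
    (hlight : ∀ v ∈ A, ∀ u, u ∉ A → blk u = blk v → w v ≤ w u) {ε : ℝ} (hε : 0 ≤ ε)
    (hp : ∀ i v, ((univ.filter fun r => 𝓡.tab i r = v).card : ℝ) / Fintype.card Ω ≤
      (1 + ε) / listSize D)
    {s : S} (hs : ∀ i, 𝓡.view s i = none) (T : ℕ) :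
    listAvg Ω T (fun ω => 𝓡.weight w (𝓡.run s ω)) ≤ (1 + ε) ^ T * κ * ∑ v, w v := by
  classical
  have hη : 0 ≤ (1 + ε) ^ T := by positivity
  unfold weight
  rw [listAvg_sum, ← sum_fiberwise univ blk w, mul_sum]
  refine sum_le_sum fun i _ => ?_
  set B := univ.filter fun v => blk v = i with hB
  have e1 : listAvg Ω T (fun ω => (𝓡.view (𝓡.run s ω) i).elim 0 w) =
      ∑ v ∈ B, w v * listAvg Ω T fun ω => if 𝓡.view (𝓡.run s ω) i = some v then 1 else 0 := by
    simp only [← listAvg_const_mul]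
    rw [← listAvg_sum]
    refine listAvg_congr fun ω _ => ?_
    have h1 := (𝓡.exists_log hs ω).1 i
    match hv : 𝓡.view (𝓡.run s ω) i with
    | none => simp
    | some v =>
      have hvB : v ∈ B := mem_filter.2 ⟨mem_univ _, (h1 v hv).1⟩
      simp [hvB]
  rw [e1, mul_sum]
  simp only [mul_comm _ (w _)]
  -- Within one block, the distribution of the chosen vertex is compared with a constant measure, on
  -- the sets F of vertices of weight at least θ.
  refine sum_mul_le_sum_mul_of_layers B w _ _ (fun v _ => hw v) fun θ hθ => ?_
  rw [← listAvg_sum, sum_const, nsmul_eq_mul]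
  set F := B.filter fun v => θ ≤ w v with hF
  set H := F ∩ A with hH
  have hHA : H ⊆ A.filter fun v => blk v = i := by
    intro v hv
    simp only [hH, hF, hB, mem_inter, mem_filter, mem_univ, true_and] at hv ⊢
    exact ⟨hv.2, hv.1.1⟩
  have e2 : listAvg Ω T (fun ω => ∑ v ∈ F, if 𝓡.view (𝓡.run s ω) i = some v then (1 : ℝ) else 0) =
      listAvg Ω T (fun ω => if ∃ v ∈ H, 𝓡.view (𝓡.run s ω) i = some v then 1 else 0) := by
    refine listAvg_congr fun ω _ => ?_
    have h1 := (𝓡.exists_log hs ω).1 i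
    match hv : 𝓡.view (𝓡.run s ω) i with
    | none => simp
    | some v => simp [hH, (h1 v hv).2]
  rw [e2]
  refine (𝓡.listAvg_view_mem_le (listSize_pos D) hA hD (le_listSize D) hε hp hs T i hHA).trans ?_
  rw [mul_left_comm (F.card : ℝ)]
  refine mul_le_mul_of_nonneg_left ?_ hη
  rcases H.eq_empty_or_nonempty with he | ⟨v, hv⟩
  · rw [he, card_empty]
    have := hκ.pos
    simp
    positivity
  -- F contains a kept vertex, and the discarded vertices of the block are at least as heavy, so all
  -- of them lie in F.
  have hcard : F.card + listSize D = H.card + b := by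
    have hb' : B.card = b := hb i
    have hA' := hA i
    have h2 : F \ A = B \ A := by
      ext u
      simp only [hF, mem_sdiff, mem_filter]
      refine ⟨fun h => ⟨h.1.1, h.2⟩, fun h => ⟨⟨h.1, ?_⟩, h.2⟩⟩
      simp only [hH, hF, hB, mem_inter, mem_filter, mem_univ, true_and] at hv
      have hu := h.1
      simp only [hB, mem_filter, mem_univ, true_and] at hu
      exact hv.1.2.trans (hlight v hv.2 u h.2 (hu.trans hv.1.1.symm))
    have h3 := card_inter_add_card_sdiff F A
    have h4 := card_inter_add_card_sdiff B A
    rw [h2] at h3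
    have h5 : B ∩ A = A.filter fun v => blk v = i := by
      ext u; simp [hB, and_comm]
    rw [h5] at h4
    rw [hH]
    omega
  have hcard' : (F.card : ℝ) = H.card + b - listSize D := by
    rw [eq_sub_iff_add_eq]; exact_mod_cast hcard
  rw [hcard', mul_comm _ κ]
  exact hκ.bound _ (card_pos.2 ⟨v, hv⟩) ((card_le_card hHA).trans (hA i).le)

open Classical in
/-- The probability that a run of `T` steps does not find a transversal of small weight. -/
theorem listAvg_failure_le {κ : ℝ} (hκ : IsRate D b κ)
    (hA : ∀ i, (A.filter fun v => blk v = i).card = listSize D)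
    (hb : ∀ i, (univ.filter fun v => blk v = i).card = b)
    (hD : ∀ v, G.degree v ≤ D) {w : V → ℝ} (hw : ∀ v, 0 ≤ w v)
    (hlight : ∀ v ∈ A, ∀ u, u ∉ A → blk u = blk v → w v ≤ w u) {ε : ℝ} (hε : 0 ≤ ε)
    (hp : ∀ i v, ((univ.filter fun r => 𝓡.tab i r = v).card : ℝ) / Fintype.card Ω ≤
      (1 + ε) / listSize D)
    {s : S} (hs : ∀ i, 𝓡.view s i = none) (T : ℕ) {δ : ℝ} (hδ : 0 < δ) (hδ1 : δ ≤ 1)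
    (hη : (1 + ε) ^ T ≤ 1 + δ / 4) (hT : 32 * Fintype.card ι ≤ T * δ) (hT0 : 0 < T) :
    listAvg Ω T (fun ω => if 𝓡.sel (𝓡.run s ω) = none ∧
      𝓡.weight w (𝓡.run s ω) ≤ (1 + δ) * (κ * ∑ v, w v) then 0 else 1) ≤ 1 - δ / 4 := by
  have hκ0 := hκ.pos
  have hW0 : 0 ≤ ∑ v, w v := sum_nonneg fun v _ => hw v
  have hT0' : (0 : ℝ) < T := by exact_mod_cast hT0
  set K := κ * ∑ v, w v with hK
  have hK0 : 0 ≤ K := by positivity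
  -- Since (1 + ε)ᵀ ≤ 2, the probability is at most 4/T times the number of blocks; this explains
  -- the constant 32.
  have hunf : listAvg Ω T (fun ω => if 𝓡.sel (𝓡.run s ω) ≠ none then 1 else 0) ≤ δ / 8 := by
    have h := 𝓡.mul_listAvg_sel_ne_none_le (listSize_pos D) hA hD (le_listSize D) hε hp hs T
    have h2 : (1 + ε) ^ T * (2 * Fintype.card ι) ≤ (1 + 1) * (2 * (T * δ / 32)) := by
      gcongr
      · linarith
      · linarith
    have h3 := h.trans h2
    have h4 : (T : ℝ) * listAvg Ω T (fun ω => if 𝓡.sel (𝓡.run s ω) ≠ none then 1 else 0) ≤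
        T * (δ / 8) := h3.trans_eq (by ring)
    exact le_of_mul_le_mul_left h4 hT0'
  have hwt0 : ∀ t : S, 0 ≤ 𝓡.weight w t := fun t => sum_nonneg fun i _ => by
    cases 𝓡.view t i with
    | none => exact le_rfl
    | some v => exact hw v
  -- This is Markov's inequality. If K = 0, it says nothing, but then all weights vanish.
  have hbig : listAvg Ω T (fun ω => if (1 + δ) * K < 𝓡.weight w (𝓡.run s ω) then 1 else 0) ≤
      (1 + δ / 4) / (1 + δ) := by
    rcases hK0.eq_or_lt with h0 | hpos
    · have hW : ∑ v, w v = 0 := by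
        rcases mul_eq_zero.1 h0.symm with h | h
        exacts [absurd h hκ0.ne', h]
      have hw0 : ∀ v, w v = 0 := fun v =>
        (sum_eq_zero_iff_of_nonneg fun v _ => hw v).1 hW v (mem_univ v)
      have hwt : ∀ t : S, 𝓡.weight w t = 0 := fun t => sum_eq_zero fun i _ => by
        cases 𝓡.view t i with
        | none => rfl
        | some v => exact hw0 v
      simp only [hwt, ← h0, mul_zero, lt_irrefl, if_false]
      rw [listAvg_const]
      positivity
    · rw [le_div_iff₀ (by positivity)]
      have h1 : listAvg Ω T (fun ω => (1 + δ) * K *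
          if (1 + δ) * K < 𝓡.weight w (𝓡.run s ω) then 1 else 0) ≤
          listAvg Ω T (fun ω => 𝓡.weight w (𝓡.run s ω)) := by
        refine listAvg_mono fun ω _ => ?_
        split_ifs with h
        · linarith
        · rw [mul_zero]; exact hwt0 _
      rw [listAvg_const_mul] at h1
      have h2 := h1.trans (𝓡.listAvg_weight_le hκ hA hb hD hw hlight hε hp hs T)
      have h3 : (1 + ε) ^ T * κ * ∑ v, w v ≤ (1 + δ / 4) * K := by
        rw [mul_assoc]
        gcongr
      have h4 := h2.trans h3
      refine le_of_mul_le_mul_left ?_ hpos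
      linarith
  have hsum : listAvg Ω T (fun ω => if 𝓡.sel (𝓡.run s ω) = none ∧
      𝓡.weight w (𝓡.run s ω) ≤ (1 + δ) * K then 0 else 1) ≤ δ / 8 + (1 + δ / 4) / (1 + δ) := by
    refine le_trans ?_ (add_le_add hunf hbig)
    rw [← listAvg_add]
    refine listAvg_mono fun ω _ => ?_
    by_cases h1 : 𝓡.sel (𝓡.run s ω) = none <;>
      by_cases h2 : 𝓡.weight w (𝓡.run s ω) ≤ (1 + δ) * K
    · rw [if_pos ⟨h1, h2⟩, if_neg (not_not.2 h1), if_neg (not_lt.2 h2), add_zero]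
    · simp [h1, not_le.1 h2, h2]
    · simp [h1, not_lt.2 h2]
    · simp [h1, not_le.1 h2]
  refine hsum.trans ?_
  have : (1 + δ / 4) / (1 + δ) ≤ 1 - 3 * δ / 8 := by
    rw [div_le_iff₀ (by positivity)]
    nlinarith
  linarith

end Resampler

open Classical in
-- Disjoint segments of the list are independent, so the failure probabilities multiply.
theorem listAvg_forall_block_le {Ω : Type*} [Fintype Ω] {T : ℕ} {Bad : List Ω → Prop} {q : ℝ}
    (hq : listAvg Ω T (fun ω => if Bad ω then 1 else 0) ≤ q) (R : ℕ) :
    listAvg Ω (R * T) (fun ω => if ∀ j < R, Bad ((ω.drop (j * T)).take T) then 1 else 0) ≤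
      q ^ R := by
  have hq0 : 0 ≤ q := (listAvg_nonneg fun l _ => by split_ifs <;> norm_num).trans hq
  induction R with
  | zero => simp [listAvg]
  | succ R ih =>
    rw [show (R + 1) * T = T + R * T by ring, listAvg_append, pow_succ]
    calc _ ≤ listAvg Ω T (fun ω => q ^ R * if Bad ω then 1 else 0) := by
          refine listAvg_mono fun ω hω => ?_
          split_ifs with h
          · rw [mul_one]
            refine le_trans (listAvg_mono fun ω' _ => ?_) ih
            have : (∀ j < R + 1, Bad (((ω ++ ω').drop (j * T)).take T)) →
                ∀ j < R, Bad ((ω'.drop (j * T)).take T) := by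
              intro H j hj
              have := H (j + 1) (by omega)
              rwa [show (j + 1) * T = ω.length + j * T by rw [hω]; ring, ← List.drop_drop,
                List.drop_left] at this
            split_ifs with h1 h2
            exacts [le_rfl, absurd (this h1) h2, zero_le_one, le_rfl]
          · rw [mul_zero]
            refine (listAvg_mono (F' := fun _ => 0 * 0) fun ω' _ => ?_).trans
              ((listAvg_const_mul _ _ _).trans (zero_mul _)).le
            rw [if_neg]
            · simp
            · intro H
              have := H 0 (by omega)
              rw [zero_mul, List.drop_zero, List.take_left' hω] at this
              exact h this
      _ = q ^ R * listAvg Ω T (fun ω => if Bad ω then 1 else 0) := listAvg_const_mul _ _ _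
      _ ≤ q ^ R * q := by gcongr

/-- Bernoulli's inequality bounds (1 + x)ᴿ from below, and (1 - x)(1 + x) ≤ 1. -/
theorem one_sub_pow_le {x : ℝ} (hx : 0 ≤ x) (hx1 : x ≤ 1) (R : ℕ) :
    (1 - x) ^ R ≤ 1 / (1 + R * x) := by
  rw [le_div_iff₀ (by positivity)]
  have h1 : 1 + R * x ≤ (1 + x) ^ R := one_add_mul_le_pow (by linarith) R
  calc (1 - x) ^ R * (1 + R * x) ≤ (1 - x) ^ R * (1 + x) ^ R := by
        have : 0 ≤ 1 - x := by linarith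
        gcongr
    _ = (1 - x ^ 2) ^ R := by rw [← mul_pow]; ring
    _ ≤ 1 := pow_le_one₀ (by nlinarith) (by nlinarith)

theorem exists_lightest {α : Type*} [DecidableEq α] (s : Finset α) (f : α → ℝ) {m : ℕ}
    (hm : m ≤ s.card) : ∃ t ⊆ s, t.card = m ∧ ∀ v ∈ t, ∀ u ∈ s, u ∉ t → f v ≤ f u := by
  induction m with
  | zero => exact ⟨∅, by simp, by simp, by simp⟩
  | succ m ih =>
    obtain ⟨t, hts, htc, ht⟩ := ih (by omega)
    have hne : (s \ t).Nonempty := by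
      rw [← card_pos, card_sdiff_of_subset hts]; omega
    obtain ⟨x, hx, hmin⟩ := exists_min_image _ f hne
    obtain ⟨hxs, hxt⟩ := mem_sdiff.1 hx
    refine ⟨insert x t, insert_subset hxs hts, by rw [card_insert_of_notMem hxt, htc], ?_⟩
    intro v hv u hu hut
    rw [mem_insert, not_or] at hut
    rcases mem_insert.1 hv with rfl | hv
    · exact hmin u (mem_sdiff.2 ⟨hu, hut.2⟩)
    · exact ht v hv u hu hut.2

/-! ### Existence -/

open Classical in
/-- The algorithm that draws uniformly from `A`. -/
noncomputable def uniformResampler {V ι : Type*} [DecidableEq ι] (blk : V → ι) (G : SimpleGraph V)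
    (A : Finset V) {m : ℕ} (hA : ∀ i, (A.filter fun v => blk v = i).card = m) :
    Resampler blk G A (Fin m) (ι → Option V) where
  view := id
  sel s := if h : ∃ i, s i = none then some h.choose else none
  tab i r := ((A.filter fun v => blk v = i).equivFinOfCardEq (hA i)).symm r
  next s r :=
    if h : ∃ i, s i = none then
      let v : V := ((A.filter fun v => blk v = h.choose).equivFinOfCardEq (hA _)).symm r
      if h' : ∃ j u, s j = some u ∧ G.Adj v u then Function.update s h'.choose none
      else Function.update s h.choose (some v)
    else s
  tab_mem i r := (mem_filter.1 (Subtype.prop _)).1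
  blk_tab i r := (mem_filter.1 (Subtype.prop
    (((A.filter fun v => blk v = i).equivFinOfCardEq (hA i)).symm r))).2
  sel_eq_none s hs := by
    by_contra! h
    have h' : ∃ i, s i = none := h
    simp only [dif_pos h'] at hs
    exact absurd hs (by simp)
  next_eq s r hs := by
    rw [dif_neg]
    intro h
    simp only [dif_pos h] at hs
    exact absurd hs (by simp)
  view_sel s i hs := by
    split_ifs at hs with h
    · rw [← Option.some.inj hs]; exact h.choose_spec
  view_next s i r hs := by
    split_ifs at hs with h
    obtain rfl := Option.some.inj hs
    by_cases h' : ∃ j u, s j = some u ∧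
      G.Adj (((A.filter fun v => blk v = h.choose).equivFinOfCardEq (hA _)).symm r : V) u
    · simp only [dif_pos h, dif_pos h']
      obtain ⟨u, hu⟩ := h'.choose_spec
      exact Or.inr ⟨h'.choose, u, hu.1, hu.2, rfl⟩
    · simp only [dif_pos h, dif_neg h']
      push Not at h'
      exact Or.inl ⟨h', rfl⟩

/-- There is an independent transversal whose weight is at most the expected weight of a random
one. -/
theorem exists_isIndepTransversal {V ι : Type*} [Fintype V] [DecidableEq V] [DecidableEq ι]
    (G : SimpleGraph V) [DecidableRel G.Adj] (blk : V → ι) {b : ℕ} (hb0 : 0 < b)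
    (hb : ∀ i, (univ.filter fun v => blk v = i).card = b) {w : V → ℝ} (hw : ∀ v, 0 ≤ w v)
    {κ : ℝ} (hκ : IsRate G.maxDegree b κ) :
    ∃ I : Finset V, IsIndepTransversal G blk I ∧ ∑ v ∈ I, w v ≤ κ * ∑ v, w v := by
  classical
  have hsurj : Function.Surjective blk := fun i => by
    obtain ⟨v, hv⟩ := card_pos.1 ((hb i).symm ▸ hb0)
    exact ⟨v, (mem_filter.1 hv).2⟩
  have := Fintype.ofSurjective blk hsurj
  set D := G.maxDegree
  choose t hts htc ht using fun i => exists_lightest (univ.filter fun v => blk v = i) w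
    (m := listSize D) ((hb i).symm ▸ hκ.size_le)
  set A : Finset V := univ.biUnion t with hAdef
  have hmem : ∀ i v, v ∈ t i → blk v = i := fun i v hv => (mem_filter.1 (hts i hv)).2
  have hAi : ∀ i, (A.filter fun v => blk v = i) = t i := by
    intro i
    ext v
    simp only [hAdef, mem_filter, mem_biUnion, mem_univ, true_and]
    constructor
    · rintro ⟨⟨j, hj⟩, rfl⟩
      rwa [← hmem j v hj] at hj
    · exact fun h => ⟨⟨i, h⟩, hmem i v h⟩
  have hA : ∀ i, (A.filter fun v => blk v = i).card = listSize D := fun i => by rw [hAi, htc]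
  have hlight : ∀ v ∈ A, ∀ u, u ∉ A → blk u = blk v → w v ≤ w u := by
    intro v hv u hu huv
    refine ht (blk v) v ?_ u (mem_filter.2 ⟨mem_univ _, huv⟩) fun h => hu ?_
    · rw [← hAi]; exact mem_filter.2 ⟨hv, rfl⟩
    · rw [← hAi] at h; exact (mem_filter.1 h).1
  set 𝓡 := uniformResampler blk G A hA with h𝓡
  have hm := listSize_pos D
  have : Nonempty (Fin (listSize D)) := ⟨⟨0, hm⟩⟩
  -- The draws are exactly uniform, so ε = 0 and T can be as large as desired.
  have hp : ∀ i v, ((univ.filter fun r => 𝓡.tab i r = v).card : ℝ) /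
      Fintype.card (Fin (listSize D)) ≤ (1 + 0) / listSize D := by
    intro i v
    rw [Fintype.card_fin, add_zero]
    gcongr
    have : (univ.filter fun r => 𝓡.tab i r = v).card ≤ 1 := by
      refine card_le_one.2 fun r hr r' hr' => ?_
      have := (mem_filter.1 hr).2.trans (mem_filter.1 hr').2.symm
      exact (Equiv.injective _ (Subtype.ext this))
    exact_mod_cast this
  set K := κ * ∑ v, w v
  have hK0 : 0 ≤ K := mul_nonneg hκ.pos.le (sum_nonneg fun v _ => hw v)
  by_contra! hno
  -- There are finitely many transversals, so if all of them weigh more than K, they do so by a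
  -- common margin δ.
  obtain ⟨δ, hδ, hδI⟩ : ∃ δ > 0, ∀ I, IsIndepTransversal G blk I → K + δ ≤ ∑ v ∈ I, w v := by
    rcases (univ.filter fun I => IsIndepTransversal G blk I).eq_empty_or_nonempty with he | hne
    · exact ⟨1, one_pos, fun I hI => absurd hI ((filter_eq_empty_iff.1 he) (mem_univ I))⟩
    · obtain ⟨I₀, hI₀, hmin⟩ := exists_min_image _ (fun I => ∑ v ∈ I, w v) hne
      refine ⟨∑ v ∈ I₀, w v - K, sub_pos.2 (hno _ (mem_filter.1 hI₀).2), fun I hI => ?_⟩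
      have := hmin I (mem_filter.2 ⟨mem_univ _, hI⟩)
      linarith
  set s : ι → Option V := fun _ => none
  have hs : ∀ i, 𝓡.view s i = none := fun i => rfl
  -- With this T, an unfinished run contributes less than δ to the estimate below, while the
  -- expected weight is at most K.
  obtain ⟨T, hT⟩ := exists_nat_gt ((K + δ) * (2 * Fintype.card ι) / δ)
  have hE := 𝓡.listAvg_weight_le hκ hA hb (fun v => G.degree_le_maxDegree v) hw hlight le_rfl hp hs T
  have hU := 𝓡.mul_listAvg_sel_ne_none_le hm hA (fun v => G.degree_le_maxDegree v)
    (le_listSize D) le_rfl hp hs T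
  rw [add_zero, one_pow, one_mul] at hE hU
  have hT0 : (0 : ℝ) < T := lt_of_le_of_lt (by positivity) hT
  have hwt0 : ∀ t, 0 ≤ 𝓡.weight w t := fun t => sum_nonneg fun i _ => by
    cases 𝓡.view t i with
    | none => exact le_rfl
    | some v => exact hw v
  have h1 : listAvg (Fin (listSize D)) T (fun ω => K + δ) ≤ listAvg (Fin (listSize D)) T
      (fun ω => 𝓡.weight w (𝓡.run s ω) +
        (K + δ) * if 𝓡.sel (𝓡.run s ω) ≠ none then 1 else 0) := by
    refine listAvg_mono fun ω _ => ?_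
    split_ifs with h
    · have := hwt0 (𝓡.run s ω)
      linarith
    · rw [mul_zero, add_zero, ← 𝓡.sum_chosen hs ω w]
      exact hδI _ (𝓡.isIndepTransversal_chosen hs (not_not.1 h))
  rw [listAvg_const, listAvg_add, listAvg_const_mul] at h1
  have h2 : δ ≤ (K + δ) * listAvg (Fin (listSize D)) T
      (fun ω => if 𝓡.sel (𝓡.run s ω) ≠ none then 1 else 0) := by linarith
  have h3 : T * δ ≤ (K + δ) * (2 * Fintype.card ι) := by
    calc T * δ ≤ T * ((K + δ) * _) := by gcongr
      _ = (K + δ) * (T * listAvg (Fin (listSize D)) T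
        (fun ω => if 𝓡.sel (𝓡.run s ω) ≠ none then 1 else 0)) := by ring
      _ ≤ _ := by gcongr
  rw [div_lt_iff₀ hδ] at hT
  linarith

end LazyResampling

/-! ### A program logic with word lengths and running times -/

namespace RandRAM

/-- All numbers in the store have at most `X` bits. -/
def Store.Bounded (X : ℕ) (s : Store) : Prop :=
  (∀ x, s.var x < 2 ^ X) ∧ ∀ a j, s.arr a j < 2 ^ X

theorem Store.Bounded.setVar {X : ℕ} {s : Store} (hs : s.Bounded X) {x v : ℕ} (hv : v < 2 ^ X) :
    (s.setVar x v).Bounded X := by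
  refine ⟨fun y => ?_, hs.2⟩
  simp only [Store.setVar, Function.update_apply]
  split_ifs
  exacts [hv, hs.1 y]

theorem Store.Bounded.setArr {X : ℕ} {s : Store} (hs : s.Bounded X) {a j v : ℕ} (hv : v < 2 ^ X) :
    (s.setArr a j v).Bounded X := by
  refine ⟨hs.1, fun b i => ?_⟩
  by_cases hb : b = a
  · subst hb
    simp only [Store.setArr, Function.update_self, Function.update_apply]
    split_ifs
    exacts [hv, hs.2 _ _]
  · simp only [Store.setArr, Function.update_of_ne hb]
    exact hs.2 _ _

/-- A bound for the bit length of the value of an expression, in units of the word length. -/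
def Expr.valWeight : Expr → ℕ
  | .lit k => Nat.size k
  | .var _ => 1
  | .read _ _ => 1
  | .bin _ e f => e.valWeight + f.valWeight + 1

/-- A bound for the cost of an expression, in units of the word length. -/
def Expr.costWeight : Expr → ℕ
  | .lit k => 1 + Nat.size k
  | .var _ => 1
  | .read _ e => e.costWeight + 1
  | .bin o e f => e.costWeight + f.costWeight + (1 + (Expr.bin o e f).valWeight)

theorem size_binOp_le (o : BinOp) (a b : ℕ) :
    Nat.size (o.eval a b) ≤ Nat.size a + Nat.size b + 1 := by
  have ha := Nat.lt_size_self a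
  have hb := Nat.lt_size_self b
  have hle : ∀ c, c ≤ a → Nat.size c ≤ Nat.size a + Nat.size b + 1 := fun c h => by
    have := Nat.size_le_size h; omega
  cases o with
  | add =>
    rw [BinOp.eval, Nat.size_le, pow_succ, pow_add]
    have h1 := Nat.one_le_two_pow (n := a.size)
    have h2 := Nat.one_le_two_pow (n := b.size)
    nlinarith
  | sub => exact hle _ (Nat.sub_le _ _)
  | mul =>
    rw [BinOp.eval, Nat.size_le, pow_succ, pow_add]
    have := Nat.mul_lt_mul'' ha hb
    omega
  | div => exact hle _ (Nat.div_le_self _ _)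
  | mod => exact hle _ (Nat.mod_le _ _)
  | lt =>
    have : Nat.size (BinOp.lt.eval a b) ≤ 1 := by
      rw [Nat.size_le, BinOp.eval]; split_ifs <;> norm_num
    omega
  | eq =>
    have : Nat.size (BinOp.eq.eval a b) ≤ 1 := by
      rw [Nat.size_le, BinOp.eval]; split_ifs <;> norm_num
    omega

theorem Expr.size_eval_le {X : ℕ} {s : Store} (hs : s.Bounded X) (e : Expr) :
    Nat.size (e.eval s) ≤ e.valWeight * (X + 1) := by
  induction e with
  | lit k => exact Nat.le_mul_of_pos_right _ (Nat.succ_pos _)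
  | var x => have := Nat.size_le.2 (hs.1 x); simp only [valWeight, eval]; omega
  | read a e _ =>
    have := Nat.size_le.2 (hs.2 a (e.eval s)); simp only [valWeight, eval]; omega
  | bin o e f he hf =>
    have := size_binOp_le o (e.eval s) (f.eval s)
    simp only [valWeight, eval, add_mul, one_mul]
    omega

theorem Expr.cost_le {X : ℕ} {s : Store} (hs : s.Bounded X) (e : Expr) :
    e.cost s ≤ e.costWeight * (X + 1) := by
  induction e with
  | lit k => exact Nat.le_mul_of_pos_right _ (Nat.succ_pos _)
  | var x => have := Nat.size_le.2 (hs.1 x); simp only [costWeight, cost]; omega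
  | read a e he =>
    have := Nat.size_le.2 (hs.2 a (e.eval s))
    simp only [costWeight, cost, add_mul, one_mul]; omega
  | bin o e f he hf =>
    have := Expr.size_eval_le hs (.bin o e f)
    simp only [eval] at this
    simp only [costWeight, cost, add_mul, one_mul]
    omega

/-- The time needed by a command whose loops are iterated at most `X` times, on words of at most
`X` bits. -/
def Cmd.timeBound (X : ℕ) : Cmd → ℕ
  | .skip => 1
  | .assign _ e => 1 + e.costWeight * (X + 1)
  | .write _ e f => 1 + e.costWeight * (X + 1) + f.costWeight * (X + 1)
  | .flip _ e => 1 + e.costWeight * (X + 1) + X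
  | .seq c d => 1 + c.timeBound X + d.timeBound X
  | .cond e c d => 1 + e.costWeight * (X + 1) + c.timeBound X + d.timeBound X
  | .loop e c => (X + 1) * (1 + e.costWeight * (X + 1) + c.timeBound X)

open Polynomial in
theorem Cmd.exists_polynomial_timeBound (c : Cmd) :
    ∃ p : ℕ[X], ∀ X, c.timeBound X = p.eval X := by
  induction c with
  | skip => exact ⟨1, by simp [timeBound]⟩
  | assign _ e => exact ⟨1 + C e.costWeight * (X + 1), by simp [timeBound]⟩
  | write _ e f =>
    exact ⟨1 + C e.costWeight * (X + 1) + C f.costWeight * (X + 1), by simp [timeBound]⟩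
  | flip _ e => exact ⟨1 + C e.costWeight * (X + 1) + X, by simp [timeBound]⟩
  | seq c d hc hd =>
    obtain ⟨p, hp⟩ := hc
    obtain ⟨q, hq⟩ := hd
    exact ⟨1 + p + q, by simp [timeBound, hp, hq]⟩
  | cond e c d hc hd =>
    obtain ⟨p, hp⟩ := hc
    obtain ⟨q, hq⟩ := hd
    exact ⟨1 + C e.costWeight * (X + 1) + p + q, by simp [timeBound, hp, hq]⟩
  | loop e c hc =>
    obtain ⟨p, hp⟩ := hc
    exact ⟨(X + 1) * (1 + C e.costWeight * (X + 1) + p), by simp [timeBound, hp]⟩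

/-- The command `c`, started on the store `s` and the random numbers `τ`, halts within its time
bound, and the final store and the remaining random numbers satisfy `Q`. -/
def Wp (k X : ℕ) (c : Cmd) (s : Store) (τ : List (Fin (2 ^ k)))
    (Q : Store → List (Fin (2 ^ k)) → Prop) : Prop :=
  s.Bounded X → ∃ s' τ' δ n,
    (∀ K t m, tapeRun k (n + m) ⟨c :: K, s, t⟩ τ = tapeRun k m ⟨K, s', t + δ⟩ τ') ∧
    n ≤ δ ∧ δ ≤ c.timeBound X ∧ s'.Bounded X ∧ Q s' τ'

section Wp

variable {k X : ℕ} {s : Store} {τ : List (Fin (2 ^ k))} {Q Q' : Store → List (Fin (2 ^ k)) → Prop}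

theorem Wp.mono {c : Cmd} (h : Wp k X c s τ Q) (hQ : ∀ s' τ', Q s' τ' → Q' s' τ') :
    Wp k X c s τ Q' := by
  intro hs
  obtain ⟨s', τ', δ, n, h1, h2, h3, h4, h5⟩ := h hs
  exact ⟨s', τ', δ, n, h1, h2, h3, h4, hQ _ _ h5⟩

theorem Wp.skip (h : Q s τ) : Wp k X .skip s τ Q := fun hs =>
  ⟨s, τ, 1, 1, fun K t m => by rw [Nat.add_comm 1 m]; rfl, le_rfl, le_rfl, hs, h⟩

theorem Wp.assign {x : ℕ} {e : Expr} (he : e.eval s < 2 ^ X) (h : Q (s.setVar x (e.eval s)) τ) :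
    Wp k X (.assign x e) s τ Q := fun hs =>
  ⟨_, τ, 1 + e.cost s, 1, fun K t m => by rw [Nat.add_comm 1 m]; rfl, by omega,
    Nat.add_le_add_left (e.cost_le hs) _, hs.setVar he, h⟩

theorem Wp.write {a : ℕ} {e f : Expr} (hf : f.eval s < 2 ^ X)
    (h : Q (s.setArr a (e.eval s) (f.eval s)) τ) : Wp k X (.write a e f) s τ Q := fun hs =>
  ⟨_, τ, 1 + e.cost s + f.cost s, 1, fun K t m => by rw [Nat.add_comm 1 m]; rfl, by omega,
    by have := e.cost_le hs; have := f.cost_le hs; simp only [Cmd.timeBound]; omega,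
    hs.setArr hf, h⟩

theorem Wp.flip (hk : k ≤ X) {x : ℕ} {e : Expr} (he : e.eval s = k) {r : Fin (2 ^ k)}
    (h : Q (s.setVar x r.val) τ) : Wp k X (.flip x e) s (r :: τ) Q := fun hs =>
  ⟨_, τ, 1 + e.cost s + e.eval s, 1, fun K t m => by
    rw [Nat.add_comm 1 m]; simp [tapeRun, he], by omega,
    by have := e.cost_le hs; simp only [Cmd.timeBound]; omega,
    hs.setVar (r.isLt.trans_le (Nat.pow_le_pow_right two_pos hk)), h⟩

theorem Wp.seq {c d : Cmd} (h : Wp k X c s τ fun s' τ' => Wp k X d s' τ' Q) :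
    Wp k X (.seq c d) s τ Q := by
  intro hs
  obtain ⟨s₁, τ₁, δ₁, n₁, h1, h2, h3, h4, h5⟩ := h hs
  obtain ⟨s₂, τ₂, δ₂, n₂, h6, h7, h8, h9, h10⟩ := h5 h4
  refine ⟨s₂, τ₂, 1 + δ₁ + δ₂, 1 + n₁ + n₂, fun K t m => ?_, by omega, ?_, h9, h10⟩
  · rw [show 1 + n₁ + n₂ + m = n₁ + (n₂ + m) + 1 by omega, tapeRun, h1, h6]
    simp only [add_assoc]
  · simp only [Cmd.timeBound]; omega

theorem Wp.cond {e : Expr} {c d : Cmd} (hc : e.eval s ≠ 0 → Wp k X c s τ Q)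
    (hd : e.eval s = 0 → Wp k X d s τ Q) : Wp k X (.cond e c d) s τ Q := by
  intro hs
  have he := e.cost_le hs
  by_cases h : e.eval s = 0
  · obtain ⟨s', τ', δ, n, h1, h2, h3, h4, h5⟩ := hd h hs
    refine ⟨s', τ', 1 + e.cost s + δ, 1 + n, fun K t m => ?_, by omega, ?_, h4, h5⟩
    · rw [show 1 + n + m = n + m + 1 by omega, tapeRun, if_neg (not_not.2 h), h1]
      simp only [add_assoc]
    · simp only [Cmd.timeBound]; omega
  · obtain ⟨s', τ', δ, n, h1, h2, h3, h4, h5⟩ := hc h hs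
    refine ⟨s', τ', 1 + e.cost s + δ, 1 + n, fun K t m => ?_, by omega, ?_, h4, h5⟩
    · rw [show 1 + n + m = n + m + 1 by omega, tapeRun, if_pos h, h1]
      simp only [add_assoc]
    · simp only [Cmd.timeBound]; omega

/-- The invariant is indexed by the number of completed iterations, which must be exactly N. The N +
1 evaluations of the condition account for the factor X + 1 in the time bound. -/
theorem Wp.loop {e : Expr} {c : Cmd} (N : ℕ) (hN : N ≤ X)
    (I : ℕ → Store → List (Fin (2 ^ k)) → Prop) (h0 : I 0 s τ)
    (hstep : ∀ j < N, ∀ s τ, I j s τ → e.eval s ≠ 0 ∧ Wp k X c s τ (I (j + 1)))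
    (hend : ∀ s τ, I N s τ → e.eval s = 0 ∧ Q s τ) : Wp k X (.loop e c) s τ Q := by
  have key : ∀ d ≤ N, ∀ s τ, I (N - d) s τ → s.Bounded X → ∃ s' τ' δ n,
      (∀ K t m, tapeRun k (n + m) ⟨.loop e c :: K, s, t⟩ τ = tapeRun k m ⟨K, s', t + δ⟩ τ') ∧
      n ≤ δ ∧ δ ≤ (d + 1) * (1 + e.costWeight * (X + 1) + c.timeBound X) ∧ s'.Bounded X ∧
      Q s' τ' := by
    intro d
    induction d with
    | zero =>
      intro _ s τ hI hs
      obtain ⟨he, hQ⟩ := hend s τ hI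
      refine ⟨s, τ, 1 + e.cost s, 1, fun K t m => ?_, by omega, ?_, hs, hQ⟩
      · rw [Nat.add_comm 1 m, tapeRun, if_neg (not_not.2 he)]
      · have := e.cost_le hs
        omega
    | succ d ih =>
      intro hd s τ hI hs
      obtain ⟨he, hc⟩ := hstep (N - (d + 1)) (by omega) s τ hI
      obtain ⟨s₁, τ₁, δ₁, n₁, h1, h2, h3, h4, h5⟩ := hc hs
      rw [show N - (d + 1) + 1 = N - d by omega] at h5
      obtain ⟨s₂, τ₂, δ₂, n₂, h6, h7, h8, h9, h10⟩ := ih (by omega) s₁ τ₁ h5 h4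
      refine ⟨s₂, τ₂, 1 + e.cost s + δ₁ + δ₂, 1 + n₁ + n₂, fun K t m => ?_, by omega, ?_, h9, h10⟩
      · rw [show 1 + n₁ + n₂ + m = n₁ + (n₂ + m) + 1 by omega, tapeRun, if_pos he, h1, h6]
        simp only [add_assoc]
      · have := e.cost_le hs
        rw [add_mul (d + 1), one_mul]
        omega
  intro hs
  obtain ⟨s', τ', δ, n, h1, h2, h3, h4, h5⟩ := key N le_rfl s τ (by simpa using h0) hs
  exact ⟨s', τ', δ, n, h1, h2, h3.trans (Nat.mul_le_mul_right _ (by omega)), h4, h5⟩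

end Wp

/-- The loop in which the variable `x` runs through `0, 1, …, e - 1`. -/
def Cmd.forTo (x : ℕ) (e : Expr) (c : Cmd) : Cmd :=
  .seq (.assign x (.lit 0))
    (.loop (.bin .lt (.var x) e) (.seq c (.assign x (.bin .add (.var x) (.lit 1)))))

@[simp] theorem Store.setVar_var (s : Store) (x v y : ℕ) :
    (s.setVar x v).var y = if y = x then v else s.var y := by
  simp [Store.setVar, Function.update_apply]

@[simp] theorem Store.setVar_arr (s : Store) (x v : ℕ) : (s.setVar x v).arr = s.arr := rfl

@[simp] theorem Store.setArr_var (s : Store) (a j v : ℕ) : (s.setArr a j v).var = s.var := rfl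

@[simp] theorem Store.setArr_arr (s : Store) (a j v b : ℕ) :
    (s.setArr a j v).arr b = if b = a then Function.update (s.arr a) j v else s.arr b := by
  simp only [Store.setArr, Function.update_apply]

/-- The bound `e` is evaluated anew in each round, so the invariant must keep its value at N, and
the body must restore the counter. -/
theorem Wp.forTo {k X : ℕ} {s : Store} {τ : List (Fin (2 ^ k))}
    {Q : Store → List (Fin (2 ^ k)) → Prop} {x : ℕ} {e : Expr} {c : Cmd} (N : ℕ) (hN : N ≤ X)
    (I : ℕ → Store → List (Fin (2 ^ k)) → Prop)
    (hI : ∀ j s τ, I j s τ → s.var x = j ∧ e.eval s = N)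
    (h0 : I 0 (s.setVar x 0) τ)
    (hstep : ∀ j < N, ∀ s τ, I j s τ → Wp k X c s τ fun s' τ' =>
      s'.var x = j ∧ I (j + 1) (s'.setVar x (j + 1)) τ')
    (hend : ∀ s τ, I N s τ → Q s τ) : Wp k X (Cmd.forTo x e c) s τ Q := by
  refine Wp.seq (Wp.assign (by simp [Expr.eval]) (Wp.loop N hN I h0 (fun j hj s τ h => ?_)
    fun s τ h => ?_))
  · obtain ⟨h1, h2⟩ := hI j s τ h
    refine ⟨by simp [Expr.eval, BinOp.eval, h1, h2, hj], Wp.seq ((hstep j hj s τ h).mono ?_)⟩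
    rintro s' τ' ⟨h3, h4⟩
    have he : (Expr.bin .add (.var x) (.lit 1)).eval s' = j + 1 := by
      simp [Expr.eval, BinOp.eval, h3]
    refine Wp.assign ?_ ?_
    · rw [he]; exact (by omega : j + 1 ≤ X).trans_lt Nat.lt_two_pow_self
    · rwa [he]
  · obtain ⟨h1, h2⟩ := hI N s τ h
    exact ⟨by simp [Expr.eval, BinOp.eval, h1, h2], hend s τ h⟩

/-- A lower bound for the probability that a program succeeds, from a bound for the fraction of the
lists of random numbers with which it succeeds. -/
theorem ofReal_le_probHaltsWithin {k X N : ℕ} {P : Cmd} {s : Store} (hs : s.Bounded X)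
    {good : Store → Prop} {T : ℕ} (hT : P.timeBound X ≤ T) {F : List (Fin (2 ^ k)) → Prop}
    [DecidablePred F] (h : ∀ τ, τ.length = N → F τ → Wp k X P s τ fun s' _ => good s') {q : ℝ}
    (hq : q ≤ listAvg (Fin (2 ^ k)) N fun τ => if F τ then 1 else 0) :
    ENNReal.ofReal q ≤ probHaltsWithin P s T good := by
  refine le_trans (ENNReal.ofReal_le_ofReal (hq.trans (listAvg_mono fun τ hτ => ?_)))
    (listAvg_tapeRun_le k (fun C => C.todo = [] ∧ C.time ≤ T ∧ good C.store) T N ⟨[P], s, 0⟩)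
  by_cases hF : F τ
  · rw [if_pos hF, if_pos]
    obtain ⟨s', τ', δ, n, h1, h2, h3, -, h5⟩ := h τ hτ hF hs
    refine ⟨⟨[], s', δ⟩, ?_, rfl, h3.trans hT, h5⟩
    -- The machine may halt early and idles for the rest of the T steps.
    rw [← Nat.add_sub_cancel' (h2.trans (h3.trans hT)), h1, tapeRun_nil, Nat.zero_add]
  · rw [if_neg hF]
    split_ifs <;> norm_num

end RandRAM

/-! ### The subroutines and their specifications -/

namespace RandRAM

open Finset

/-- The word bound of the store is needed where a value is merely copied and has to fit. -/
theorem Wp.bounded {k X : ℕ} {c : Cmd} {s : Store} {τ : List (Fin (2 ^ k))}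
    {Q : Store → List (Fin (2 ^ k)) → Prop} (h : s.Bounded X → Wp k X c s τ Q) :
    Wp k X c s τ Q := fun hs => h hs hs

/-- The store `s'` agrees with `s` on the variables below `d` and on the arrays outside `as`. -/
def Store.Frame (d : ℕ) (as : List ℕ) (s s' : Store) : Prop :=
  (∀ x < d, s'.var x = s.var x) ∧ ∀ a ∉ as, s'.arr a = s.arr a

namespace Store.Frame

variable {d d' : ℕ} {as as' : List ℕ} {s s' s'' : Store}

theorem refl (d : ℕ) (as : List ℕ) (s : Store) : Frame d as s s := ⟨fun _ _ => rfl, fun _ _ => rfl⟩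

theorem setVar (h : Frame d as s s') {x : ℕ} (hx : d ≤ x) (v : ℕ) :
    Frame d as s (s'.setVar x v) :=
  ⟨fun y hy => by rw [setVar_var, if_neg (by omega), h.1 y hy], h.2⟩

theorem setArr (h : Frame d as s s') {a : ℕ} (ha : a ∈ as) (j v : ℕ) :
    Frame d as s (s'.setArr a j v) :=
  ⟨h.1, fun b hb => by rw [setArr_arr, if_neg (by rintro rfl; exact hb ha), h.2 b hb]⟩

theorem trans (h : Frame d as s s') (h' : Frame d' as' s' s'') (hd : d ≤ d') (ha : as' ⊆ as) :
    Frame d as s s'' :=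
  ⟨fun x hx => by rw [h'.1 x (by omega), h.1 x hx],
    fun a hn => by rw [h'.2 a (fun hm => hn (ha hm)), h.2 a hn]⟩

end Store.Frame

namespace Expr

/-- The sum of two expressions. -/
abbrev add : Expr → Expr → Expr := .bin .add

/-- The product of two expressions. -/
abbrev mul : Expr → Expr → Expr := .bin .mul

/-- The comparison of two expressions. -/
abbrev lt : Expr → Expr → Expr := .bin .lt

/-- The equality test for two expressions. -/
abbrev eq : Expr → Expr → Expr := .bin .eq

end Expr

namespace Cmd

open RandRAM.Expr

/-- Variable `2` becomes the product of the denominators. -/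
def denominators : Cmd :=
  .seq (.assign 2 (lit 1)) (forTo 20 (var 0) (.assign 2 (mul (var 2) (read 3 (var 20)))))

/-- Array `5` becomes the list of the weights, multiplied by their common denominator. -/
def weights : Cmd :=
  forTo 20 (var 0)
    (.write 5 (var 20) (mul (read 2 (var 20)) (bin .div (var 2) (read 3 (var 20)))))

/-- Array `7` becomes the list of the vertices, ordered in each block by their weights. -/
def table : Cmd :=
  forTo 20 (var 0) (.seq (.assign 21 (lit 0)) (.seq
    (forTo 22 (var 0) (.assign 21 (add (var 21)
      (mul (eq (read 1 (var 22)) (read 1 (var 20)))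
        (add (lt (read 5 (var 22)) (read 5 (var 20)))
          (mul (eq (read 5 (var 22)) (read 5 (var 20))) (lt (var 22) (var 20))))))))
    (.write 7 (add (mul (read 1 (var 20)) (var 0)) (var 21)) (var 20))))

/-- Variable `3` becomes the maximum degree. -/
def maxDegree : Cmd :=
  .seq (.assign 3 (lit 0)) (forTo 20 (var 0) (.seq (.assign 21 (lit 0)) (.seq
    (forTo 22 (var 0)
      (.assign 21 (add (var 21) (read 0 (add (mul (var 20) (var 0)) (var 22))))))
    (.cond (lt (var 3) (var 21)) (.assign 3 (var 21)) .skip))))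

/-- The last value of variable `20` for which `e` is true is stored in `x`. -/
def scan (x : ℕ) (e : Expr) : Cmd :=
  .seq (.assign x (var 1)) (forTo 20 (var 1) (.cond e (.assign x (var 20)) .skip))

/-- One step of the resampling algorithm. -/
def resample : Cmd :=
  .seq (.flip 12 (var 7)) (.seq (scan 13 (eq (read 8 (var 20)) (lit 0)))
    (.cond (lt (var 13) (var 1))
      (.seq (.assign 14 (read 7 (add (mul (var 13) (var 0)) (bin .mod (var 12) (var 4)))))
        (.seq (scan 15 (mul (read 8 (var 20))
          (read 0 (add (mul (var 14) (var 0)) (bin .sub (read 8 (var 20)) (lit 1))))))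
          (.cond (lt (var 15) (var 1)) (.write 8 (var 15) (lit 0))
            (.write 8 (var 13) (add (var 14) (lit 1))))))
      .skip))

/-- One run of the resampling algorithm. -/
def trial : Cmd :=
  .seq (forTo 20 (var 1) (.write 8 (var 20) (lit 0))) (forTo 11 (var 5) resample)

/-- The best result found so far is updated. -/
def update : Cmd :=
  .seq (.assign 16 (lit 1)) (.seq (.assign 17 (lit 0)) (.seq
    (forTo 20 (var 1) (.seq
      (.assign 17 (add (var 17) (read 5 (bin .sub (read 8 (var 20)) (lit 1)))))
      (.cond (read 8 (var 20)) .skip (.assign 16 (lit 0)))))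
    (.cond (mul (var 16) (add (eq (var 9) (lit 0)) (lt (var 17) (var 10))))
      (.seq (.assign 9 (lit 1)) (.seq (.assign 10 (var 17))
        (forTo 20 (var 1) (.write 9 (var 20) (read 8 (var 20))))))
      .skip)))

/-- The best result is written into the output array. -/
def output : Cmd :=
  forTo 20 (var 1) (.write 4 (bin .sub (read 9 (var 20)) (lit 1)) (lit 1))

end Cmd

section Specs

variable {k X : ℕ} {s : Store} {τ : List (Fin (2 ^ k))} {Q : Store → List (Fin (2 ^ k)) → Prop}

theorem lt_two_pow_of_le {a X : ℕ} (h : a ≤ X) : a < 2 ^ X := h.trans_lt Nat.lt_two_pow_self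

theorem wp_denominators {n : ℕ} (hX : 0 < X) (hn : s.var 0 = n) (hnX : n ≤ X)
    (hb : ∀ j ≤ n, ∏ i ∈ range j, s.arr 3 i < 2 ^ X)
    (hQ : ∀ s', s.Frame 2 [] s' → s'.var 2 = ∏ i ∈ range n, s.arr 3 i → Q s' τ) :
    Wp k X Cmd.denominators s τ Q := by
  refine Wp.seq (Wp.assign (by simpa [Expr.eval] using hX.ne') (Wp.forTo n hnX
    (fun j s' τ' => τ' = τ ∧ s.Frame 2 [] s' ∧ s'.var 20 = j ∧
      s'.var 2 = ∏ i ∈ range j, s.arr 3 i) ?_ ?_ ?_ ?_))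
  · rintro j s' τ' ⟨-, hf, h1, -⟩
    exact ⟨h1, by simp [Expr.eval, hf.1, hn]⟩
  · exact ⟨rfl, ((Store.Frame.refl ..).setVar le_rfl _).setVar (by norm_num) _,
      by simp [Expr.eval], by simp [Expr.eval]⟩
  · rintro j hj s' τ' ⟨rfl, hf, h1, h2⟩
    have he : (Expr.mul (.var 2) (.read 3 (.var 20))).eval s' = ∏ i ∈ range (j + 1), s.arr 3 i := by
      simp [Expr.eval, BinOp.eval, h1, h2, hf.2, prod_range_succ]
    refine Wp.assign (he ▸ hb _ hj) ⟨by simp [h1], rfl,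
      (hf.setVar le_rfl _).setVar (by norm_num) _, by simp, ?_⟩
    rw [he]; simp
  · rintro s' τ' ⟨rfl, hf, -, h2⟩
    exact hQ s' hf h2

theorem wp_weights {n : ℕ} (hn : s.var 0 = n) (hnX : n ≤ X)
    (hb : ∀ j < n, s.arr 2 j * (s.var 2 / s.arr 3 j) < 2 ^ X)
    (hQ : ∀ s', s.Frame 3 [5] s' → (∀ j < n, s'.arr 5 j = s.arr 2 j * (s.var 2 / s.arr 3 j)) →
      (∀ j, n ≤ j → s'.arr 5 j = s.arr 5 j) → Q s' τ) :
    Wp k X Cmd.weights s τ Q := by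
  refine Wp.forTo n hnX (fun j s' τ' => τ' = τ ∧ s.Frame 3 [5] s' ∧ s'.var 20 = j ∧
      (∀ i < j, s'.arr 5 i = s.arr 2 i * (s.var 2 / s.arr 3 i)) ∧
      ∀ i, j ≤ i → s'.arr 5 i = s.arr 5 i) ?_ ?_ ?_ ?_
  · rintro j s' τ' ⟨-, hf, h1, -⟩
    exact ⟨h1, by simp [Expr.eval, hf.1, hn]⟩
  · exact ⟨rfl, (Store.Frame.refl ..).setVar (by norm_num) _, by simp, by simp, by simp⟩
  · rintro j hj s' τ' ⟨rfl, hf, h1, h2, h3⟩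
    have he : (Expr.mul (.read 2 (.var 20)) (.bin .div (.var 2) (.read 3 (.var 20)))).eval s' =
        s.arr 2 j * (s.var 2 / s.arr 3 j) := by
      simp [Expr.eval, BinOp.eval, h1, hf.1, hf.2]
    refine Wp.write (he ▸ hb _ hj) ⟨by simp [h1], rfl,
      (hf.setArr (by simp) _ _).setVar (by norm_num) _, by simp, fun i hi => ?_, fun i hi => ?_⟩
    · rw [he]
      by_cases hij : i = j
      · simp [Expr.eval, h1, hij]
      · simp [Expr.eval, h1, hij, Function.update_of_ne, h2 i (by omega)]
    · have hij : i ≠ j := by omega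
      simp [Expr.eval, h1, hij, h3 i (by omega)]
  · rintro s' τ' ⟨rfl, hf, -, h2, h3⟩
    exact hQ s' hf h2 h3

/-- The number of vertices of the block of `v` that come before `v` in the order by weights. -/
def rank (n : ℕ) (B W : ℕ → ℕ) (v : ℕ) : ℕ :=
  ∑ u ∈ range n, if B u = B v ∧ (W u < W v ∨ W u = W v ∧ u < v) then 1 else 0

/-- Distinct vertices have distinct positions, so no entry is overwritten later. Positions that
belong to no vertex keep their old value. -/
theorem wp_table {n : ℕ} (hn : s.var 0 = n) (hnX : n ≤ X)
    (hinj : ∀ u < n, ∀ v < n, s.arr 1 u * n + rank n (s.arr 1) (s.arr 5) u =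
      s.arr 1 v * n + rank n (s.arr 1) (s.arr 5) v → u = v)
    (hQ : ∀ s', s.Frame 3 [7] s' →
      (∀ v < n, s'.arr 7 (s.arr 1 v * n + rank n (s.arr 1) (s.arr 5) v) = v) →
      (∀ q, (∀ v < n, s.arr 1 v * n + rank n (s.arr 1) (s.arr 5) v ≠ q) →
        s'.arr 7 q = s.arr 7 q) → Q s' τ) :
    Wp k X Cmd.table s τ Q := by
  refine Wp.forTo n hnX (fun j s' τ' => τ' = τ ∧ s.Frame 3 [7] s' ∧ s'.var 20 = j ∧
      (∀ v < j, s'.arr 7 (s.arr 1 v * n + rank n (s.arr 1) (s.arr 5) v) = v) ∧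
      ∀ q, (∀ v < j, s.arr 1 v * n + rank n (s.arr 1) (s.arr 5) v ≠ q) →
        s'.arr 7 q = s.arr 7 q) ?_ ?_ ?_ ?_
  · rintro j s' τ' ⟨-, hf, h1, -⟩
    exact ⟨h1, by simp [Expr.eval, hf.1, hn]⟩
  · exact ⟨rfl, (Store.Frame.refl ..).setVar (by norm_num) _, by simp, by simp, by simp⟩
  · rintro j hj s' τ' ⟨rfl, hf, h1, h2, h3⟩
    refine Wp.seq (Wp.assign (by simp [Expr.eval]) (Wp.seq (Wp.forTo n hnX
      (fun i s'' τ'' => τ'' = τ' ∧ s'.Frame 21 [] s'' ∧ s''.var 22 = i ∧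
        s''.var 21 = ∑ u ∈ range i, if s.arr 1 u = s.arr 1 j ∧
          (s.arr 5 u < s.arr 5 j ∨ s.arr 5 u = s.arr 5 j ∧ u < j) then 1 else 0) ?_ ?_ ?_ ?_)))
    · rintro i s'' τ'' ⟨-, hf', h4, -⟩
      exact ⟨h4, by simp [Expr.eval, hf'.1, hf.1, hn]⟩
    · exact ⟨rfl, ((Store.Frame.refl ..).setVar le_rfl _).setVar (by norm_num) _, by simp,
        by simp [Expr.eval]⟩
    · rintro i hi s'' τ'' ⟨rfl, hf', h4, h5⟩
      have he : (Expr.add (.var 21) (.mul (.eq (.read 1 (.var 22)) (.read 1 (.var 20)))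
          (.add (.lt (.read 5 (.var 22)) (.read 5 (.var 20)))
            (.mul (.eq (.read 5 (.var 22)) (.read 5 (.var 20)))
              (.lt (.var 22) (.var 20)))))).eval s'' =
          ∑ u ∈ range (i + 1), if s.arr 1 u = s.arr 1 j ∧
          (s.arr 5 u < s.arr 5 j ∨ s.arr 5 u = s.arr 5 j ∧ u < j) then 1 else 0 := by
        rw [sum_range_succ, ← h5]
        simp only [Expr.eval, BinOp.eval, h4, hf'.1 20 (by norm_num), h1,
          hf'.2 _ List.not_mem_nil, hf.2 1 (by simp), hf.2 5 (by simp)]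
        congr 1
        -- The two alternatives in the lexicographic comparison exclude each other, so their sum is
        -- again 0 or 1.
        by_cases c1 : s.arr 1 i = s.arr 1 j <;> by_cases c2 : s.arr 5 i = s.arr 5 j <;>
          by_cases c3 : s.arr 5 i < s.arr 5 j <;> by_cases c4 : i < j <;> simp [c1, c2, c3, c4]
      refine Wp.assign ?_ ⟨by simp [h4], rfl, (hf'.setVar le_rfl _).setVar (by norm_num) _, by simp, ?_⟩
      · rw [he]
        refine lt_two_pow_of_le (le_trans ?_ hnX)
        refine (sum_le_sum (g := fun _ => 1) fun u _ => ?_).trans (by simpa using hi)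
        split_ifs <;> simp
      · rw [he]; simp
    · rintro s'' τ'' ⟨rfl, hf', h4, h5⟩
      have h20 : s''.var 20 = j := by rw [hf'.1 20 (by norm_num), h1]
      have hidx : (Expr.add (.mul (.read 1 (.var 20)) (.var 0)) (.var 21)).eval s'' =
          s.arr 1 j * n + rank n (s.arr 1) (s.arr 5) j := by
        simp only [Expr.eval, BinOp.eval, h20, h5, rank, hf'.1 0 (by norm_num),
          hf.1 0 (by norm_num), hn, hf'.2 _ List.not_mem_nil, hf.2 1 (by simp)]
      have hval : (Expr.var 20).eval s'' = j := h20
      have hf'' : s.Frame 3 [7] s'' := hf.trans hf' (by norm_num) (by simp)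
      have h7 : s''.arr 7 = s'.arr 7 := hf'.2 _ List.not_mem_nil
      refine Wp.write (by rw [hval]; exact lt_two_pow_of_le (by omega)) ⟨by simpa using h20, rfl,
        (hf''.setArr (by simp) _ _).setVar (by norm_num) _, by simp, fun v hv => ?_, fun q hq => ?_⟩
      · rw [hidx, hval]
        by_cases hvj : v = j
        · subst hvj; simp
        · have : s.arr 1 v * n + rank n (s.arr 1) (s.arr 5) v ≠
              s.arr 1 j * n + rank n (s.arr 1) (s.arr 5) j :=
            fun h => hvj (hinj v (by omega) j hj h)
          simp [Function.update_of_ne this, h7, h2 v (by omega)]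
      · rw [hidx, hval]
        simpa [Function.update_of_ne (hq j (by omega)).symm, h7] using
          h3 q fun v hv => hq v (by omega)
  · rintro s' τ' ⟨rfl, hf, -, h2, h3⟩
    exact hQ s' hf h2 h3

theorem wp_maxDegree {n : ℕ} (hn : s.var 0 = n) (hnX : n ≤ X) (hadj : ∀ q, s.arr 0 q ≤ 1)
    (hQ : ∀ s', s.Frame 3 [] s' →
      s'.var 3 = (range n).sup (fun v => ∑ u ∈ range n, s.arr 0 (v * n + u)) → Q s' τ) :
    Wp k X Cmd.maxDegree s τ Q := by
  refine Wp.seq (Wp.assign (by simp [Expr.eval]) (Wp.forTo n hnX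
    (fun j s' τ' => τ' = τ ∧ s.Frame 3 [] s' ∧ s'.var 20 = j ∧
      s'.var 3 = (range j).sup (fun v => ∑ u ∈ range n, s.arr 0 (v * n + u))) ?_ ?_ ?_ ?_))
  · rintro j s' τ' ⟨-, hf, h1, -⟩
    exact ⟨h1, by simp [Expr.eval, hf.1, hn]⟩
  · exact ⟨rfl, ((Store.Frame.refl ..).setVar le_rfl _).setVar (by norm_num) _, by simp,
      by simp [Expr.eval]⟩
  · rintro j hj s' τ' ⟨rfl, hf, h1, h2⟩
    refine Wp.seq (Wp.assign (by simp [Expr.eval]) (Wp.seq (Wp.forTo n hnX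
      (fun i s'' τ'' => τ'' = τ' ∧ s'.Frame 21 [] s'' ∧ s''.var 22 = i ∧
        s''.var 21 = ∑ u ∈ range i, s.arr 0 (j * n + u)) ?_ ?_ ?_ ?_)))
    · rintro i s'' τ'' ⟨-, hf', h4, -⟩
      exact ⟨h4, by simp [Expr.eval, hf'.1, hf.1, hn]⟩
    · exact ⟨rfl, ((Store.Frame.refl ..).setVar le_rfl _).setVar (by norm_num) _, by simp,
        by simp [Expr.eval]⟩
    · rintro i hi s'' τ'' ⟨rfl, hf', h4, h5⟩
      have he : (Expr.add (.var 21) (.read 0 (.add (.mul (.var 20) (.var 0)) (.var 22)))).eval s'' =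
          ∑ u ∈ range (i + 1), s.arr 0 (j * n + u) := by
        rw [sum_range_succ, ← h5]
        simp only [Expr.eval, BinOp.eval, h4, hf'.1 20 (by norm_num), h1, hf'.1 0 (by norm_num),
          hf.1 0 (by norm_num), hn, hf'.2 _ List.not_mem_nil, hf.2 _ List.not_mem_nil]
      refine Wp.assign ?_ ⟨by simp [h4], rfl, (hf'.setVar le_rfl _).setVar (by norm_num) _, by simp, ?_⟩
      · rw [he]
        refine lt_two_pow_of_le (le_trans ?_ hnX)
        exact (sum_le_sum (g := fun _ => 1) fun u _ => hadj _).trans (by simpa using hi)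
      · rw [he]; simp
    · rintro s'' τ'' ⟨rfl, hf', h4, h5⟩
      have h20 : s''.var 20 = j := by rw [hf'.1 20 (by norm_num), h1]
      have h3 : s''.var 3 = (range j).sup (fun v => ∑ u ∈ range n, s.arr 0 (v * n + u)) := by
        rw [hf'.1 3 (by norm_num), h2]
      have hf'' : s.Frame 3 [] s'' := hf.trans hf' (by norm_num) (by simp)
      have hmax : (range (j + 1)).sup (fun v => ∑ u ∈ range n, s.arr 0 (v * n + u)) =
          max (s''.var 21) (s''.var 3) := by
        rw [range_add_one, sup_insert, ← h3, ← h5]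
      refine Wp.bounded fun hs'' => Wp.cond (fun hc => Wp.assign (hs''.1 21) ?_)
        (fun hc => Wp.skip ?_)
      · have : s''.var 3 < s''.var 21 := by
          by_contra h; simp [Expr.eval, BinOp.eval, h] at hc
        refine ⟨by simpa using h20, rfl, (hf''.setVar le_rfl _).setVar (by norm_num) _, by simp, ?_⟩
        rw [hmax, max_eq_left this.le]; simp [Expr.eval]
      · have : ¬ s''.var 3 < s''.var 21 := by
          intro h; simp [Expr.eval, BinOp.eval, h] at hc
        refine ⟨h20, rfl, hf''.setVar (by norm_num) _, by simp, ?_⟩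
        rw [hmax, max_eq_right (not_lt.1 this)]; simp
  · rintro s' τ' ⟨rfl, hf, -, h2⟩
    exact hQ s' hf h2

/-- The last index below `j` that satisfies `P`, or `d` if there is none. -/
def lastIdx (P : ℕ → Prop) [DecidablePred P] (d : ℕ) : ℕ → ℕ
  | 0 => d
  | j + 1 => if P j then j else lastIdx P d j

theorem lastIdx_spec (P : ℕ → Prop) [DecidablePred P] (d j : ℕ) :
    (lastIdx P d j = d ∧ ∀ i < j, ¬ P i) ∨ (lastIdx P d j < j ∧ P (lastIdx P d j)) := by
  induction j with
  | zero => exact Or.inl ⟨rfl, by simp⟩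
  | succ j ih =>
    unfold lastIdx
    split_ifs with h
    · exact Or.inr ⟨by omega, h⟩
    · rcases ih with ⟨h1, h2⟩ | ⟨h1, h2⟩
      · refine Or.inl ⟨h1, fun i hi => ?_⟩
        rcases (Nat.lt_succ_iff_lt_or_eq.1 hi) with hi | rfl
        exacts [h2 i hi, h]
      · exact Or.inr ⟨by omega, h2⟩

/-- The value l in `x` signals that no index satisfies P. The condition `e` must decide P on every
store that differs from `s` only in `x` and the counter. -/
theorem wp_scan {l x : ℕ} {e : Expr} (hl : s.var 1 = l) (hlX : l ≤ X) (hx1 : x ≠ 1)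
    (hx20 : x ≠ 20) (P : ℕ → Prop) [DecidablePred P]
    (hP : ∀ i < l, ∀ s' : Store, (∀ y, y ≠ x → y ≠ 20 → s'.var y = s.var y) → s'.arr = s.arr →
      s'.var 20 = i → (e.eval s' ≠ 0 ↔ P i))
    (hQ : ∀ s' : Store, (∀ y, y ≠ x → y ≠ 20 → s'.var y = s.var y) → s'.arr = s.arr →
      s'.var x = lastIdx P l l → Q s' τ) :
    Wp k X (Cmd.scan x e) s τ Q := by
  refine Wp.seq (Wp.assign (by simp [Expr.eval, hl, lt_two_pow_of_le hlX]) (Wp.forTo l hlX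
    (fun j s' τ' => τ' = τ ∧ (∀ y, y ≠ x → y ≠ 20 → s'.var y = s.var y) ∧ s'.arr = s.arr ∧
      s'.var 20 = j ∧ s'.var x = lastIdx P l j) ?_ ?_ ?_ ?_))
  · rintro j s' τ' ⟨-, h1, -, h2, -⟩
    exact ⟨h2, by simp [Expr.eval, h1 1 hx1.symm (by norm_num), hl]⟩
  · refine ⟨rfl, fun y h1 h2 => by simp [h1, h2], rfl, by simp, ?_⟩
    simp [hx20, Expr.eval, hl, lastIdx]
  · rintro j hj s' τ' ⟨rfl, h1, h2, h3, h4⟩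
    have hj' := hP j hj s' h1 h2 h3
    refine Wp.cond (fun hc => Wp.assign ?_ ?_) (fun hc => Wp.skip ?_)
    · simp only [Expr.eval, h3]; exact lt_two_pow_of_le (by omega)
    · refine ⟨by simp [h3, hx20.symm], rfl, fun y hy hy' => by simp [hy, hy', h1], h2, by simp, ?_⟩
      simp [hx20, Expr.eval, h3, lastIdx, hj'.1 hc]
    · refine ⟨h3, rfl, fun y hy hy' => by simp [hy', h1 y hy hy'], h2, by simp, ?_⟩
      have : ¬ P j := fun h => hj'.2 h hc
      simp [hx20, lastIdx, this, h4]
  · rintro s' τ' ⟨rfl, h1, h2, -, h4⟩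
    exact hQ s' h1 h2 h4

/-- One step of the resampling algorithm: `cur i` is `0` if block `i` has no vertex, and `v + 1` if
it has the vertex `v`. -/
def resample (n l m : ℕ) (adj tab cur : ℕ → ℕ) (r : ℕ) : ℕ → ℕ :=
  if lastIdx (fun q => cur q = 0) l l < l then
    if lastIdx (fun q => cur q * adj (tab (lastIdx (fun q => cur q = 0) l l * n + r % m) * n +
        (cur q - 1)) ≠ 0) l l < l then
      Function.update cur (lastIdx (fun q => cur q * adj
        (tab (lastIdx (fun q => cur q = 0) l l * n + r % m) * n + (cur q - 1)) ≠ 0) l l) 0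
    else
      Function.update cur (lastIdx (fun q => cur q = 0) l l)
        (tab (lastIdx (fun q => cur q = 0) l l * n + r % m) + 1)
  else cur

theorem resample_of_le {n l m : ℕ} {adj tab cur : ℕ → ℕ} {r q : ℕ} (hq : l ≤ q) :
    resample n l m adj tab cur r q = cur q := by
  unfold resample
  split_ifs with h1 h2
  · exact Function.update_of_ne (by omega) _ _
  · exact Function.update_of_ne (by omega) _ _
  · rfl

theorem wp_resample {n l m : ℕ} (hn : s.var 0 = n) (hl : s.var 1 = l) (hm : s.var 4 = m)
    (hk : s.var 7 = k) (hnX : n ≤ X) (hlX : l ≤ X) (hkX : k ≤ X) (htab : ∀ q, s.arr 7 q < n)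
    {r : Fin (2 ^ k)}
    (hQ : ∀ s', s.Frame 12 [8] s' →
      s'.arr 8 = resample n l m (s.arr 0) (s.arr 7) (s.arr 8) r → Q s' τ) :
    Wp k X Cmd.resample s (r :: τ) Q := by
  refine Wp.seq (Wp.flip hkX (by simp [Expr.eval, hk]) (Wp.seq ?_))
  refine wp_scan (l := l) (by simp [hl]) hlX (by norm_num) (by norm_num)
    (fun q => s.arr 8 q = 0) ?_ fun s₁ h1 h2 h3 => ?_
  · intro i _ s' _ h h20
    simp only [Store.setVar_arr] at h
    simp [Expr.eval, BinOp.eval, h, h20]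
  simp only [Store.setVar_arr] at h2
  have hv : ∀ y, y ≠ 12 → y ≠ 13 → y ≠ 20 → s₁.var y = s.var y := fun y a b c => by
    rw [h1 y b c]; simp [a]
  have hf₁ : s.Frame 12 [8] s₁ :=
    ⟨fun x hx => hv x (by omega) (by omega) (by omega), fun a _ => by rw [h2]⟩
  set i := lastIdx (fun q => s.arr 8 q = 0) l l with hi
  have h12 : s₁.var 12 = r.val := by rw [h1 12 (by norm_num) (by norm_num)]; simp
  have hlt : (Expr.lt (.var 13) (.var 1)).eval s₁ ≠ 0 ↔ i < l := by
    simp [Expr.eval, BinOp.eval, h3, hv, hl]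
  refine Wp.cond (fun hc => ?_) (fun hc => Wp.skip (hQ _ hf₁ ?_))
  swap
  · rw [h2, resample, if_neg (fun h => hlt.2 h hc)]
  have hil := hlt.1 hc
  set v := s.arr 7 (i * n + r % m) with hvdef
  have he : (Expr.read 7 (.add (.mul (.var 13) (.var 0)) (.bin .mod (.var 12) (.var 4)))).eval s₁ =
      v := by
    simp [Expr.eval, BinOp.eval, h3, h12, h2, hv, hn, hm, hvdef]
  have hvn : v < n := htab _
  refine Wp.seq (Wp.assign (by rw [he]; exact lt_two_pow_of_le (by omega)) (Wp.seq ?_))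
  -- The factor `s.arr 8 q` masks the empty blocks, for which the truncated subtraction would point
  -- to vertex 0.
  refine wp_scan (l := l) (by simp [hv, hl]) hlX (by norm_num) (by norm_num)
    (fun q => s.arr 8 q * s.arr 0 (v * n + (s.arr 8 q - 1)) ≠ 0) ?_ fun s₂ h4 h5 h6 => ?_
  · intro q _ s' h hs' h20
    have h14 : s'.var 14 = v := by rw [h 14 (by norm_num) (by norm_num)]; simp [he]
    have h0 : s'.var 0 = n := by rw [h 0 (by norm_num) (by norm_num)]; simp [hv, hn]
    simp only [Store.setVar_arr, h2] at hs'
    simp [Expr.eval, BinOp.eval, hs', h20, h14, h0]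
  simp only [Store.setVar_arr, h2] at h5
  have hv' : ∀ y, y ≠ 12 → y ≠ 13 → y ≠ 14 → y ≠ 15 → y ≠ 20 → s₂.var y = s.var y :=
    fun y a b c d e => by rw [h4 y d e, Store.setVar_var, if_neg c, hv y a b e]
  have hf₂ : s.Frame 12 [8] s₂ :=
    ⟨fun x hx => hv' x (by omega) (by omega) (by omega) (by omega) (by omega),
      fun a _ => by rw [h5]⟩
  have h14 : s₂.var 14 = v := by rw [h4 14 (by norm_num) (by norm_num)]; simp [he]
  have h13 : s₂.var 13 = i := by rw [h4 13 (by norm_num) (by norm_num)]; simp [h3]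
  set j := lastIdx (fun q => s.arr 8 q * s.arr 0 (v * n + (s.arr 8 q - 1)) ≠ 0) l l with hj
  have hlt' : (Expr.lt (.var 15) (.var 1)).eval s₂ ≠ 0 ↔ j < l := by
    simp [Expr.eval, BinOp.eval, h6, hv', hl]
  refine Wp.cond (fun hc' => Wp.write (by simp [Expr.eval]) (hQ _ (hf₂.setArr (by simp) _ _) ?_))
    (fun hc' => Wp.write ?_ (hQ _ (hf₂.setArr (by simp) _ _) ?_))
  · rw [resample, if_pos hil, if_pos (hlt'.1 hc')]
    rw [Store.setArr_arr, if_pos rfl, h5]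
    simp only [Expr.eval, h6]
    rfl
  · simp only [Expr.eval, BinOp.eval, h14]; exact lt_two_pow_of_le (by omega)
  · rw [resample, if_pos hil, if_neg (fun h => hlt'.2 h hc')]
    rw [Store.setArr_arr, if_pos rfl, h5]
    simp only [Expr.eval, BinOp.eval, h13, h14]
    rfl

/-- The result of a run of the resampling algorithm. -/
def trial (n l m : ℕ) (adj tab : ℕ → ℕ) (ω : List (Fin (2 ^ k))) : ℕ → ℕ :=
  ω.foldl (fun cur (r : Fin (2 ^ k)) => resample n l m adj tab cur r.val) fun _ => 0

theorem trial_of_le {n l m : ℕ} {adj tab : ℕ → ℕ} {q : ℕ} (hq : l ≤ q) (ω : List (Fin (2 ^ k))) :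
    trial n l m adj tab ω q = 0 := by
  induction ω using List.reverseRecOn with
  | nil => rfl
  | append_singleton ω r ih =>
    rw [trial, List.foldl_append, List.foldl_cons, List.foldl_nil, resample_of_le hq]
    exact ih

theorem wp_trial {n l m T : ℕ} (hn : s.var 0 = n) (hl : s.var 1 = l) (hm : s.var 4 = m)
    (hT : s.var 5 = T) (hk : s.var 7 = k) (hnX : n ≤ X) (hlX : l ≤ X) (hkX : k ≤ X) (hTX : T ≤ X)
    (htab : ∀ q, s.arr 7 q < n) (hcur : ∀ q, l ≤ q → s.arr 8 q = 0) (hτ : T ≤ τ.length)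
    (hQ : ∀ s', s.Frame 11 [8] s' →
      s'.arr 8 = trial n l m (s.arr 0) (s.arr 7) (τ.take T) → Q s' (τ.drop T)) :
    Wp k X Cmd.trial s τ Q := by
  refine Wp.seq (Wp.forTo l hlX (fun j s' τ' => τ' = τ ∧ s.Frame 11 [8] s' ∧ s'.var 20 = j ∧
    (∀ q < j, s'.arr 8 q = 0) ∧ ∀ q, l ≤ q → s'.arr 8 q = 0) ?_ ?_ ?_ ?_)
  · rintro j s' τ' ⟨-, hf, h1, -⟩
    exact ⟨h1, by simp [Expr.eval, hf.1, hl]⟩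
  · exact ⟨rfl, (Store.Frame.refl ..).setVar (by norm_num) _, by simp, by simp, hcur⟩
  · rintro j hj s' τ' ⟨rfl, hf, h1, h2, h3⟩
    refine Wp.write (by simp [Expr.eval]) ⟨by simp [h1], rfl,
      (hf.setArr (by simp) _ _).setVar (by norm_num) _, by simp, fun q hq => ?_, fun q hq => ?_⟩
    · by_cases hqj : q = j
      · simp [Expr.eval, h1, hqj]
      · simp [Expr.eval, h1, hqj, h2 q (by omega)]
    · simp [Expr.eval, h1, Function.update_of_ne (by omega : q ≠ j), h3 q hq]
  · rintro s₁ τ₁ ⟨rfl, hf₁, -, h2, h3⟩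
    -- The array has to vanish beyond l as well, since the contents are compared as functions on all
    -- of ℕ.
    have h0 : s₁.arr 8 = fun _ => 0 := funext fun q => by
      rcases lt_or_ge q l with h | h
      exacts [h2 q h, h3 q h]
    refine Wp.forTo T hTX (fun j s' τ' => τ' = τ₁.drop j ∧ s.Frame 11 [8] s' ∧ s'.var 11 = j ∧
      s'.arr 8 = trial n l m (s.arr 0) (s.arr 7) (τ₁.take j)) ?_ ?_ ?_ ?_
    · rintro j s' τ' ⟨-, hf, h1, -⟩
      exact ⟨h1, by simp [Expr.eval, hf.1, hT]⟩
    · exact ⟨rfl, hf₁.setVar le_rfl _, by simp, by simpa [trial] using h0⟩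
    · rintro j hj s' τ' ⟨rfl, hf, h1, h2⟩
      have hjτ : j < τ₁.length := by omega
      rw [List.drop_eq_getElem_cons hjτ]
      refine wp_resample (n := n) (l := l) (m := m) (by simp [hf.1, hn]) (by simp [hf.1, hl]) (by simp [hf.1, hm])
        (by simp [hf.1, hk]) hnX hlX hkX (by simpa [hf.2] using htab) fun s'' hf' h8 => ?_
      refine ⟨by rw [hf'.1 11 (by norm_num), h1], rfl,
        (hf.trans hf' (by norm_num) (by simp)).setVar le_rfl _, by simp, ?_⟩
      rw [Store.setVar_arr, h8, h2, hf.2 0 (by simp), hf.2 7 (by simp), List.take_add_one,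
        List.getElem?_eq_getElem hjτ, trial, trial, List.foldl_append]
      rfl
    · rintro s' τ' ⟨rfl, hf, -, h2⟩
      exact hQ s' hf h2

/-- For an empty block the program reads the weight of vertex 0, because 0 - 1 = 0. This spoils the
sum but does no harm: variable 16 is then 0 and the result is rejected. -/
theorem wp_update {l Y : ℕ} (hX0 : 0 < X) (hl : s.var 1 = l) (hlX : l ≤ X) (hY : ∀ q, s.arr 5 q ≤ Y)
    (hYX : l * Y < 2 ^ X)
    (hQ : ∀ s', s.Frame 9 [9] s' →
      (((∀ q < l, s.arr 8 q ≠ 0) ∧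
          (s.var 9 = 0 ∨ ∑ q ∈ range l, s.arr 5 (s.arr 8 q - 1) < s.var 10) ∧ s'.var 9 = 1 ∧
          s'.var 10 = ∑ q ∈ range l, s.arr 5 (s.arr 8 q - 1) ∧ ∀ q < l, s'.arr 9 q = s.arr 8 q) ∨
        (¬ ((∀ q < l, s.arr 8 q ≠ 0) ∧
          (s.var 9 = 0 ∨ ∑ q ∈ range l, s.arr 5 (s.arr 8 q - 1) < s.var 10)) ∧
          s'.var 9 = s.var 9 ∧ s'.var 10 = s.var 10 ∧ s'.arr 9 = s.arr 9)) → Q s' τ) :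
    Wp k X Cmd.update s τ Q := by
  have hX : 1 < 2 ^ X := Nat.one_lt_two_pow hX0.ne'
  refine Wp.seq (Wp.assign (by simpa [Expr.eval] using hX) (Wp.seq (Wp.assign (by simp [Expr.eval])
    (Wp.seq (Wp.forTo l hlX (fun j s' τ' => τ' = τ ∧ s.Frame 11 [] s' ∧ s'.var 20 = j ∧
      s'.var 17 = ∑ q ∈ range j, s.arr 5 (s.arr 8 q - 1) ∧
      ((s'.var 16 = 1 ∧ ∀ q < j, s.arr 8 q ≠ 0) ∨ (s'.var 16 = 0 ∧ ¬ ∀ q < j, s.arr 8 q ≠ 0)))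
      ?_ ?_ ?_ ?_)))))
  · rintro j s' τ' ⟨-, hf, h1, -⟩
    exact ⟨h1, by simp [Expr.eval, hf.1, hl]⟩
  · exact ⟨rfl, (((Store.Frame.refl ..).setVar (by norm_num) _).setVar (by norm_num) _).setVar
      (by norm_num) _, by simp, by simp [Expr.eval], by simp [Expr.eval]⟩
  · rintro j hj s' τ' ⟨rfl, hf, h1, h2, h3⟩
    have he : (Expr.add (.var 17) (.read 5 (.bin .sub (.read 8 (.var 20)) (.lit 1)))).eval s' =
        ∑ q ∈ range (j + 1), s.arr 5 (s.arr 8 q - 1) := by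
      simp [Expr.eval, BinOp.eval, h1, h2, hf.2, sum_range_succ]
    refine Wp.seq (Wp.assign ?_ (Wp.cond (fun hc => Wp.skip ?_) (fun hc => Wp.assign
      (by simp [Expr.eval]) ?_)))
    · rw [he]
      refine lt_of_le_of_lt ((sum_le_sum fun q _ => hY _).trans ?_) hYX
      rw [sum_const, card_range, smul_eq_mul]
      exact Nat.mul_le_mul_right _ hj
    · have hcj : s.arr 8 j ≠ 0 := by simpa [Expr.eval, h1, hf.2] using hc
      refine ⟨by simp [h1], rfl, (hf.setVar (by norm_num) _).setVar (by norm_num) _, by simp,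
        by rw [he]; simp, ?_⟩
      simp only [Nat.forall_lt_succ_right (n := j)]
      simpa [hcj] using h3
    · have hcj : s.arr 8 j = 0 := by simpa [Expr.eval, h1, hf.2] using hc
      refine ⟨by simp [h1], rfl, ((hf.setVar (by norm_num) _).setVar (by norm_num) _).setVar
        (by norm_num) _, by simp, by rw [he]; simp, ?_⟩
      simp only [Nat.forall_lt_succ_right (n := j)]
      simp [hcj, Expr.eval]
  · rintro s₁ τ₁ ⟨rfl, hf, -, h2, h3⟩
    have hc : (Expr.mul (.var 16) (.add (.eq (.var 9) (.lit 0)) (.lt (.var 17) (.var 10)))).eval s₁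
        ≠ 0 ↔ ((∀ q < l, s.arr 8 q ≠ 0) ∧
          (s.var 9 = 0 ∨ ∑ q ∈ range l, s.arr 5 (s.arr 8 q - 1) < s.var 10)) := by
      simp only [Expr.eval, BinOp.eval, h2, hf.1 9 (by norm_num), hf.1 10 (by norm_num)]
      rcases h3 with ⟨h3, h4⟩ | ⟨h3, h4⟩
      · rw [h3]
        by_cases c1 : s.var 9 = 0 <;>
          by_cases c2 : ∑ q ∈ range l, s.arr 5 (s.arr 8 q - 1) < s.var 10 <;> simp [c1, c2]
        all_goals exact h4
      · rw [h3]
        simp only [zero_mul, ne_eq, not_true_eq_false, false_iff, not_and]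
        exact fun h => absurd h h4
    refine Wp.bounded fun hs₁ => Wp.cond (fun h => ?_) (fun h => Wp.skip (hQ _ ?_ (Or.inr ?_)))
    · obtain ⟨h5, h6⟩ := hc.1 h
      refine Wp.seq (Wp.assign (by simpa [Expr.eval] using hX) (Wp.seq (Wp.assign
        (by simpa [Expr.eval] using hs₁.1 17) (Wp.forTo l hlX (fun j s' τ' => τ' = τ₁ ∧
          s.Frame 9 [9] s' ∧ s'.var 20 = j ∧ s'.var 9 = 1 ∧
          s'.var 10 = ∑ q ∈ range l, s.arr 5 (s.arr 8 q - 1) ∧ ∀ q < j, s'.arr 9 q = s.arr 8 q)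
          ?_ ?_ ?_ ?_))))
      · rintro j s' τ' ⟨-, hf', h1, -⟩
        exact ⟨h1, by simp [Expr.eval, hf'.1, hl]⟩
      · have hf' : s.Frame 9 [9] s₁ := (Store.Frame.refl ..).trans hf (by norm_num) (by simp)
        exact ⟨rfl, ((hf'.setVar (by norm_num) _).setVar (by norm_num) _).setVar (by norm_num) _,
          by simp, by simp [Expr.eval], by simp [Expr.eval, h2], by simp⟩
      · rintro j hj s' τ' ⟨rfl, hf', h1, h7, h8, h9⟩
        have he : (Expr.read 8 (.var 20)).eval s' = s.arr 8 j := by simp [Expr.eval, h1, hf'.2]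
        refine Wp.bounded fun hs' => Wp.write (hs'.2 _ _) ⟨by simp [h1], rfl,
          (hf'.setArr (by simp) _ _).setVar (by norm_num) _, by simp, by simp [h7], by simp [h8],
          fun q hq => ?_⟩
        rw [he]
        by_cases hqj : q = j
        · simp [Expr.eval, h1, hqj]
        · simp [Expr.eval, h1, hqj, h9 q (by omega)]
      · rintro s' τ' ⟨rfl, hf', -, h7, h8, h9⟩
        exact hQ s' hf' (Or.inl ⟨h5, h6, h7, h8, h9⟩)
    · exact (Store.Frame.refl ..).trans hf (by norm_num) (by simp)
    · exact ⟨fun h' => hc.2 h' h, hf.1 9 (by norm_num), hf.1 10 (by norm_num),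
        hf.2 9 (by simp)⟩

end Specs

end RandRAM

/-! ### The whole program -/

namespace RandRAM

open Finset

namespace Expr

/-- A power of the number of vertices. -/
def pow : ℕ → Expr
  | 0 => lit 1
  | i + 1 => mul (pow i) (var 0)

theorem eval_pow (s : Store) (i : ℕ) : (pow i).eval s = s.var 0 ^ i := by
  induction i with
  | zero => rfl
  | succ i ih => simp only [pow, eval, BinOp.eval, ih, pow_succ]

end Expr

namespace Cmd

open RandRAM.Expr

/-- The parameters of the resampling algorithm: the size of the blocks, the number of steps of a
run, the number of runs, and the number of random bits for each step. -/
def parameters (c : ℕ) : Cmd :=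
  .seq (.assign 4 (add (mul (lit 4) (var 3)) (eq (var 3) (lit 0))))
    (.seq (.assign 5 (mul (lit 32) (pow (c + 1))))
      (.seq (.assign 6 (mul (lit 4) (pow (2 * c)))) (.assign 7 (mul (lit (2 * c + 12)) (var 0)))))

/-- The best of the results of several runs. -/
def search : Cmd := .seq (.assign 9 (lit 0)) (forTo 8 (var 6) (.seq trial update))

/-- The program for independent transversals of small weight. -/
def program (c : ℕ) : Cmd :=
  .seq denominators (.seq weights (.seq table (.seq maxDegree (.seq (parameters c)
    (.seq search output)))))

end Cmd

variable {k X : ℕ} {s : Store} {τ : List (Fin (2 ^ k))} {Q : Store → List (Fin (2 ^ k)) → Prop}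

theorem wp_parameters (c : ℕ) {n D : ℕ} (hn : s.var 0 = n) (hD : s.var 3 = D)
    (h4 : LazyResampling.listSize D ≤ X) (h5 : 32 * n ^ (c + 1) ≤ X) (h6 : 4 * n ^ (2 * c) ≤ X)
    (h7 : (2 * c + 12) * n ≤ X)
    (hQ : ∀ s', s.Frame 3 [] s' → s'.var 4 = LazyResampling.listSize D →
      s'.var 5 = 32 * n ^ (c + 1) → s'.var 6 = 4 * n ^ (2 * c) → s'.var 7 = (2 * c + 12) * n →
      Q s' τ) : Wp k X (Cmd.parameters c) s τ Q := by
  have e4 : (Expr.add (.mul (.lit 4) (.var 3)) (.eq (.var 3) (.lit 0))).eval s =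
      LazyResampling.listSize D := by
    simp [Expr.eval, BinOp.eval, hD, LazyResampling.listSize]
  refine Wp.seq (Wp.assign (e4 ▸ lt_two_pow_of_le h4) ?_)
  rw [e4]
  refine Wp.seq (Wp.assign ?_ (Wp.seq (Wp.assign ?_ (Wp.assign ?_ (hQ _ ?_ ?_ ?_ ?_ ?_)))))
  · simpa [Expr.eval, BinOp.eval, Expr.eval_pow, hn] using lt_two_pow_of_le h5
  · simpa [Expr.eval, BinOp.eval, Expr.eval_pow, hn] using lt_two_pow_of_le h6
  · simpa [Expr.eval, BinOp.eval, Expr.eval_pow, hn] using lt_two_pow_of_le h7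
  · exact ((((Store.Frame.refl ..).setVar (by norm_num) _).setVar (by norm_num) _).setVar
      (by norm_num) _).setVar (by norm_num) _
  all_goals simp [Expr.eval, BinOp.eval, Expr.eval_pow, hn]

/-- All blocks have a vertex. -/
def Finished (l : ℕ) (cur : ℕ → ℕ) : Prop := ∀ q < l, cur q ≠ 0

/-- The integral weight of a partial transversal. -/
def totalWeight (l : ℕ) (W cur : ℕ → ℕ) : ℕ := ∑ q ∈ range l, W (cur q - 1)

/-- The result of the `i`-th run. -/
def trialAt (n l m T : ℕ) (adj tab : ℕ → ℕ) (τ : List (Fin (2 ^ k))) (i : ℕ) : ℕ → ℕ :=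
  trial n l m adj tab ((τ.drop (i * T)).take T)

/-- `best` is a lightest one of the results of the first `R` runs, if one of them is a
transversal. -/
def IsBest (l R : ℕ) (W : ℕ → ℕ) (cur : ℕ → ℕ → ℕ) (best : ℕ → ℕ) : Prop :=
  ∃ i < R, Finished l (cur i) ∧ (∀ q < l, best q = cur i q) ∧
    ∀ i' < R, Finished l (cur i') → totalWeight l W (cur i) ≤ totalWeight l W (cur i')

/-- Variable 9 tells whether a transversal has been found. Before round j, exactly j·T random
numbers are consumed, so the rounds read disjoint segments of the list. -/
theorem wp_search {n l m T R Y : ℕ} (hX0 : 0 < X) (hn : s.var 0 = n) (hl : s.var 1 = l)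
    (hm : s.var 4 = m) (hT : s.var 5 = T) (hR : s.var 6 = R) (hk : s.var 7 = k) (hnX : n ≤ X)
    (hlX : l ≤ X) (hkX : k ≤ X) (hTX : T ≤ X) (hRX : R ≤ X) (hY : ∀ q, s.arr 5 q ≤ Y)
    (hYX : l * Y < 2 ^ X) (htab : ∀ q, s.arr 7 q < n) (hcur : ∀ q, l ≤ q → s.arr 8 q = 0)
    (hτ : τ.length = R * T)
    (hQ : ∀ s' τ', s.Frame 8 [8, 9] s' →
      ((∃ i < R, Finished l (trialAt n l m T (s.arr 0) (s.arr 7) τ i)) →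
        IsBest l R (s.arr 5) (trialAt n l m T (s.arr 0) (s.arr 7) τ) (s'.arr 9)) → Q s' τ') :
    Wp k X Cmd.search s τ Q := by
  set cur := trialAt n l m T (s.arr 0) (s.arr 7) τ with hcurdef
  refine Wp.seq (Wp.assign (by simp [Expr.eval]) (Wp.forTo R hRX
    (fun j s' τ' => τ' = τ.drop (j * T) ∧ s.Frame 8 [8, 9] s' ∧ s'.var 8 = j ∧
      (∀ q, l ≤ q → s'.arr 8 q = 0) ∧ ((s'.var 9 = 0 ∧ ∀ i < j, ¬ Finished l (cur i)) ∨
        (s'.var 9 ≠ 0 ∧ ∃ i < j, Finished l (cur i) ∧ (∀ q < l, s'.arr 9 q = cur i q) ∧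
          s'.var 10 = totalWeight l (s.arr 5) (cur i) ∧
          ∀ i' < j, Finished l (cur i') →
            totalWeight l (s.arr 5) (cur i) ≤ totalWeight l (s.arr 5) (cur i'))))
    ?_ ?_ ?_ ?_))
  · rintro j s' τ' ⟨-, hf, h1, -⟩
    exact ⟨h1, by simp [Expr.eval, hf.1, hR]⟩
  · exact ⟨by simp, ((Store.Frame.refl ..).setVar (by norm_num) _).setVar (by norm_num) _, by simp,
      by simpa using hcur, by simp [Expr.eval]⟩
  · rintro j hj s' τ' ⟨rfl, hf, h1, h2, h3⟩
    have hlen : T ≤ (τ.drop (j * T)).length := by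
      rw [List.length_drop, hτ, ← Nat.sub_mul]
      exact Nat.le_mul_of_pos_left _ (by omega)
    refine Wp.seq (wp_trial (n := n) (l := l) (m := m) (by simp [hf.1, hn]) (by simp [hf.1, hl])
      (by simp [hf.1, hm]) (by simp [hf.1, hT]) (by simp [hf.1, hk]) hnX hlX hkX hTX
      (by simpa [hf.2] using htab) h2 hlen fun s₁ hf₁ h8 => ?_)
    have h8' : s₁.arr 8 = cur j := by
      rw [h8, hf.2 0 (by simp), hf.2 7 (by simp)]; rfl
    have h5' : s₁.arr 5 = s.arr 5 := by rw [hf₁.2 5 (by simp), hf.2 5 (by simp)]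
    have hf' : s.Frame 8 [8, 9] s₁ := hf.trans hf₁ (by norm_num) (by simp)
    refine wp_update (Y := Y) hX0 (by rw [hf'.1 1 (by norm_num), hl]) hlX
      (by rw [h5']; exact hY) hYX fun s₂ hf₂ h4 => ?_
    have hf'' : s.Frame 8 [8, 9] s₂ := hf'.trans hf₂ (by norm_num) (by simp)
    refine ⟨by rw [hf₂.1 8 (by norm_num), hf₁.1 8 (by norm_num), h1], ?_,
      hf''.setVar le_rfl _, by simp, fun q hq => ?_, ?_⟩
    · rw [List.drop_drop]; congr 1; ring
    · rw [Store.setVar_arr, hf₂.2 8 (by simp), h8']; exact trial_of_le hq _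
    · simp only [Store.setVar_arr, Store.setVar_var, show (9 : ℕ) ≠ 8 by norm_num,
        show (10 : ℕ) ≠ 8 by norm_num, if_false]
      rw [h8', h5', hf₁.1 9 (by norm_num), hf₁.1 10 (by norm_num), hf₁.2 9 (by simp)] at h4
      change (Finished l (cur j) ∧ (s'.var 9 = 0 ∨
        totalWeight l (s.arr 5) (cur j) < s'.var 10) ∧ s₂.var 9 = 1 ∧
        s₂.var 10 = totalWeight l (s.arr 5) (cur j) ∧ ∀ q < l, s₂.arr 9 q = cur j q) ∨
        (¬ (Finished l (cur j) ∧ (s'.var 9 = 0 ∨ totalWeight l (s.arr 5) (cur j) < s'.var 10)) ∧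
          s₂.var 9 = s'.var 9 ∧ s₂.var 10 = s'.var 10 ∧ s₂.arr 9 = s'.arr 9) at h4
      rcases h4 with ⟨h5, h6, h7, h9, h10⟩ | ⟨h5, h6, h7, h9⟩
      · refine Or.inr ⟨by simp [h7], j, by omega, h5, h10, h9, fun i' hi' hfi => ?_⟩
        rcases Nat.lt_succ_iff_lt_or_eq.1 hi' with hi' | rfl
        · rcases h3 with ⟨_, h3⟩ | ⟨hne, i, hi, hfi', -, h12, h13⟩
          · exact absurd hfi (h3 i' hi')
          · rcases h6 with h6 | h6
            · exact absurd h6 hne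
            · exact (h12 ▸ h6).le.trans (h13 i' hi' hfi)
        · exact le_rfl
      · rw [h6, h7, h9]
        rcases h3 with ⟨h11, h12⟩ | ⟨hne, i, hi, hfi', h11, h12, h13⟩
        · refine Or.inl ⟨h11, fun i hi hfi => ?_⟩
          rcases Nat.lt_succ_iff_lt_or_eq.1 hi with hi | rfl
          exacts [h12 i hi hfi, h5 ⟨hfi, Or.inl h11⟩]
        · refine Or.inr ⟨hne, i, by omega, hfi', h11, h12, fun i' hi' hfi => ?_⟩
          rcases Nat.lt_succ_iff_lt_or_eq.1 hi' with hi' | rfl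
          · exact h13 i' hi' hfi
          · by_contra hlt
            exact h5 ⟨hfi, Or.inr (h12 ▸ not_le.1 hlt)⟩
  · rintro s' τ' ⟨rfl, hf, -, -, h3⟩
    refine hQ s' _ hf ?_
    rintro ⟨i, hi, hfi⟩
    rcases h3 with ⟨-, h3⟩ | ⟨-, i, hi, hfi', h11, -, h13⟩
    · exact absurd hfi (h3 i hi)
    · exact ⟨i, hi, hfi', h11, h13⟩

theorem wp_output {l : ℕ} (hX0 : 0 < X) (hl : s.var 1 = l) (hlX : l ≤ X)
    (hQ : ∀ s', (∀ v, s'.arr 4 v ≠ 0 ↔ s.arr 4 v ≠ 0 ∨ ∃ q < l, s.arr 9 q - 1 = v) → Q s' τ) :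
    Wp k X Cmd.output s τ Q := by
  refine Wp.forTo l hlX (fun j s' τ' => τ' = τ ∧ s.Frame 8 [4] s' ∧ s'.var 20 = j ∧
      ∀ v, s'.arr 4 v ≠ 0 ↔ s.arr 4 v ≠ 0 ∨ ∃ q < j, s.arr 9 q - 1 = v) ?_ ?_ ?_ ?_
  · rintro j s' τ' ⟨-, hf, h1, -⟩
    exact ⟨h1, by simp [Expr.eval, hf.1, hl]⟩
  · exact ⟨rfl, (Store.Frame.refl ..).setVar (by norm_num) _, by simp, by simp⟩
  · rintro j hj s' τ' ⟨rfl, hf, h1, h2⟩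
    refine Wp.write (by simpa [Expr.eval] using hX0.ne') ⟨by simp [h1], rfl,
      (hf.setArr (by simp) _ _).setVar (by norm_num) _, by simp, fun v => ?_⟩
    have he : (Expr.bin .sub (.read 9 (.var 20)) (.lit 1)).eval s' = s.arr 9 j - 1 := by
      simp [Expr.eval, BinOp.eval, h1, hf.2]
    rw [he, Store.setVar_arr, Store.setArr_arr, if_pos rfl]
    by_cases hv : v = s.arr 9 j - 1
    · subst hv
      simp only [Function.update_self, Expr.eval, ne_eq, one_ne_zero, not_false_eq_true, true_iff]
      exact Or.inr ⟨j, by omega, rfl⟩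
    · rw [Function.update_of_ne hv, h2]
      refine or_congr_right ⟨fun ⟨q, hq, h⟩ => ⟨q, by omega, h⟩, fun ⟨q, hq, h⟩ => ?_⟩
      rcases Nat.lt_succ_iff_lt_or_eq.1 hq with hq | rfl
      exacts [⟨q, hq, h⟩, absurd h.symm hv]
  · rintro s' τ' ⟨rfl, -, -, h2⟩
    exact hQ s' h2

/-- The vertex of a given rank in a given block. -/
noncomputable def tableEntry (n : ℕ) (B W : ℕ → ℕ) (q : ℕ) : ℕ :=
  open Classical in
  if h : ∃ v < n, B v * n + rank n B W v = q then h.choose else 0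

theorem tableEntry_lt {n : ℕ} (hn : 0 < n) (B W : ℕ → ℕ) (q : ℕ) : tableEntry n B W q < n := by
  unfold tableEntry
  split_ifs with h
  exacts [h.choose_spec.1, hn]

theorem tableEntry_rank {n : ℕ} {B W : ℕ → ℕ}
    (hinj : ∀ u < n, ∀ v < n, B u * n + rank n B W u = B v * n + rank n B W v → u = v)
    {v : ℕ} (hv : v < n) : tableEntry n B W (B v * n + rank n B W v) = v := by
  have h : ∃ u < n, B u * n + rank n B W u = B v * n + rank n B W v := ⟨v, hv, rfl⟩
  rw [tableEntry, dif_pos h]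
  exact hinj _ h.choose_spec.1 v hv h.choose_spec.2

/-- The weights, multiplied by their common denominator. -/
def intWeight (n : ℕ) (num den : ℕ → ℕ) (j : ℕ) : ℕ :=
  if j < n then num j * ((∏ i ∈ range n, den i) / den j) else 0

theorem wp_program (c : ℕ) {n l D Y : ℕ} {W : ℕ → ℕ} (hX0 : 0 < X) (hn0 : 0 < n)
    (hn : s.var 0 = n) (hl : s.var 1 = l)
    (hk : k = (2 * c + 12) * n) (hnX : n ≤ X) (hlX : l ≤ X)
    (h4 : LazyResampling.listSize D ≤ X) (h5 : 32 * n ^ (c + 1) ≤ X) (h6 : 4 * n ^ (2 * c) ≤ X)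
    (h7 : (2 * c + 12) * n ≤ X)
    (hden : ∀ j ≤ n, ∏ i ∈ range j, s.arr 3 i < 2 ^ X)
    (hW : intWeight n (s.arr 2) (s.arr 3) = W) (hY : ∀ q, W q ≤ Y) (hYX : Y < 2 ^ X)
    (hlYX : l * Y < 2 ^ X)
    (hinj : ∀ u < n, ∀ v < n, s.arr 1 u * n + rank n (s.arr 1) W u =
      s.arr 1 v * n + rank n (s.arr 1) W v → u = v)
    (hadj : ∀ q, s.arr 0 q ≤ 1)
    (hD : (range n).sup (fun v => ∑ u ∈ range n, s.arr 0 (v * n + u)) = D)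
    (hzero : ∀ a, 4 ≤ a → ∀ q, s.arr a q = 0)
    (hτ : τ.length = 4 * n ^ (2 * c) * (32 * n ^ (c + 1)))
    (hQ : ∀ s' τ', ((∃ i < 4 * n ^ (2 * c),
        Finished l (trialAt n l (LazyResampling.listSize D) (32 * n ^ (c + 1)) (s.arr 0)
          (tableEntry n (s.arr 1) W) τ i)) →
        ∃ best, IsBest l (4 * n ^ (2 * c)) W (trialAt n l (LazyResampling.listSize D)
          (32 * n ^ (c + 1)) (s.arr 0) (tableEntry n (s.arr 1) W) τ) best ∧
          ∀ v, s'.arr 4 v ≠ 0 ↔ ∃ q < l, best q - 1 = v) → Q s' τ') :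
    Wp k X (Cmd.program c) s τ Q := by
  refine Wp.seq (wp_denominators hX0 hn hnX hden fun s₁ hf₁ h2 => Wp.seq ?_)
  have a1 : ∀ a, s₁.arr a = s.arr a := fun a => hf₁.2 a List.not_mem_nil
  refine wp_weights (n := n) (by rw [hf₁.1 0 (by norm_num), hn]) hnX ?_ fun s₂ hf₂ h8 h9 =>
    Wp.seq ?_
  · intro j hj
    rw [a1, a1, h2]
    have := hY j
    rw [← hW, intWeight, if_pos hj] at this
    omega
  have hW₂ : s₂.arr 5 = W := by
    rw [← hW]
    funext j
    unfold intWeight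
    split_ifs with hj
    · rw [h8 j hj, a1, a1, h2]
    · rw [h9 j (not_lt.1 hj), a1, hzero 5 (by norm_num)]
  have hB₂ : s₂.arr 1 = s.arr 1 := by rw [hf₂.2 1 (by simp), a1]
  refine wp_table (n := n) (by rw [hf₂.1 0 (by norm_num), hf₁.1 0 (by norm_num), hn]) hnX
    (by rw [hB₂, hW₂]; exact hinj) fun s₃ hf₃ h10 h11 => Wp.seq ?_
  rw [hB₂, hW₂] at h10 h11
  have htab : s₃.arr 7 = tableEntry n (s.arr 1) W := by
    funext q
    by_cases hq : ∃ v < n, s.arr 1 v * n + rank n (s.arr 1) W v = q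
    · obtain ⟨v, hv, rfl⟩ := hq
      rw [h10 v hv, tableEntry_rank hinj hv]
    · rw [tableEntry, dif_neg hq, h11 q (fun v hv h => hq ⟨v, hv, h⟩), hf₂.2 7 (by simp), a1,
        hzero 7 (by norm_num)]
  have a3 : ∀ a, a ≠ 5 → a ≠ 7 → s₃.arr a = s.arr a := fun a h h' => by
    rw [hf₃.2 a (by simpa using h'), hf₂.2 a (by simpa using h), a1]
  have v3 : ∀ x < 2, s₃.var x = s.var x := fun x hx => by
    rw [hf₃.1 x (by omega), hf₂.1 x (by omega), hf₁.1 x hx]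
  refine wp_maxDegree (n := n) (by rw [v3 0 (by norm_num), hn]) hnX
    (by rw [a3 0 (by norm_num) (by norm_num)]; exact hadj) fun s₄ hf₄ h12 => Wp.seq ?_
  rw [a3 0 (by norm_num) (by norm_num), hD] at h12
  have v4 : ∀ x < 2, s₄.var x = s.var x := fun x hx => by rw [hf₄.1 x (by omega), v3 x hx]
  refine wp_parameters c (n := n) (by rw [v4 0 (by norm_num), hn]) h12 h4 h5 h6 h7
    fun s₅ hf₅ h13 h14 h15 h16 => Wp.seq ?_
  have v5 : ∀ x < 2, s₅.var x = s.var x := fun x hx => by rw [hf₅.1 x (by omega), v4 x hx]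
  have a5 : ∀ a, s₅.arr a = s₃.arr a := fun a => by
    rw [hf₅.2 a List.not_mem_nil, hf₄.2 a List.not_mem_nil]
  have e5 : s₅.arr 5 = W := by rw [a5, hf₃.2 5 (by simp), hW₂]
  have e7 : s₅.arr 7 = tableEntry n (s.arr 1) W := by rw [a5, htab]
  have e0 : s₅.arr 0 = s.arr 0 := by rw [a5, a3 0 (by norm_num) (by norm_num)]
  refine wp_search (n := n) (l := l) (Y := Y) hX0 (by rw [v5 0 (by norm_num), hn])
    (by rw [v5 1 (by norm_num), hl]) h13 h14 h15 (by rw [h16, hk]) hnX hlX (hk ▸ h7) h5 h6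
    (by rw [e5]; exact hY) hlYX (by rw [e7]; exact tableEntry_lt hn0 _ _)
    (fun q _ => by rw [a5, a3 8 (by norm_num) (by norm_num), hzero 8 (by norm_num)]) hτ
    fun s₆ τ₆ hf₆ h17 => ?_
  rw [e5, e7, e0] at h17
  refine wp_output (l := l) hX0 (by rw [hf₆.1 1 (by norm_num), v5 1 (by norm_num), hl]) hlX
    fun s₇ h18 => hQ s₇ _ fun h => ⟨s₆.arr 9, h17 h, fun v => ?_⟩
  rw [h18, hf₆.2 4 (by simp), a5, a3 4 (by norm_num) (by norm_num), hzero 4 le_rfl]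
  simp

end RandRAM

/-! ### The order by weights and the resampler of the program -/

namespace RandRAM

open Finset LazyResampling

section Rank

variable {n l b : ℕ} {blk : Fin n → Fin l} {B W : ℕ → ℕ}

theorem rank_eq_card (hB : ∀ v : Fin n, B v = blk v) (v : Fin n) :
    rank n B W v = (univ.filter fun u : Fin n =>
      blk u = blk v ∧ (W u < W v ∨ W u = W v ∧ u < v)).card := by
  rw [rank, sum_range, card_filter]
  simp only [hB, Fin.val_inj, Fin.lt_def]

theorem rank_lt_rank (hB : ∀ v : Fin n, B v = blk v) {u v : Fin n} (huv : blk u = blk v)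
    (h : W u < W v ∨ W u = W v ∧ u < v) : rank n B W u < rank n B W v := by
  rw [rank_eq_card hB, rank_eq_card hB]
  refine card_lt_card ((ssubset_iff_of_subset fun x hx => ?_).2 ⟨u, ?_, ?_⟩)
  · simp only [mem_filter, mem_univ, true_and] at hx ⊢
    rw [← huv]
    refine ⟨hx.1, ?_⟩
    rcases hx.2 with h' | ⟨h', h''⟩ <;> rcases h with h | ⟨h1, h2⟩
    · exact Or.inl (h'.trans h)
    · exact Or.inl (h1 ▸ h')
    · exact Or.inl (h' ▸ h)
    · exact Or.inr ⟨h'.trans h1, h''.trans h2⟩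
  · simpa [huv] using h
  · simp

theorem eq_of_rank_eq (hB : ∀ v : Fin n, B v = blk v) {u v : Fin n} (huv : blk u = blk v)
    (h : rank n B W u = rank n B W v) : u = v := by
  by_contra hne
  rcases lt_trichotomy (W u) (W v) with hw | hw | hw
  · exact (rank_lt_rank hB huv (Or.inl hw)).ne h
  · rcases lt_or_gt_of_ne hne with hlt | hlt
    · exact (rank_lt_rank hB huv (Or.inr ⟨hw, hlt⟩)).ne h
    · exact (rank_lt_rank hB huv.symm (Or.inr ⟨hw.symm, hlt⟩)).ne h.symm
  · exact (rank_lt_rank hB huv.symm (Or.inl hw)).ne h.symm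

theorem rank_lt_card (hB : ∀ v : Fin n, B v = blk v)
    (hb : ∀ i, (univ.filter fun v => blk v = i).card = b) (v : Fin n) : rank n B W v < b := by
  rw [rank_eq_card hB, ← hb (blk v)]
  refine card_lt_card ((ssubset_iff_of_subset fun x hx => ?_).2 ⟨v, by simp, by simp⟩)
  simp only [mem_filter, mem_univ, true_and] at hx ⊢
  exact hx.1

/-- Ranks are injective on a block and less than its size b, so they take every value below b
exactly once. -/
theorem image_rank_filter (hB : ∀ v : Fin n, B v = blk v)
    (hb : ∀ i, (univ.filter fun v => blk v = i).card = b) {m : ℕ} (hm : m ≤ b) (i : Fin l) :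
    ((univ.filter fun v : Fin n => rank n B W v < m).filter fun v => blk v = i).image
      (fun v : Fin n => rank n B W v) = range m := by
  have hall : (univ.filter fun v => blk v = i).image (fun v : Fin n => rank n B W v) = range b := by
    refine eq_of_subset_of_card_le (fun q hq => ?_) ?_
    · obtain ⟨v, -, rfl⟩ := mem_image.1 hq
      exact mem_range.2 (rank_lt_card hB hb v)
    · rw [card_range, card_image_of_injOn, hb]
      intro u hu v hv h
      rw [mem_coe, mem_filter] at hu hv
      exact eq_of_rank_eq hB (hu.2.trans hv.2.symm) h
  ext q
  rw [mem_range]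
  constructor
  · intro hq
    obtain ⟨v, hv, rfl⟩ := mem_image.1 hq
    exact (mem_filter.1 (mem_filter.1 hv).1).2
  · intro hq
    obtain ⟨v, hv, rfl⟩ := mem_image.1 (hall ▸ mem_range.2 (hq.trans_le hm))
    exact mem_image.2 ⟨v, by simpa [hq] using hv, rfl⟩

theorem card_filter_rank_lt (hB : ∀ v : Fin n, B v = blk v)
    (hb : ∀ i, (univ.filter fun v => blk v = i).card = b) {m : ℕ} (hm : m ≤ b) (i : Fin l) :
    ((univ.filter fun v : Fin n => rank n B W v < m).filter fun v => blk v = i).card = m := by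
  refine Eq.trans ?_ ((congrArg card (image_rank_filter (W := W) hB hb hm i)).trans (card_range m))
  refine (card_image_of_injOn ?_).symm
  intro u hu v hv h
  rw [mem_coe, mem_filter] at hu hv
  exact eq_of_rank_eq hB (hu.2.trans hv.2.symm) h

/-- The rank is less than b ≤ n, so block and rank are the quotient and the remainder modulo n. -/
theorem injective_mul_add_rank (hB : ∀ v : Fin n, B v = blk v)
    (hb : ∀ i, (univ.filter fun v => blk v = i).card = b) (hbn : b ≤ n) :
    ∀ u < n, ∀ v < n, B u * n + rank n B W u = B v * n + rank n B W v → u = v := by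
  intro u hu v hv h
  have hu' := (rank_lt_card (W := W) hB hb ⟨u, hu⟩).trans_le hbn
  have hv' := (rank_lt_card (W := W) hB hb ⟨v, hv⟩).trans_le hbn
  have h1 := congrArg (· / n) h
  have h2 := congrArg (· % n) h
  simp only [Nat.mul_add_mod', Nat.mod_eq_of_lt hu', Nat.mod_eq_of_lt hv'] at h2
  rw [h2] at h
  have h3 : B u = B v := Nat.eq_of_mul_eq_mul_right (by omega) (by omega : B u * n = B v * n)
  rw [hB ⟨u, hu⟩, hB ⟨v, hv⟩, Fin.val_inj] at h3
  exact congrArg Fin.val (eq_of_rank_eq (W := W) hB h3 h2)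

theorem exists_tableEntry_eq (hB : ∀ v : Fin n, B v = blk v)
    (hb : ∀ i, (univ.filter fun v => blk v = i).card = b) (hbn : b ≤ n) {m : ℕ} (hm : m ≤ b)
    (i : Fin l) {q : ℕ} (hq : q < m) : ∃ v : Fin n, tableEntry n B W (i * n + q) = v ∧
      blk v = i ∧ rank n B W v = q := by
  obtain ⟨v, hv, rfl⟩ := mem_image.1 ((image_rank_filter (W := W) hB hb hm i) ▸ mem_range.2 hq)
  have hvi := (mem_filter.1 hv).2
  refine ⟨v, ?_, hvi, rfl⟩
  rw [← hvi, ← hB]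
  exact tableEntry_rank (injective_mul_add_rank hB hb hbn) v.2

end Rank

section Resampler

variable {n l b m : ℕ} {blk : Fin n → Fin l} {B W adj : ℕ → ℕ} {G : SimpleGraph (Fin n)}

/-- The abstract state that is represented by the contents of an array. -/
def vertexAt (n : ℕ) (l : ℕ) (s : {cur : ℕ → ℕ // ∀ q, cur q ≤ n}) (i : Fin l) :
    Option (Fin n) :=
  if h : s.1 i = 0 then none else some ⟨s.1 i - 1, by have := s.2 i; omega⟩

theorem vertexAt_eq_some {s : {cur : ℕ → ℕ // ∀ q, cur q ≤ n}} {i : Fin l} {v : Fin n} :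
    vertexAt n l s i = some v ↔ s.1 i = v + 1 := by
  unfold vertexAt
  split_ifs with h
  · simp [h]
  · rw [Option.some_inj, Fin.ext_iff]
    dsimp only
    omega

theorem vertexAt_eq_none {s : {cur : ℕ → ℕ // ∀ q, cur q ≤ n}} {i : Fin l} :
    vertexAt n l s i = none ↔ s.1 i = 0 := by
  unfold vertexAt
  split_ifs with h <;> simp [h]

theorem resample_le {tab cur : ℕ → ℕ} (htab : ∀ q, tab q < n) (hcur : ∀ q, cur q ≤ n) (r q : ℕ) :
    resample n l m adj tab cur r q ≤ n := by
  unfold resample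
  split_ifs
  all_goals first | exact hcur q | (rw [Function.update_apply]; split_ifs)
  all_goals first | exact hcur q | exact Nat.zero_le _ | exact htab _

/-- The resampling algorithm that the program carries out. -/
noncomputable def ramResampler (k : ℕ) (hn : 0 < n) (hB : ∀ v : Fin n, B v = blk v)
    (hb : ∀ i, (univ.filter fun v => blk v = i).card = b) (hbn : b ≤ n) (hm0 : 0 < m) (hm : m ≤ b)
    (hadj : ∀ u v : Fin n, adj (u * n + v) ≠ 0 ↔ G.Adj u v) :
    Resampler blk G (univ.filter fun v : Fin n => rank n B W v < m) (Fin (2 ^ k))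
      {cur : ℕ → ℕ // ∀ q, cur q ≤ n} where
  view := vertexAt n l
  next s r := ⟨resample n l m adj (tableEntry n B W) s.1 r.val,
    resample_le (tableEntry_lt hn B W) s.2 r.val⟩
  sel s := if h : lastIdx (fun q => s.1 q = 0) l l < l then some ⟨_, h⟩ else none
  tab i r := ⟨tableEntry n B W (i * n + r % m), tableEntry_lt hn B W _⟩
  tab_mem i r := by
    obtain ⟨v, hv, -, hr⟩ := exists_tableEntry_eq (W := W) hB hb hbn hm i (Nat.mod_lt r.val hm0)
    simp only [mem_filter, mem_univ, true_and, hv, hr, Nat.mod_lt r.val hm0]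
  blk_tab i r := by
    obtain ⟨v, hv, hi, -⟩ := exists_tableEntry_eq (W := W) hB hb hbn hm i (Nat.mod_lt r.val hm0)
    simp only [hv, Fin.eta, hi]
  sel_eq_none s hs i hi := by
    split_ifs at hs with h
    rcases lastIdx_spec (fun q => s.1 q = 0) l l with h' | h'
    · exact h'.2 i i.2 (vertexAt_eq_none.1 hi)
    · exact h h'.1
  next_eq s r hs := by
    split_ifs at hs with h
    ext1
    simp only [resample, if_neg h]
  view_sel s i hs := by
    split_ifs at hs with h
    rw [← Option.some.inj hs, vertexAt_eq_none]
    rcases lastIdx_spec (fun q => s.1 q = 0) l l with h' | h'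
    · omega
    · exact h'.2
  view_next s i r hs := by
    split_ifs at hs with h
    obtain rfl := Option.some.inj hs
    set i := lastIdx (fun q => s.1 q = 0) l l with hi
    set v := tableEntry n B W (i * n + r % m) with hv
    have hvn : v < n := tableEntry_lt hn B W _
    have hadj' : ∀ q (hq : s.1 q ≠ 0), adj (v * n + (s.1 q - 1)) ≠ 0 ↔
        G.Adj ⟨v, hvn⟩ ⟨s.1 q - 1, by have := s.2 q; omega⟩ := fun q hq => hadj ⟨v, hvn⟩ ⟨_, _⟩
    set j := lastIdx (fun q => s.1 q * adj (v * n + (s.1 q - 1)) ≠ 0) l l with hj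
    -- Either no chosen vertex is adjacent to the one drawn, or block j holds an adjacent one, which
    -- is removed.
    rcases lastIdx_spec (fun q => s.1 q * adj (v * n + (s.1 q - 1)) ≠ 0) l l with h' | h'
    · have hr : resample n l m adj (tableEntry n B W) s.1 r.val =
          Function.update s.1 i (v + 1) := by
        rw [resample, if_pos h, if_neg]
        change ¬ j < l
        omega
      refine Or.inl ⟨fun j' u hu ha => h'.2 j' j'.2 ?_, funext fun q => ?_⟩
      · rw [vertexAt_eq_some] at hu
        refine mul_ne_zero (by omega) ?_
        rw [hadj' j' (by omega)]
        convert ha using 1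
        ext
        dsimp only
        omega
      · rcases eq_or_ne q ⟨i, h⟩ with rfl | hq
        · rw [Function.update_self, vertexAt_eq_some]
          dsimp only
          rw [hr, Function.update_self]
        · rw [Function.update_of_ne hq]
          have : q.val ≠ i := fun h => hq (Fin.ext h)
          unfold vertexAt
          simp only [hr, Function.update_of_ne this]
    · have hjl : j < l := h'.1
      have hr : resample n l m adj (tableEntry n B W) s.1 r.val = Function.update s.1 j 0 := by
        rw [resample, if_pos h, if_pos]
        exact hjl
      obtain ⟨h1, h2⟩ := mul_ne_zero_iff.1 h'.2
      refine Or.inr ⟨⟨j, hjl⟩, ⟨s.1 j - 1, by have := s.2 j; omega⟩, ?_, (hadj' j h1).1 h2,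
        funext fun q => ?_⟩
      · rw [vertexAt_eq_some]
        have : s.1 j ≠ 0 := h1
        dsimp only
        omega
      · rcases eq_or_ne q ⟨j, hjl⟩ with rfl | hq
        · rw [Function.update_self, vertexAt_eq_none]
          dsimp only
          rw [hr, Function.update_self]
        · rw [Function.update_of_ne hq]
          have : q.val ≠ j := fun h => hq (Fin.ext h)
          unfold vertexAt
          simp only [hr, Function.update_of_ne this]

end Resampler

end RandRAM

/-! ### The success probability of the program -/

namespace RandRAM

open Finset LazyResampling

section Resampler

variable {n l b m k : ℕ} {blk : Fin n → Fin l} {B W adj : ℕ → ℕ} {G : SimpleGraph (Fin n)}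

/-- The state without any vertices. -/
def emptyState (n : ℕ) : {cur : ℕ → ℕ // ∀ q, cur q ≤ n} := ⟨fun _ => 0, fun _ => Nat.zero_le _⟩

/-- Within a residue class modulo m, a number is determined by its quotient, which is at most N / m.
-/
theorem card_filter_mod_le (N m a : ℕ) :
    (univ.filter fun r : Fin N => r.val % m = a).card ≤ N / m + 1 := by
  rw [← card_range (N / m + 1)]
  refine card_le_card_of_injOn (fun r => r.val / m) (fun r _ => ?_) fun r hr r' hr' h => ?_
  · exact mem_coe.2 (mem_range.2 (Nat.lt_succ_of_le (Nat.div_le_div_right r.2.le)))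
  · simp only [coe_filter, Set.mem_ofPred_eq, mem_univ, true_and] at hr hr'
    ext
    rw [← Nat.div_add_mod r.val m, ← Nat.div_add_mod r'.val m, hr, hr']
    simp only at h
    rw [h]

variable (hn : 0 < n) (hB : ∀ v : Fin n, B v = blk v)
  (hb : ∀ i, (univ.filter fun v => blk v = i).card = b) (hbn : b ≤ n) (hm0 : 0 < m) (hm : m ≤ b)
  (hadj : ∀ u v : Fin n, adj (u * n + v) ≠ 0 ↔ G.Adj u v)

/-- A vertex is drawn only if r mod m is its rank, which happens for at most 2ᵏ/m + 1 values of r.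
So the bias is ε = m/2ᵏ. -/
theorem card_ramResampler_tab_le (i : Fin l) (v : Fin n) :
    ((univ.filter fun r =>
      (ramResampler (W := W) k hn hB hb hbn hm0 hm hadj).tab i r = v).card : ℝ) /
      Fintype.card (Fin (2 ^ k)) ≤ (1 + m / 2 ^ k) / m := by
  have h1 : (univ.filter fun r =>
      (ramResampler (W := W) k hn hB hb hbn hm0 hm hadj).tab i r = v).card ≤ 2 ^ k / m + 1 := by
    refine (card_le_card fun r hr => ?_).trans
      (card_filter_mod_le (2 ^ k) m (rank n B W v))
    obtain ⟨u, hu, -, hr'⟩ := exists_tableEntry_eq (W := W) hB hb hbn hm i (Nat.mod_lt r.val hm0)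
    simp only [mem_filter, mem_univ, true_and] at hr ⊢
    have : v.val = u.val := by rw [← hr]; exact hu
    rw [this, hr']
  have h2 : ((2 ^ k / m + 1 : ℕ) : ℝ) ≤ 2 ^ k / m + 1 := by
    push_cast
    have := Nat.cast_div_le (α := ℝ) (m := 2 ^ k) (n := m)
    push_cast at this
    linarith
  have hm' : (0 : ℝ) < m := by exact_mod_cast hm0
  rw [Fintype.card_fin, div_le_iff₀ (by positivity)]
  refine ((Nat.cast_le.2 h1).trans h2).trans_eq ?_
  push_cast
  field_simp

theorem ramResampler_view_emptyState (i : Fin l) :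
    (ramResampler (W := W) k hn hB hb hbn hm0 hm hadj).view (emptyState n) i = none := rfl

theorem ramResampler_run (ω : List (Fin (2 ^ k))) :
    ((ramResampler (W := W) k hn hB hb hbn hm0 hm hadj).run (emptyState n) ω).1 =
      trial n l m adj (tableEntry n B W) ω := by
  induction ω using List.reverseRecOn with
  | nil => rfl
  | append_singleton ω r ih =>
    rw [Resampler.run_append, trial, List.foldl_append, List.foldl_cons, List.foldl_nil,
      ← trial, ← ih]
    rfl

theorem ramResampler_sel_eq_none_iff (s : {cur : ℕ → ℕ // ∀ q, cur q ≤ n}) :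
    (ramResampler (W := W) k hn hB hb hbn hm0 hm hadj).sel s = none ↔ Finished l s.1 := by
  change (if h : lastIdx (fun q => s.1 q = 0) l l < l then some ⟨_, h⟩ else none) =
    (none : Option (Fin l)) ↔ _
  rcases lastIdx_spec (fun q => s.1 q = 0) l l with h | h
  · rw [dif_neg (by omega)]
    exact ⟨fun _ => h.2, fun _ => rfl⟩
  · rw [dif_pos h.1]
    refine ⟨fun h' => absurd h' (by simp), fun h' => absurd h.2 (h' _ h.1)⟩

theorem totalWeight_eq {s : {cur : ℕ → ℕ // ∀ q, cur q ≤ n}} (hs : Finished l s.1)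
    {d : ℝ} {w : Fin n → ℝ} (hw : ∀ v : Fin n, (W v : ℝ) = d * w v) :
    (totalWeight l W s.1 : ℝ) =
      d * (ramResampler (W := W) k hn hB hb hbn hm0 hm hadj).weight w s := by
  rw [totalWeight, sum_range, Resampler.weight, mul_sum, Nat.cast_sum]
  refine sum_congr rfl fun i _ => ?_
  have h0 := hs i i.2
  have hv : vertexAt n l s i = some ⟨s.1 i - 1, by have := s.2 i; omega⟩ := dif_neg h0
  change _ = d * (vertexAt n l s i).elim 0 w
  rw [hv]
  exact hw ⟨_, _⟩

theorem mem_chosen_iff {ω : List (Fin (2 ^ k))} (hω : Finished l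
      ((ramResampler (W := W) k hn hB hb hbn hm0 hm hadj).run (emptyState n) ω).1) (v : Fin n) :
    v ∈ (ramResampler (W := W) k hn hB hb hbn hm0 hm hadj).chosen
        ((ramResampler (W := W) k hn hB hb hbn hm0 hm hadj).run (emptyState n) ω) ↔
      ∃ q < l, ((ramResampler (W := W) k hn hB hb hbn hm0 hm hadj).run (emptyState n) ω).1 q - 1 =
        v := by
  set 𝓡 := ramResampler (W := W) k hn hB hb hbn hm0 hm hadj with h𝓡
  set s := 𝓡.run (emptyState n) ω with hs
  have hlog := (𝓡.exists_log (ramResampler_view_emptyState hn hB hb hbn hm0 hm hadj) ω).1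
  rw [Resampler.chosen, mem_filter]
  constructor
  · rintro ⟨-, h⟩
    have := vertexAt_eq_some.1 h
    exact ⟨blk v, (blk v).2, by omega⟩
  · rintro ⟨q, hq, h⟩
    have h0 := hω q hq
    have hv : 𝓡.view s ⟨q, hq⟩ = some v := vertexAt_eq_some.2 (by dsimp only; omega)
    refine ⟨mem_univ _, ?_⟩
    rw [(hlog _ _ hv).1]
    exact hv

/-- With x = 32n^(c+1)·m/2ᵏ, the left side is at most eˣ ≤ 1 + 2x, since 0 ≤ x ≤ 1. The number k of
bits is chosen such that 2ᵏ ≥ 256n^(2c+2), and m ≤ n; so x ≤ n⁻ᶜ/8. -/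
theorem one_add_pow_le_of_params (c : ℕ) {n m k : ℕ} (hn : 0 < n) (hmn : m ≤ n) (hk : k = (2 * c + 12) * n) :
    (1 + (m : ℝ) / 2 ^ k) ^ (32 * n ^ (c + 1)) ≤ 1 + ((n : ℝ) ^ c)⁻¹ / 4 := by
  have h2 : 256 * n ^ (2 * c + 2) ≤ 2 ^ k := by
    calc 256 * n ^ (2 * c + 2) ≤ 2 ^ (8 * n) * (2 ^ n) ^ (2 * c + 2) :=
          Nat.mul_le_mul (by
            calc 256 = 2 ^ 8 := by norm_num
              _ ≤ 2 ^ (8 * n) := Nat.pow_le_pow_right (by norm_num) (by omega))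
            (Nat.pow_le_pow_left Nat.lt_two_pow_self.le _)
      _ = 2 ^ (8 * n + n * (2 * c + 2)) := by rw [← pow_mul, ← pow_add]
      _ ≤ 2 ^ k := Nat.pow_le_pow_right (by norm_num) (by rw [hk]; nlinarith)
  have h2' : (256 : ℝ) * (n : ℝ) ^ (2 * c + 2) ≤ 2 ^ k := by exact_mod_cast h2
  have hn' : (0 : ℝ) < n := by exact_mod_cast hn
  have hn1 : (1 : ℝ) ≤ n := by exact_mod_cast hn
  set x : ℝ := (32 * n ^ (c + 1) : ℕ) * ((m : ℝ) / 2 ^ k) with hx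
  have hx0 : 0 ≤ x := by positivity
  have hx8 : x ≤ ((n : ℝ) ^ c)⁻¹ / 8 := by
    have hmn' : (m : ℝ) ≤ n := by exact_mod_cast hmn
    rw [hx, ← mul_div_assoc, div_le_iff₀ (by positivity)]
    push_cast
    calc 32 * (n : ℝ) ^ (c + 1) * m ≤ 32 * (n : ℝ) ^ (c + 1) * n := by gcongr
      _ = ((n : ℝ) ^ c)⁻¹ / 8 * (256 * (n : ℝ) ^ (2 * c + 2)) := by
        field_simp
        ring
      _ ≤ _ := by gcongr
  have hδ1 : ((n : ℝ) ^ c)⁻¹ ≤ 1 := inv_le_one_of_one_le₀ (one_le_pow₀ hn1)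
  calc (1 + (m : ℝ) / 2 ^ k) ^ (32 * n ^ (c + 1))
      ≤ Real.exp ((m : ℝ) / 2 ^ k) ^ (32 * n ^ (c + 1)) := by
        gcongr
        rw [add_comm]
        exact Real.add_one_le_exp _
    _ = Real.exp x := by rw [← Real.exp_nat_mul]
    _ ≤ 1 + 2 * x := by
        have := Real.abs_exp_sub_one_le (x := x) (by rw [abs_of_nonneg hx0]; linarith)
        rw [abs_of_nonneg hx0] at this
        linarith [le_abs_self (Real.exp x - 1)]
    _ ≤ _ := by linarith

open Classical in
-- Each of the 4n^(2c) runs fails with probability at most 1 - δ/4, where δ = n⁻ᶜ, and the runs use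
-- disjoint segments of the list.
theorem one_sub_le_listAvg_exists {D c : ℕ} {κ : ℝ} {w : Fin n → ℝ}
    (hκ : IsRate D b κ) [DecidableRel G.Adj] (hD : ∀ v, G.degree v ≤ D) (hmD : m = listSize D)
    (hw : ∀ v, 0 ≤ w v) (hlight : ∀ u v : Fin n, rank n B W v < m → m ≤ rank n B W u →
      blk u = blk v → w v ≤ w u) (hln : l ≤ n) (hk : k = (2 * c + 12) * n) :
    1 - ((n : ℝ) ^ c)⁻¹ ≤ listAvg (Fin (2 ^ k)) (4 * n ^ (2 * c) * (32 * n ^ (c + 1))) fun τ =>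
      if ∃ i < 4 * n ^ (2 * c), ∃ s, s =
          (ramResampler (W := W) k hn hB hb hbn hm0 hm hadj).run (emptyState n)
            ((τ.drop (i * (32 * n ^ (c + 1)))).take (32 * n ^ (c + 1))) ∧
        (ramResampler (W := W) k hn hB hb hbn hm0 hm hadj).sel s = none ∧
        (ramResampler (W := W) k hn hB hb hbn hm0 hm hadj).weight w s ≤
          (1 + ((n : ℝ) ^ c)⁻¹) * (κ * ∑ v, w v) then 1 else 0 := by
  set 𝓡 := ramResampler (W := W) k hn hB hb hbn hm0 hm hadj with h𝓡
  set δ : ℝ := ((n : ℝ) ^ c)⁻¹ with hδ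
  set T := 32 * n ^ (c + 1) with hT
  set R := 4 * n ^ (2 * c) with hR
  have hn' : (0 : ℝ) < n := by exact_mod_cast hn
  have hn1 : (1 : ℝ) ≤ n := by exact_mod_cast hn
  have hδ0 : 0 < δ := by positivity
  have hδ1 : δ ≤ 1 := inv_le_one_of_one_le₀ (one_le_pow₀ hn1)
  have hfail := 𝓡.listAvg_failure_le hκ (hmD ▸ card_filter_rank_lt hB hb hm) hb hD hw
    (fun v hv u hu huv => hlight u v (mem_filter.1 hv).2
      (by simpa using hu) huv) (ε := m / 2 ^ k) (by positivity)
    (hmD ▸ card_ramResampler_tab_le hn hB hb hbn hm0 hm hadj)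
    (ramResampler_view_emptyState hn hB hb hbn hm0 hm hadj) T hδ0 hδ1
    (one_add_pow_le_of_params c hn (hm.trans hbn) hk)
    (by
      rw [Fintype.card_fin, hT, hδ]
      push_cast
      have : (l : ℝ) ≤ n := by exact_mod_cast hln
      calc 32 * (l : ℝ) ≤ 32 * n := by linarith
        _ = _ := by field_simp; ring) (by positivity)
  set Bad : List (Fin (2 ^ k)) → Prop := fun ω => ¬ (𝓡.sel (𝓡.run (emptyState n) ω) = none ∧
    𝓡.weight w (𝓡.run (emptyState n) ω) ≤ (1 + δ) * (κ * ∑ v, w v)) with hBad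
  have hall : listAvg (Fin (2 ^ k)) (R * T) (fun τ =>
      if ∀ j < R, Bad ((τ.drop (j * T)).take T) then 1 else 0) ≤ (1 - δ / 4) ^ R := by
    convert listAvg_forall_block_le (Bad := Bad) (T := T) (q := 1 - δ / 4) ?_ R
    refine le_trans (listAvg_congr fun ω _ => ?_).le hfail
    by_cases h : 𝓡.sel (𝓡.run (emptyState n) ω) = none ∧
      𝓡.weight w (𝓡.run (emptyState n) ω) ≤ (1 + δ) * (κ * ∑ v, w v)
    · rw [if_pos h, if_neg (not_not.2 h)]
    · rw [if_neg h, if_pos h]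
  have hpow := one_sub_pow_le (x := δ / 4) (by positivity) (by linarith) R
  -- The number R of runs is chosen such that Rδ/4 = nᶜ; so the bound 1/(1 + nᶜ) is below δ.
  have hRδ : 1 / (1 + R * (δ / 4)) ≤ δ := by
    have : (R : ℝ) * (δ / 4) = (n : ℝ) ^ c := by
      rw [hR, hδ]; push_cast; field_simp; ring
    rw [this, hδ, ← one_div]
    gcongr
    linarith
  have hsum : listAvg (Fin (2 ^ k)) (R * T) (fun τ => (if ∃ i < R, ∃ s, s =
      𝓡.run (emptyState n) ((τ.drop (i * T)).take T) ∧ 𝓡.sel s = none ∧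
        𝓡.weight w s ≤ (1 + δ) * (κ * ∑ v, w v) then 1 else 0) +
      if ∀ j < R, Bad ((τ.drop (j * T)).take T) then 1 else 0) = 1 := by
    refine (listAvg_congr fun τ _ => ?_).trans (listAvg_const (R * T) 1)
    by_cases h : ∀ j < R, Bad ((τ.drop (j * T)).take T)
    · rw [if_pos h, if_neg, zero_add]
      rintro ⟨i, hi, _, rfl, h'⟩
      exact h i hi h'
    · rw [if_neg h, if_pos, add_zero]
      push Not at h
      obtain ⟨j, hj, h⟩ := h
      exact ⟨j, hj, _, rfl, h⟩
  rw [listAvg_add] at hsum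
  linarith

end Resampler

end RandRAM

/-! ### Sizes of the input and the final estimate -/

namespace RandRAM

open Finset LazyResampling

section Input

variable {n l : ℕ} (G : SimpleGraph (Fin n)) [DecidableRel G.Adj] (blk : Fin n → Fin l)
  (w : Fin n → ℚ≥0)

theorem inputStore_arr_zero (u v : Fin n) :
    (inputStore G blk w).arr 0 (u * n + v) = if G.Adj u v then 1 else 0 := by
  change (if ∃ u' v' : Fin n, u.val * n + v.val = u'.val * n + v'.val ∧ G.Adj u' v' then 1 else 0) =
    _
  refine if_congr ⟨?_, fun h => ⟨u, v, rfl, h⟩⟩ rfl rfl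
  rintro ⟨u', v', h, h'⟩
  have h2 := congrArg (· % n) h
  simp only [Nat.mul_add_mod', Nat.mod_eq_of_lt v.2, Nat.mod_eq_of_lt v'.2] at h2
  have h3 : u.val = u'.val := Nat.eq_of_mul_eq_mul_right (by have := u.2; omega)
    (by omega : u.val * n = u'.val * n)
  rwa [Fin.ext h3, Fin.ext h2]

theorem inputStore_arr_zero_le (q : ℕ) : (inputStore G blk w).arr 0 q ≤ 1 := by
  change (if ∃ u v : Fin n, q = u.val * n + v.val ∧ G.Adj u v then 1 else 0) ≤ 1
  split_ifs <;> simp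

theorem inputStore_arr_one (v : Fin n) : (inputStore G blk w).arr 1 v = blk v := by
  simp [inputStore]

theorem inputStore_arr_two (v : Fin n) : (inputStore G blk w).arr 2 v = (w v).num := by
  simp [inputStore]

theorem inputStore_arr_three (v : Fin n) : (inputStore G blk w).arr 3 v = (w v).den := by
  simp [inputStore]

theorem inputStore_arr_of_le {a q : ℕ} (ha : a ≠ 0) (h : 4 ≤ a ∨ n ≤ q) :
    (inputStore G blk w).arr a q = 0 := by
  change (if a = 0 then _ else _) = 0
  rw [if_neg ha]
  split_ifs <;> first | rfl | omega

theorem sup_sum_inputStore :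
    (range n).sup (fun v => ∑ u ∈ range n, (inputStore G blk w).arr 0 (v * n + u)) =
      G.maxDegree := by
  have hrow : ∀ v : Fin n, ∑ u ∈ range n, (inputStore G blk w).arr 0 (v * n + u) = G.degree v := by
    intro v
    rw [sum_range]
    simp only [inputStore_arr_zero]
    rw [← card_filter, ← G.card_neighborFinset_eq_degree]
    congr 1
    ext u
    simp
  apply le_antisymm
  · refine Finset.sup_le fun v hv => ?_
    have := hrow ⟨v, mem_range.1 hv⟩
    rw [this]
    exact G.degree_le_maxDegree _
  · refine G.maxDegree_le_of_forall_degree_le _ fun v => ?_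
    rw [← hrow v]
    exact le_sup (f := fun v => ∑ u ∈ range n, (inputStore G blk w).arr 0 (v * n + u))
      (mem_range.2 v.2)

theorem size_le_inputLength (v : Fin n) :
    Nat.size (blk v).val + Nat.size (w v).num + Nat.size (w v).den ≤ inputLength blk w :=
  (single_le_sum (f := fun v => Nat.size (blk v).val + Nat.size (w v).num + Nat.size (w v).den)
    (fun _ _ => Nat.zero_le _) (mem_univ v)).trans (Nat.le_add_left _ _)

theorem le_inputLength : n ≤ inputLength blk w := by
  have := Nat.le_mul_self n
  unfold inputLength
  omega

theorem lt_two_pow_of_size_le {a X : ℕ} (h : Nat.size a ≤ X) : a < 2 ^ X := Nat.size_le.1 h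

theorem inputStore_bounded {X : ℕ} (hX : inputLength blk w < X) :
    (inputStore G blk w).Bounded X := by
  have hn := le_inputLength blk w
  have hl : Nat.size l ≤ inputLength blk w := by unfold inputLength; omega
  refine ⟨fun x => ?_, fun a q => ?_⟩
  · change (if x = 0 then n else if x = 1 then l else 0) < 2 ^ X
    split_ifs
    · exact lt_two_pow_of_le (by omega)
    · exact lt_two_pow_of_size_le (by omega)
    · positivity
  · rcases Nat.eq_zero_or_pos a with rfl | ha
    · exact lt_two_pow_of_le ((inputStore_arr_zero_le G blk w q).trans (by omega))
    · by_cases h : 4 ≤ a ∨ n ≤ q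
      · rw [inputStore_arr_of_le G blk w ha.ne' h]; positivity
      · push Not at h
        have hs := size_le_inputLength blk w ⟨q, h.2⟩
        obtain rfl | rfl | rfl : a = 1 ∨ a = 2 ∨ a = 3 := by omega
        · rw [inputStore_arr_one G blk w ⟨q, h.2⟩]; exact lt_two_pow_of_size_le (by omega)
        · rw [inputStore_arr_two G blk w ⟨q, h.2⟩]; exact lt_two_pow_of_size_le (by omega)
        · rw [inputStore_arr_three G blk w ⟨q, h.2⟩]; exact lt_two_pow_of_size_le (by omega)

/-- The bit lengths of the denominators add up to at most the input length, so passing to a common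
denominator keeps all numbers polynomially long. -/
theorem prod_den_le {j : ℕ} (hj : j ≤ n) :
    ∏ i ∈ range j, (inputStore G blk w).arr 3 i ≤ 2 ^ inputLength blk w := by
  calc ∏ i ∈ range j, (inputStore G blk w).arr 3 i
      ≤ ∏ i ∈ range j, 2 ^ Nat.size ((inputStore G blk w).arr 3 i) :=
        prod_le_prod' fun i _ => (Nat.lt_size_self _).le
    _ = 2 ^ ∑ i ∈ range j, Nat.size ((inputStore G blk w).arr 3 i) := prod_pow_eq_pow_sum ..
    _ ≤ 2 ^ inputLength blk w := by
      refine Nat.pow_le_pow_right (by norm_num) ?_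
      calc ∑ i ∈ range j, Nat.size ((inputStore G blk w).arr 3 i)
          ≤ ∑ i ∈ range n, Nat.size ((inputStore G blk w).arr 3 i) :=
            sum_le_sum_of_subset (range_subset_range.2 hj)
        _ = ∑ v : Fin n, Nat.size (w v).den := by
            rw [sum_range]; simp only [inputStore_arr_three]
        _ ≤ ∑ v, (Nat.size (blk v).val + Nat.size (w v).num + Nat.size (w v).den) :=
            sum_le_sum fun v _ => Nat.le_add_left _ _
        _ ≤ _ := Nat.le_add_left _ _

theorem intWeight_le (q : ℕ) :
    intWeight n ((inputStore G blk w).arr 2) ((inputStore G blk w).arr 3) q ≤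
      2 ^ (2 * inputLength blk w) := by
  unfold intWeight
  split_ifs with hq
  · rw [two_mul, pow_add]
    refine Nat.mul_le_mul ?_ ((Nat.div_le_self _ _).trans (prod_den_le G blk w le_rfl))
    rw [inputStore_arr_two G blk w ⟨q, hq⟩]
    have := size_le_inputLength blk w ⟨q, hq⟩
    exact (lt_two_pow_of_size_le (by omega)).le
  · exact Nat.zero_le _

theorem prod_den_pos : 0 < ∏ i ∈ range n, (inputStore G blk w).arr 3 i :=
  prod_pos fun i hi => by
    rw [inputStore_arr_three G blk w ⟨i, mem_range.1 hi⟩]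
    exact NNRat.den_pos _

theorem cast_intWeight (v : Fin n) :
    (intWeight n ((inputStore G blk w).arr 2) ((inputStore G blk w).arr 3) v : ℝ) =
      (∏ i ∈ range n, (inputStore G blk w).arr 3 i : ℕ) * (w v : ℝ) := by
  rw [intWeight, if_pos v.2, Nat.cast_mul, Nat.cast_div (dvd_prod_of_mem _ (mem_range.2 v.2)),
    inputStore_arr_two, inputStore_arr_three, NNRat.cast_def]
  · ring
  · rw [inputStore_arr_three]
    exact_mod_cast NNRat.den_ne_zero _

end Input

/-- A bound for the bit lengths of the numbers in the course of the computation. -/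
def sizeBound (c L : ℕ) : ℕ := 3 * L + (2 * c + 12) * L + 32 * L ^ (c + 1) + 4 * L ^ (2 * c) + 1

theorem probHaltsWithin_program (c : ℕ) {n l b : ℕ} (G : SimpleGraph (Fin n))
    [DecidableRel G.Adj] (blk : Fin n → Fin l) (w : Fin n → ℚ≥0) (hn : 0 < n) (hb0 : 0 < b)
    (hb : ∀ i, (univ.filter fun v => blk v = i).card = b) {κ : ℝ}
    (hκ : IsRate G.maxDegree b κ) {t : ℕ}
    (ht : (Cmd.program c).timeBound (sizeBound c (inputLength blk w)) ≤ t) :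
    ENNReal.ofReal (1 - ((n : ℝ) ^ c)⁻¹) ≤
      probHaltsWithin (Cmd.program c) (inputStore G blk w) t fun s =>
        IsIndepTransversal G blk (outputSet n s) ∧
        ∑ v ∈ outputSet n s, (w v : ℝ) ≤ (1 + ((n : ℝ) ^ c)⁻¹) * (κ * ∑ v, (w v : ℝ)) := by
  classical
  set L := inputLength blk w with hL
  set X := sizeBound c L with hX
  set s₀ := inputStore G blk w with hs₀
  set k := (2 * c + 12) * n with hk
  set m := listSize G.maxDegree with hmD
  set W := intWeight n (s₀.arr 2) (s₀.arr 3) with hW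
  set T := 32 * n ^ (c + 1) with hT
  set R := 4 * n ^ (2 * c) with hR
  have hnL : n ≤ L := le_inputLength blk w
  have hXdef : X = 3 * L + (2 * c + 12) * L + 32 * L ^ (c + 1) + 4 * L ^ (2 * c) + 1 := rfl
  have hln : l ≤ n := by
    have hsurj : Function.Surjective blk := fun i => by
      obtain ⟨v, hv⟩ := card_pos.1 ((hb i).symm ▸ hb0)
      exact ⟨v, (mem_filter.1 hv).2⟩
    simpa using Fintype.card_le_of_surjective blk hsurj
  have hbn : b ≤ n := by
    rw [← hb (blk ⟨0, hn⟩)]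
    exact (card_le_univ _).trans (Fintype.card_fin n).le
  have hm : m ≤ b := hκ.size_le
  have hm0 : 0 < m := listSize_pos _
  have hB : ∀ v : Fin n, s₀.arr 1 v = blk v := inputStore_arr_one G blk w
  have hadj : ∀ u v : Fin n, s₀.arr 0 (u * n + v) ≠ 0 ↔ G.Adj u v := fun u v => by
    rw [hs₀, inputStore_arr_zero]; simp
  set d : ℝ := ((∏ i ∈ range n, s₀.arr 3 i : ℕ) : ℝ) with hd
  have hd0 : 0 < d := Nat.cast_pos.2 (prod_den_pos G blk w)
  have hWw : ∀ v : Fin n, (W v : ℝ) = d * (w v : ℝ) := cast_intWeight G blk w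
  set 𝓡 := ramResampler (W := W) k hn hB hb hbn hm0 hm hadj with h𝓡
  have hview := ramResampler_view_emptyState (W := W) (k := k) hn hB hb hbn hm0 hm hadj
  have hprob := one_sub_le_listAvg_exists (W := W) hn hB hb hbn hm0 hm hadj
    (c := c) (w := fun v => (w v : ℝ)) hκ (fun v => G.degree_le_maxDegree v) hmD
    (fun v => NNRat.cast_nonneg _) (fun u v hv hu huv => by
      -- The integral weights are the given ones multiplied by d > 0, so both orders agree and lower
      -- ranks are lighter.
      by_contra! h
      have hlt : W u < W v := by
        have : (W u : ℝ) < W v := by rw [hWw, hWw]; exact mul_lt_mul_of_pos_left h hd0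
        exact_mod_cast this
      have := rank_lt_rank hB huv (Or.inl hlt)
      omega) hln hk
  refine ofReal_le_probHaltsWithin (inputStore_bounded G blk w (X := X) (by omega)) ht
    (fun τ hτ hF => ?_) hprob
  have hpow1 : n ^ (c + 1) ≤ L ^ (c + 1) := Nat.pow_le_pow_left hnL _
  have hpow2 : n ^ (2 * c) ≤ L ^ (2 * c) := Nat.pow_le_pow_left hnL _
  have hmulL : (2 * c + 12) * n ≤ (2 * c + 12) * L := Nat.mul_le_mul_left _ hnL
  have hYX : 2 ^ (2 * L) < 2 ^ X := Nat.pow_lt_pow_right (by norm_num) (by omega)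
  -- The sum of l integral weights must fit into a word: each is at most 2^(2L) and l < 2ᴸ, hence
  -- the term 3L in `sizeBound`.
  have hlYX : l * 2 ^ (2 * L) < 2 ^ X := by
    calc l * 2 ^ (2 * L) < 2 ^ L * 2 ^ (2 * L) :=
          Nat.mul_lt_mul_of_pos_right (lt_two_pow_of_le (hln.trans hnL)) (by positivity)
      _ = 2 ^ (3 * L) := by rw [← pow_add]; congr 1; ring
      _ ≤ 2 ^ X := Nat.pow_le_pow_right (by norm_num) (by omega)
  refine wp_program c (n := n) (l := l) (D := G.maxDegree) (Y := 2 ^ (2 * L)) (W := W)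
    (by omega) hn rfl rfl hk (by omega) (by omega) (by omega) (by omega) (by omega) (by omega)
    (fun j hj => (prod_den_le G blk w hj).trans_lt
      (Nat.pow_lt_pow_right (by norm_num) (by omega))) rfl (intWeight_le G blk w) hYX hlYX
    (injective_mul_add_rank hB hb hbn) (inputStore_arr_zero_le G blk w)
    (sup_sum_inputStore G blk w)
    (fun a ha q => inputStore_arr_of_le G blk w (by omega) (Or.inl ha)) hτ fun s' τ' hs' => ?_
  have htrial : ∀ i, trialAt n l m T (s₀.arr 0) (tableEntry n (s₀.arr 1) W) τ i =
      (𝓡.run (emptyState n) ((τ.drop (i * T)).take T)).1 := fun i =>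
    (ramResampler_run hn hB hb hbn hm0 hm hadj _).symm
  obtain ⟨i, hi, _, rfl, hfin, hwt⟩ := hF
  have hfin' := (ramResampler_sel_eq_none_iff hn hB hb hbn hm0 hm hadj _).1 hfin
  -- Run i succeeds, but the output comes from some finished run j, which is at least as light.
  obtain ⟨best, ⟨j, hj, hfj, hbest, hmin⟩, hout⟩ := hs' ⟨i, hi, (htrial i).symm ▸ hfin'⟩
  rw [htrial] at hfj
  have hle := hmin i hi ((htrial i).symm ▸ hfin')
  rw [htrial, htrial] at hle
  have hle' := (Nat.cast_le (α := ℝ)).2 hle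
  rw [totalWeight_eq hn hB hb hbn hm0 hm hadj hfj hWw (k := k),
    totalWeight_eq hn hB hb hbn hm0 hm hadj hfin' hWw (k := k), mul_le_mul_iff_right₀ hd0] at hle'
  have hset : outputSet n s' = 𝓡.chosen (𝓡.run (emptyState n) ((τ.drop (j * T)).take T)) := by
    ext v
    rw [mem_chosen_iff hn hB hb hbn hm0 hm hadj hfj, outputSet, mem_filter, hout]
    simp only [mem_univ, true_and]
    refine exists_congr fun q => and_congr_right fun hq => ?_
    rw [hbest q hq, htrial]
  rw [hset]
  refine ⟨𝓡.isIndepTransversal_chosen hview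
    ((ramResampler_sel_eq_none_iff hn hB hb hbn hm0 hm hadj _).2 hfj), ?_⟩
  rw [𝓡.sum_chosen hview]
  exact hle'.trans hwt

theorem exists_polynomial_program (c : ℕ) : ∃ p : Polynomial ℕ,
    ∀ L, (Cmd.program c).timeBound (sizeBound c L) = p.eval L := by
  obtain ⟨p, hp⟩ := Cmd.exists_polynomial_timeBound (Cmd.program c)
  refine ⟨p.comp (3 * .X + (2 * .C c + 12) * .X + 32 * .X ^ (c + 1) + 4 * .X ^ (2 * c) + 1),
    fun L => ?_⟩
  rw [hp, Polynomial.eval_comp]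
  congr 1
  simp [sizeBound]

end RandRAM

theorem theorem4p4 :
    -- existence, for arbitrary nonnegative real weights
    (∀ (V : Type*) (ι : Type*) [Fintype V] [DecidableEq V] [DecidableEq ι]
      (G : SimpleGraph V) [DecidableRel G.Adj] (blk : V → ι) (b : ℕ) (w : V → ℝ),
      0 < b → (∀ i, (Finset.univ.filter fun v => blk v = i).card = b) → (∀ v, 0 ≤ w v) →
      ((4 * G.maxDegree ≤ b → b ≤ 8 * G.maxDegree →
        ∃ I : Finset V, IsIndepTransversal G blk I ∧
          ∑ v ∈ I, w v ≤ (∑ v, w v) *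
            (2 / ((b : ℝ) + 4 * √(((b : ℝ) - 4 * G.maxDegree) * G.maxDegree)))) ∧
       (8 * G.maxDegree ≤ b →
        ∃ I : Finset V, IsIndepTransversal G blk I ∧
          ∑ v ∈ I, w v ≤ (∑ v, w v) / b))) ∧
    -- randomized polynomial-time algorithm, for nonnegative rational weights
    (∀ c : ℕ, ∃ (P : RandRAM.Cmd) (p : Polynomial ℕ),
      ∀ (n l b : ℕ) (G : SimpleGraph (Fin n)) [DecidableRel G.Adj] (blk : Fin n → Fin l)
        (w : Fin n → ℚ≥0),
      0 < n → 0 < b → (∀ i, (Finset.univ.filter fun v => blk v = i).card = b) →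
      ((4 * G.maxDegree ≤ b → b ≤ 8 * G.maxDegree →
        ENNReal.ofReal (1 - ((n : ℝ) ^ c)⁻¹) ≤
          RandRAM.probHaltsWithin P (inputStore G blk w) (p.eval (inputLength blk w)) fun s =>
            IsIndepTransversal G blk (outputSet n s) ∧
            ∑ v ∈ outputSet n s, (w v : ℝ) ≤ (1 + ((n : ℝ) ^ c)⁻¹) * ((∑ v, (w v : ℝ)) *
              (2 / ((b : ℝ) + 4 * √(((b : ℝ) - 4 * G.maxDegree) * G.maxDegree))))) ∧
       (8 * G.maxDegree ≤ b →
        ENNReal.ofReal (1 - ((n : ℝ) ^ c)⁻¹) ≤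
          RandRAM.probHaltsWithin P (inputStore G blk w) (p.eval (inputLength blk w)) fun s =>
            IsIndepTransversal G blk (outputSet n s) ∧
            ∑ v ∈ outputSet n s, (w v : ℝ) ≤
              (1 + ((n : ℝ) ^ c)⁻¹) * ((∑ v, (w v : ℝ)) / b)))) := by
  refine ⟨?_, fun c => ?_⟩
  · intro V ι _ _ _ G _ blk b w hb0 hb hw
    refine ⟨fun h1 h2 => ?_, fun h => ?_⟩
    · obtain ⟨I, hI, hIw⟩ := LazyResampling.exists_isIndepTransversal G blk hb0 hb hw
        (LazyResampling.isRate_of_le hb0 h1 h2)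
      exact ⟨I, hI, by rwa [mul_comm]⟩
    · obtain ⟨I, hI, hIw⟩ := LazyResampling.exists_isIndepTransversal G blk hb0 hb hw
        (LazyResampling.isRate_inv hb0 h)
      exact ⟨I, hI, by rwa [div_eq_mul_one_div, mul_comm]⟩
  · obtain ⟨p, hp⟩ := RandRAM.exists_polynomial_program c
    refine ⟨RandRAM.Cmd.program c, p, fun n l b G _ blk w hn hb0 hb => ⟨fun h1 h2 => ?_, fun h => ?_⟩⟩
    · rw [mul_comm (∑ v, (w v : ℝ))]
      exact RandRAM.probHaltsWithin_program c G blk w hn hb0 hb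
        (LazyResampling.isRate_of_le hb0 h1 h2) (hp _).le
    · rw [div_eq_mul_one_div, mul_comm (∑ v, (w v : ℝ))]
      exact RandRAM.probHaltsWithin_program c G blk w hn hb0 hb
        (LazyResampling.isRate_inv hb0 h) (hp _).le
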